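/- \textbf{Theorem.} Let $n,p,q$ be non-negative integers and let $\Sigma$ be a symmetric positive definite $p\times p$ real matrix. For each $\theta\in\mathbb R^{p\times q}$ let $P_\theta$ be a probability measure, with expectation $E_\theta$, under which the observed random matrices $X$ ($p\times q$) and $S$ ($p\times p$) are independent, $X\sim N_{p\times q}(\theta,\Sigma\otimes I_q)$, and $S=Y^{\top}Y$ for some random matrix $Y\sim N_{nq\times p}(0,I_{nq}\otimes(\Sigma/q))$. Here $U\sim N_{k\times l}(M,V\otimes W)$ means that the entries of the $k\times l$ matrix $U$ are jointly Gaussian with $E[U_{ij}]=M_{ij}$ and $\operatorname{Cov}(U_{ij},U_{i'j'})=V_{ii'}W_{jj'}$. Let $S^{+}$ be the Moore--Penrose inverse of $S$, $R=\operatorname{rank}(S)$ and $F=\operatorname{tr}(X^{\top}S^{+}X)$, and suppose that $P_\theta(qR>2)=1$ for all $\theta$. Put $$b=\frac{2\,(q\min(nq,p)-2)}{nq+p-2\min(nq,p)+3},$$ and let $r:(0,\infty)\to\mathbb R$ be differentiable, non-decreasing, with bounded derivative and $0\le r\le b$. Consider the estimators $$\delta_r(X,S)=\Big(I_p-\frac{r(F)}{F}SS^{+}\Big)X\quad(\text{set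 equal to } X \text{ where } F=0),\qquad \delta^0(X,S)=X,$$ the latter being the maximum likelihood estimator of $\theta$, and the loss $L(\theta,\delta)=\operatorname{tr}\big((\delta-\theta)^{\top}\Sigma^{-1}(\delta-\theta)\big)$. Then $\delta_r$ dominates $\delta^0$, that is, $$E_\theta\big[L(\theta,\delta_r(X,S))\big]\le E_\theta\big[L(\theta,\delta^0(X,S))\big]\qquad\text{for every }\theta\in\mathbb R^{p\times q}.$$ Moreover, the inequality is strict for at least one $\theta$, except in the degenerate cases where $r\equiv0$ on $(0,\infty)$, or where $q=1$ and $r\equiv b$ on $(0,\infty)$. -/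

import Mathlib

open MeasureTheory ProbabilityTheory
open scoped Matrix Kronecker ENNReal

/-! ### The Moore–Penrose inverse of a real matrix -/

/-- `B` satisfies the four Penrose equations for the real matrix `A`. -/
structure IsMoorePenrose {m n : Type*} [Fintype m] [Fintype n]
    (A : Matrix m n ℝ) (B : Matrix n m ℝ) : Prop where
  mul_mul_left : A * B * A = A
  mul_mul_right : B * A * B = B
  symm_left : (A * B)ᵀ = A * B
  symm_right : (B * A)ᵀ = B * A

/-- The Penrose equations have at most one solution. -/
theorem IsMoorePenrose.unique {m n : Type*} [Fintype m] [Fintype n]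
    {A : Matrix m n ℝ} {B C : Matrix n m ℝ}
    (hB : IsMoorePenrose A B) (hC : IsMoorePenrose A C) : B = C := by
  have h1 : A * B = A * C := by
    calc A * B = (A * B)ᵀ := hB.symm_left.symm
      _ = (A * C * A * B)ᵀ := by rw [hC.mul_mul_left]
      _ = (A * B)ᵀ * (A * C)ᵀ := by rw [← Matrix.transpose_mul, Matrix.mul_assoc (A * C)]
      _ = A * B * A * C := by rw [hB.symm_left, hC.symm_left, ← Matrix.mul_assoc]
      _ = A * C := by rw [hB.mul_mul_left]
  have h2 : B * A = C * A := by
    calc B * A = (B * A)ᵀ := hB.symm_right.symm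
      _ = (B * (A * C * A))ᵀ := by rw [hC.mul_mul_left]
      _ = (C * A)ᵀ * (B * A)ᵀ := by
          rw [← Matrix.transpose_mul]; simp only [Matrix.mul_assoc]
      _ = C * (A * B * A) := by
          rw [hB.symm_right, hC.symm_right]; simp only [Matrix.mul_assoc]
      _ = C * A := by rw [hB.mul_mul_left]
  calc B = B * A * B := hB.mul_mul_right.symm
    _ = C * A * B := by rw [h2]
    _ = C * A * C := by rw [Matrix.mul_assoc, h1, ← Matrix.mul_assoc]
    _ = C := hC.mul_mul_right

/-- A symmetric real matrix has a symmetric Moore–Penrose inverse. -/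
theorem exists_isMoorePenrose_of_symm {n : Type*} [Fintype n] [DecidableEq n]
    (A : Matrix n n ℝ) (hA : Aᵀ = A) : ∃ B, IsMoorePenrose A B ∧ Bᵀ = B := by
  have hH : A.IsHermitian := by
    rw [Matrix.IsHermitian, Matrix.conjTranspose_eq_transpose_of_trivial, hA]
  have hsa : IsSelfAdjoint A := hH
  have hfin : (spectrum ℝ A).Finite := Matrix.finite_real_spectrum
  have hc : ∀ f : ℝ → ℝ, ContinuousOn f (spectrum ℝ A) := fun f => hfin.continuousOn f
  have key : A * cfc (fun x : ℝ => x⁻¹) A = cfc (fun x : ℝ => x * x⁻¹) A := by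
    conv_lhs => rw [← cfc_id' ℝ A]
    rw [cfc_id' ℝ A, cfc_mul _ _ A (hc _) (hc _), cfc_id' ℝ A]
  have key' : cfc (fun x : ℝ => x⁻¹) A * A = cfc (fun x : ℝ => x * x⁻¹) A := by
    rw [← key]
    nth_rewrite 2 [← cfc_id' ℝ A]
    nth_rewrite 3 [← cfc_id' ℝ A]
    exact cfc_commute_cfc _ _ A
  have tr : ∀ f : ℝ → ℝ, (cfc f A)ᵀ = cfc f A := fun f => by
    have : IsSelfAdjoint (cfc f A) := cfc_predicate f A
    rw [← Matrix.conjTranspose_eq_transpose_of_trivial]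
    exact this
  refine ⟨cfc (fun x : ℝ => x⁻¹) A, ⟨?_, ?_, ?_, ?_⟩, tr _⟩
  · rw [key]
    have : cfc (fun x : ℝ => x * x⁻¹) A * cfc (fun x : ℝ => x) A = cfc (fun x : ℝ => x) A := by
      rw [← cfc_mul _ _ A (hc _) (hc _)]
      congr 1; funext x
      exact mul_inv_mul_cancel x
    rwa [cfc_id' ℝ A] at this
  · rw [key', ← cfc_mul _ _ A (hc _) (hc _)]
    congr 1; funext x
    by_cases h : x = 0 <;> simp [h]
  · rw [key, tr]
  · rw [key', tr]

/-- Every real matrix has a Moore–Penrose inverse. -/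
theorem exists_isMoorePenrose {m n : Type*} [Fintype m] [Fintype n]
    (A : Matrix m n ℝ) : ∃ B, IsMoorePenrose A B := by
  classical
  obtain ⟨C, hC, hCs⟩ := exists_isMoorePenrose_of_symm (Aᵀ * A) (by
    rw [Matrix.transpose_mul, Matrix.transpose_transpose])
  have h0 : A * (C * (Aᵀ * A)) = A := by
    rw [← sub_eq_zero, ← Matrix.conjTranspose_mul_self_eq_zero,
      Matrix.conjTranspose_eq_transpose_of_trivial, Matrix.mul_sub]
    have e : (A * (C * (Aᵀ * A)) - A)ᵀ * A = 0 := by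
      rw [Matrix.transpose_sub, Matrix.transpose_mul, hC.symm_right, Matrix.sub_mul,
        sub_eq_zero, Matrix.mul_assoc (C * (Aᵀ * A)), ← hC.symm_right, Matrix.transpose_mul, hCs,
        Matrix.transpose_mul, Matrix.transpose_transpose, hC.mul_mul_left]
    rw [← Matrix.mul_assoc, e, Matrix.zero_mul, sub_zero]
  refine ⟨C * Aᵀ, ⟨?_, ?_, ?_, ?_⟩⟩
  · rw [Matrix.mul_assoc, Matrix.mul_assoc C]; exact h0
  · have := hC.mul_mul_right
    calc C * Aᵀ * A * (C * Aᵀ) = (C * (Aᵀ * A) * C) * Aᵀ := by simp only [Matrix.mul_assoc]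
      _ = C * Aᵀ := by rw [this]
  · simp [Matrix.transpose_mul, hCs, Matrix.mul_assoc]
  · have := hC.symm_right
    simpa only [Matrix.mul_assoc] using this

/-- The Moore–Penrose inverse `A⁺` of a real matrix. -/
noncomputable def moorePenrose {m n : Type*} [Fintype m] [Fintype n]
    (A : Matrix m n ℝ) : Matrix n m ℝ :=
  (exists_isMoorePenrose A).choose

theorem moorePenrose_spec {m n : Type*} [Fintype m] [Fintype n]
    (A : Matrix m n ℝ) : IsMoorePenrose A (moorePenrose A) :=
  (exists_isMoorePenrose A).choose_spec

/-! ### Matrix normal distributions and the statistical model -/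

/-- The entries of a matrix as a Euclidean vector indexed by pairs (row, column). -/
noncomputable def entryVec {m n : Type*} (A : Matrix m n ℝ) : EuclideanSpace ℝ (m × n) :=
  WithLp.toLp 2 fun ij => A ij.1 ij.2

/-- `U ∼ N_{m × n}(M, V ⊗ W)` under `P`: the entries of `U` are jointly Gaussian with mean `M` and
`Cov(U i j, U k l) = V i k * W j l`. -/
def IsMatrixNormal {Ω m n : Type*} [MeasurableSpace Ω] [Fintype m] [Fintype n]
    [DecidableEq m] [DecidableEq n] (P : Measure Ω) (U : Ω → Matrix m n ℝ)
    (M : Matrix m n ℝ) (V : Matrix m m ℝ) (W : Matrix n n ℝ) : Prop :=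
  HasLaw (fun ω => entryVec (U ω)) (multivariateGaussian (entryVec M) (V ⊗ₖ W)) P

/-- The model for the observed pair `(X, S)` under `P`, with mean `θ` and covariance `Sig`:
`X ∼ N_{p × q}(θ, Sig ⊗ I_q)` and `S = Yᵀ Y` are independent, where
`Y ∼ N_{nq × p}(0, I_{nq} ⊗ (Sig / q))`. -/
structure GaussianModel {Ω : Type*} [MeasurableSpace Ω] {p q : ℕ} (n : ℕ) (P : Measure Ω)
    (X : Ω → Matrix (Fin p) (Fin q) ℝ) (S : Ω → Matrix (Fin p) (Fin p) ℝ)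
    (θ : Matrix (Fin p) (Fin q) ℝ) (Sig : Matrix (Fin p) (Fin p) ℝ) : Prop where
  law_X : IsMatrixNormal P X θ Sig (1 : Matrix (Fin q) (Fin q) ℝ)
  law_S : ∃ Y : Ω → Matrix (Fin (n * q)) (Fin p) ℝ,
    IsMatrixNormal P Y 0 (1 : Matrix (Fin (n * q)) (Fin (n * q)) ℝ) ((q : ℝ)⁻¹ • Sig) ∧
      ∀ ω, S ω = (Y ω)ᵀ * Y ω
  indep : IndepFun (fun ω => entryVec (X ω)) (fun ω => entryVec (S ω)) P

/-! ### Estimators, risk and domination -/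

/-- The statistic `F = tr(Xᵀ S⁺ X)`. -/
noncomputable def statF {p q : ℕ} (X : Matrix (Fin p) (Fin q) ℝ)
    (S : Matrix (Fin p) (Fin p) ℝ) : ℝ :=
  (Xᵀ * moorePenrose S * X).trace

/-- The James–Stein type estimator `δ_r(X, S) = (I_p - (r(F) / F) S S⁺) X`. -/
noncomputable def jamesStein {p q : ℕ} (r : ℝ → ℝ) (X : Matrix (Fin p) (Fin q) ℝ)
    (S : Matrix (Fin p) (Fin p) ℝ) : Matrix (Fin p) (Fin q) ℝ :=
  (1 - (r (statF X S) / statF X S) • (S * moorePenrose S)) * X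

/-- The maximum likelihood estimator `δ⁰(X, S) = X`. -/
def mle {p q : ℕ} (X : Matrix (Fin p) (Fin q) ℝ) (_S : Matrix (Fin p) (Fin p) ℝ) :
    Matrix (Fin p) (Fin q) ℝ :=
  X

/-- The invariant quadratic loss `tr((δ - θ)ᵀ Sig⁻¹ (δ - θ))`. -/
noncomputable def quadLoss {p q : ℕ} (Sig : Matrix (Fin p) (Fin p) ℝ)
    (θ δ : Matrix (Fin p) (Fin q) ℝ) : ℝ :=
  ((δ - θ)ᵀ * Sig⁻¹ * (δ - θ)).trace

/-- The risk of the estimator `δ` under `P` at `θ`: the expectation, in `[0, ∞]`, of the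
(nonnegative) quadratic loss. -/
noncomputable def risk {Ω : Type*} [MeasurableSpace Ω] {p q : ℕ} (P : Measure Ω)
    (X : Ω → Matrix (Fin p) (Fin q) ℝ) (S : Ω → Matrix (Fin p) (Fin p) ℝ)
    (Sig : Matrix (Fin p) (Fin p) ℝ)
    (δ : Matrix (Fin p) (Fin q) ℝ → Matrix (Fin p) (Fin p) ℝ → Matrix (Fin p) (Fin q) ℝ)
    (θ : Matrix (Fin p) (Fin q) ℝ) : ℝ≥0∞ :=
  ∫⁻ ω, ENNReal.ofReal (quadLoss Sig θ (δ (X ω) (S ω))) ∂P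

/-!
The proof writes `S = Yᵀ Y` with `Y` Gaussian and independent of `X`, and integrates by parts in
`X` and in `Y`. Let `N = nq`, `m = min N p`, `c = N + p - 2m + 3`. By
`transpose_mul_self_mul_moorePenrose` and `moorePenrose_transpose_mul_self`, the estimator is
`X - w G` with `G = Y⁺ Y X` (`projField`), `w = r(F) / F` and `F = tr(Xᵀ Y⁺ (Y⁺)ᵀ X)` (`gramF`). In
the expansion of its loss (`quadLoss_sub_smul_projField`) there are two terms besides the loss of
`X`.

* The linear term `-2 w tr((X - θ)ᵀ Sig⁻¹ G)` becomes `-2 div_X (w G)` by Stein's lemma in `X`.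
* The quadratic term `w² tr(Gᵀ Sig⁻¹ G)` equals `tr(Sig⁻¹ Yᵀ (w² V))`, where
  `V = (Y⁺)ᵀ X Xᵀ Y⁺ Y` (`dualField`) satisfies `Yᵀ V = G Gᵀ`. By Stein's lemma in `Y` it becomes
  `q⁻¹ div_Y (w² V)`.

Here `div_X G = q m` and `div_Y V = (c - 4) F` (`sum_deriv_dualField`), the derivative of `F` along
`G` in `X` is `2 F`, and along `V` in `Y` it is `-2 T` with `0 ≤ T ≤ F²`. As `r` is nondecreasing,
`w(t) + t w'(t) ≥ 0`, and the sum of the two terms is at most minus the gain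
`w (2 (q m - 2) - c r(F) / q)` (`shrinkGain`). The bound `r ≤ b` makes the gain nonnegative.

The fields are singular at matrices `Y` of lower rank, and `w` may be singular at `F = 0`, so
Stein's lemma is applied to compactly supported `C¹` fields only, obtained by cutoffs
(`shrinkWeight`). Cutting off at large `Y` has a favourable sign, and cutting off at `‖X‖² ~ a` costs
`O(d / a)` when `Y` is cut off at `‖Y‖² ~ d`. Near matrices of lower rank the cutoff is a function
of `D ^ η`, where `D` (`gramDet`) is the smaller Gram determinant: as the derivative of `log D`
along `V` is `2 F`, the cost is `O(η)` times a bound for `w`. The function `r(t) / t` is replaced by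
`C¹` functions bounded by `b (k + 1)` that keep the monotonicity and the bound of `r`
(`exists_regularization`). With `η`, `a`, `d` depending suitably on `k`, the errors tend to `0`, and
Fatou's lemma gives the inequality with the gain as an explicit term
(`lintegral_quadLoss_add_shrinkGain_le`).

For strictness, outside the degenerate cases `r` takes a value in `(0, q b)`
(`exists_mem_Ioo_of_nondegenerate`). The gain is then positive on a nonempty open set, which the
Gaussian law charges, and the risk of `X` is finite.
-/

/-! ### Gaussian measures and Stein's lemma -/

open scoped RealInnerProductSpace in
/-- The standard Gaussian measure has density `(2π)^(-d/2) exp(-‖x‖²/2)`. -/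
theorem stdGaussian_eq_withDensity (E : Type*) [NormedAddCommGroup E] [InnerProductSpace ℝ E]
    [FiniteDimensional ℝ E] [MeasurableSpace E] [BorelSpace E] :
    stdGaussian E = (volume : Measure E).withDensity fun x => ENNReal.ofReal
      ((2 * Real.pi) ^ (-(Module.finrank ℝ E / 2 : ℝ)) * Real.exp (-(1 / 2) * ‖x‖ ^ 2)) := by
  set a : ℝ := (2 * Real.pi) ^ (-(Module.finrank ℝ E / 2 : ℝ)) with ha
  have ha0 : 0 < a := by positivity
  have hint : Integrable (fun x : E => a * Real.exp (-(1 / 2) * ‖x‖ ^ 2)) := by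
    have := (GaussianFourier.integrable_cexp_neg_mul_sq_norm_add (V := E)
      (b := 1 / 2) (by norm_num) 0 0).re
    refine (this.congr ?_).const_mul a
    filter_upwards with x
    have : (-(1 / 2 : ℂ) * (‖x‖ : ℂ) ^ 2 + 0 * ((⟪(0 : E), x⟫ : ℝ) : ℂ))
      = ((-(1 / 2) * ‖x‖ ^ 2 : ℝ) : ℂ) := by push_cast; ring
    rw [this, ← Complex.ofReal_exp]
    exact Complex.ofReal_re _
  have hfin : IsFiniteMeasure ((volume : Measure E).withDensity fun x => ENNReal.ofReal
      (a * Real.exp (-(1 / 2) * ‖x‖ ^ 2))) := isFiniteMeasure_withDensity_ofReal hint.2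
  apply Measure.ext_of_charFun
  ext t
  rw [charFun_stdGaussian, charFun_apply,
    integral_withDensity_eq_integral_toReal_smul (by fun_prop) (by simp)]
  have key := GaussianFourier.integral_cexp_neg_mul_sq_norm_add (V := E)
      (b := 1 / 2) (by norm_num) Complex.I t
  have e : ∀ x : E, (ENNReal.ofReal (a * Real.exp (-(1 / 2) * ‖x‖ ^ 2))).toReal •
      Complex.exp (⟪x, t⟫ * Complex.I)
      = (a : ℂ) * Complex.exp (-(1 / 2) * ‖x‖ ^ 2 + Complex.I * ⟪t, x⟫) := by
    intro x
    rw [ENNReal.toReal_ofReal (by positivity), Complex.exp_add, real_inner_comm, Complex.real_smul]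
    push_cast
    rw [mul_comm Complex.I]
    ring
  simp_rw [e]
  rw [integral_const_mul, key, ← mul_assoc]
  have : (a : ℂ) * ((Real.pi : ℂ) / (1 / 2)) ^ ((Module.finrank ℝ E : ℂ) / 2) = 1 := by
    rw [show (Real.pi : ℂ) / (1 / 2) = ((2 * Real.pi : ℝ) : ℂ) by push_cast; ring,
      show (Module.finrank ℝ E : ℂ) / 2 = ((Module.finrank ℝ E / 2 : ℝ) : ℂ) by push_cast; rfl,
      ← Complex.ofReal_cpow (by positivity), ← Complex.ofReal_mul, ha,
      ← Real.rpow_add (by positivity)]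
    simp
  rw [this, one_mul]
  congr 1
  rw [Complex.I_sq]
  ring

open scoped RealInnerProductSpace in
/-- **Stein's lemma** for the standard Gaussian measure. -/
theorem integral_inner_mul_stdGaussian {E : Type*} [NormedAddCommGroup E] [InnerProductSpace ℝ E]
    [FiniteDimensional ℝ E] [MeasurableSpace E] [BorelSpace E] {f : E → ℝ}
    (hf : ContDiff ℝ 1 f) (hc : HasCompactSupport f) (v : E) :
    ∫ x, ⟪v, x⟫ * f x ∂(stdGaussian E) = ∫ x, fderiv ℝ f x v ∂(stdGaussian E) := by
  have hf' : Continuous fun x => fderiv ℝ f x v :=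
    (hf.continuous_fderiv one_ne_zero).clm_apply continuous_const
  have hc' : HasCompactSupport fun x => fderiv ℝ f x v := hc.fderiv_apply (𝕜 := ℝ) v
  set a : ℝ := (2 * Real.pi) ^ (-(Module.finrank ℝ E / 2 : ℝ)) with ha
  set w : E → ℝ := fun x => a * Real.exp (-(1 / 2) * ‖x‖ ^ 2) with hw
  have hwd : ∀ x, HasFDerivAt w (-(w x) • innerSL ℝ x) x := by
    intro x
    have h1 : HasFDerivAt (fun x : E => ‖x‖ ^ 2) (2 • innerSL ℝ x) x :=
      (hasStrictFDerivAt_norm_sq x).hasFDerivAt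
    have := ((h1.const_mul (-(1 / 2))).exp).const_mul a
    refine this.congr_fderiv ?_
    ext y
    simp [hw]
    ring
  have hwc : Continuous w := by fun_prop
  have conv : ∀ g : E → ℝ, ∫ x, g x ∂(stdGaussian E) = ∫ x, g x * w x := by
    intro g
    rw [stdGaussian_eq_withDensity,
      integral_withDensity_eq_integral_toReal_smul (by fun_prop) (by simp)]
    refine integral_congr_ae (.of_forall fun x => ?_)
    simp only [smul_eq_mul]
    rw [ENNReal.toReal_ofReal (by positivity), mul_comm]
  rw [conv, conv]
  have h2 : Continuous fun x => f x * (-(w x) • innerSL ℝ x) v := by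
    refine hf.continuous.mul ?_
    change Continuous fun x => -(w x) * ⟪x, v⟫
    fun_prop
  have ibp := integral_bilinear_hasFDerivAt_right_eq_neg_left_of_integrable
    (μ := (volume : Measure E)) (v := v) (B := ContinuousLinearMap.mul ℝ ℝ)
    ((hf'.mul hwc).integrable_of_hasCompactSupport hc'.mul_right)
    (h2.integrable_of_hasCompactSupport hc.mul_right)
    ((hf.continuous.mul hwc).integrable_of_hasCompactSupport hc.mul_right)
    (fun x _ => (hf.differentiable one_ne_zero x).hasFDerivAt) (fun x _ => hwd x)
  simp only [ContinuousLinearMap.mul_apply'] at ibp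
  rw [← neg_inj, ← ibp, ← integral_neg]
  refine integral_congr_ae (.of_forall fun x => ?_)
  simp [real_inner_comm]
  ring

open scoped MatrixOrder in
theorem toEuclideanCLM_sqrt_sqrt_apply {ι : Type*} [Fintype ι] [DecidableEq ι] {C : Matrix ι ι ℝ}
    (hC : C.PosSemidef) (x : EuclideanSpace ℝ ι) :
    Matrix.toEuclideanCLM (𝕜 := ℝ) (CFC.sqrt C) (Matrix.toEuclideanCLM (𝕜 := ℝ) (CFC.sqrt C) x)
      = Matrix.toEuclideanCLM (𝕜 := ℝ) C x := by
  rw [← mul_apply_eq_comp, ← map_mul, CFC.sqrt_mul_sqrt_self _ hC.nonneg]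

open scoped MatrixOrder in
theorem injective_toEuclideanCLM_sqrt {ι : Type*} [Fintype ι] [DecidableEq ι]
    {C : Matrix ι ι ℝ} (hC : C.PosDef) :
    Function.Injective (Matrix.toEuclideanCLM (𝕜 := ℝ) (CFC.sqrt C)) := by
  intro x y hxy
  have := congrArg (Matrix.toEuclideanCLM (𝕜 := ℝ) (CFC.sqrt C)) hxy
  simp only [toEuclideanCLM_sqrt_sqrt_apply hC.posSemidef] at this
  have h2 := congrArg (Matrix.toEuclideanCLM (𝕜 := ℝ) C⁻¹) this
  simp only [← mul_apply_eq_comp, ← map_mul] at h2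
  rw [Matrix.nonsing_inv_mul _ ((Matrix.isUnit_iff_isUnit_det _).1 hC.isUnit)] at h2
  simpa using h2

open scoped MatrixOrder in
theorem surjective_toEuclideanCLM_sqrt {ι : Type*} [Fintype ι] [DecidableEq ι]
    {C : Matrix ι ι ℝ} (hC : C.PosDef) :
    Function.Surjective (Matrix.toEuclideanCLM (𝕜 := ℝ) (CFC.sqrt C)) :=
  LinearMap.surjective_of_injective
    (f := (Matrix.toEuclideanCLM (𝕜 := ℝ) (CFC.sqrt C)).toLinearMap)
    (injective_toEuclideanCLM_sqrt hC)

open scoped RealInnerProductSpace MatrixOrder in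
/-- **Stein's lemma** for a nondegenerate multivariate Gaussian measure. -/
theorem integral_inner_sub_mul_multivariateGaussian {ι : Type*} [Fintype ι] [DecidableEq ι]
    {C : Matrix ι ι ℝ} (hC : C.PosDef) (m : EuclideanSpace ℝ ι) {f : EuclideanSpace ℝ ι → ℝ}
    (hf : ContDiff ℝ 1 f) (hc : HasCompactSupport f) (u : EuclideanSpace ℝ ι) :
    ∫ z, ⟪u, z - m⟫ * f z ∂(multivariateGaussian m C)
      = ∫ z, fderiv ℝ f z (Matrix.toEuclideanCLM (𝕜 := ℝ) C u) ∂(multivariateGaussian m C) := by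
  have hemb : Topology.IsClosedEmbedding
      fun x => m + Matrix.toEuclideanCLM (𝕜 := ℝ) (CFC.sqrt C) x :=
    (Homeomorph.addLeft m).isClosedEmbedding.comp
      (LinearMap.isClosedEmbedding_of_injective (f := (Matrix.toEuclideanCLM (𝕜 := ℝ)
        (CFC.sqrt C)).toLinearMap) (LinearMap.ker_eq_bot.2 (injective_toEuclideanCLM_sqrt hC)))
  have hf' : Continuous fun x => fderiv ℝ f x (Matrix.toEuclideanCLM (𝕜 := ℝ) C u) :=
    (hf.continuous_fderiv one_ne_zero).clm_apply continuous_const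
  set T := Matrix.toEuclideanCLM (𝕜 := ℝ) (CFC.sqrt C) with hT
  have hTT : T (T u) = Matrix.toEuclideanCLM (𝕜 := ℝ) C u :=
    toEuclideanCLM_sqrt_sqrt_apply hC.posSemidef u
  have hTsa : IsSelfAdjoint T := (CFC.sqrt_nonneg C).isSelfAdjoint.map _
  have hfd := hf.continuous
  rw [multivariateGaussian, ← hT, integral_map (by fun_prop)
    (Continuous.aestronglyMeasurable (by fun_prop)),
    integral_map (by fun_prop) hf'.aestronglyMeasurable]
  have h1 := integral_inner_mul_stdGaussian (f := fun x => f (m + T x))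
    (hf.comp (by fun_prop)) (hc.comp_isClosedEmbedding hemb) (T u)
  have e1 : ∀ x, ⟪T u, x⟫ = ⟪u, m + T x - m⟫ := by
    intro x
    rw [add_sub_cancel_left, ← ContinuousLinearMap.adjoint_inner_right, hTsa.adjoint_eq]
  have e2 : ∀ x, fderiv ℝ (fun x => f (m + T x)) x (T u)
      = fderiv ℝ f (m + T x) (Matrix.toEuclideanCLM (𝕜 := ℝ) C u) := by
    intro x
    have h : HasFDerivAt (fun x => m + T x) T x := T.hasFDerivAt.const_add m
    have := ((hf.differentiable one_ne_zero (m + T x)).hasFDerivAt.comp x h).fderiv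
    rw [show (fun x => f (m + T x)) = f ∘ fun x => m + T x from rfl, this]
    rw [ContinuousLinearMap.comp_apply, hTT]
  simp_rw [e1, e2] at h1
  exact h1

open scoped RealInnerProductSpace in
/-- **Stein's lemma** for the partial derivative in the coordinate `k`: the score is
`C⁻¹ (z - m)`. -/
theorem integral_inv_mulVec_mul_multivariateGaussian {ι : Type*} [Fintype ι] [DecidableEq ι]
    {C : Matrix ι ι ℝ} (hC : C.PosDef) (m : EuclideanSpace ℝ ι) {f : EuclideanSpace ℝ ι → ℝ}
    (hf : ContDiff ℝ 1 f) (hc : HasCompactSupport f) (k : ι) :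
    ∫ z, (C⁻¹ *ᵥ ⇑(z - m)) k * f z ∂(multivariateGaussian m C)
      = ∫ z, fderiv ℝ f z (EuclideanSpace.single k 1) ∂(multivariateGaussian m C) := by
  have hsymm : (C⁻¹)ᵀ = C⁻¹ := by
    rw [← Matrix.conjTranspose_eq_transpose_of_trivial]; exact hC.inv.isHermitian
  have h := integral_inner_sub_mul_multivariateGaussian hC m hf hc
    (Matrix.toEuclideanCLM (𝕜 := ℝ) C⁻¹ (EuclideanSpace.single k 1))
  rw [← mul_apply_eq_comp, ← map_mul,
    Matrix.mul_nonsing_inv _ ((Matrix.isUnit_iff_isUnit_det _).1 hC.isUnit)] at h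
  simp only [map_one, one_apply_eq_self] at h
  rw [← h]
  refine integral_congr_ae (.of_forall fun z => ?_)
  simp only
  congr 1
  rw [real_inner_comm, Matrix.inner_toEuclideanCLM]
  rw [Matrix.dotProduct_mulVec, ← Matrix.mulVec_transpose, hsymm]
  simp

open scoped MatrixOrder in
theorem multivariateGaussian_absolutelyContinuous {ι : Type*} [Fintype ι] [DecidableEq ι]
    {C : Matrix ι ι ℝ} (hC : C.PosDef) (m : EuclideanSpace ℝ ι) :
    multivariateGaussian m C ≪ volume := by
  set T := Matrix.toEuclideanCLM (𝕜 := ℝ) (CFC.sqrt C) with hT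
  have h1 : stdGaussian (EuclideanSpace ℝ ι) ≪ volume := by
    rw [stdGaussian_eq_withDensity]
    exact withDensity_absolutelyContinuous _ _
  have h2 : (volume : Measure (EuclideanSpace ℝ ι)).map T ≪ volume := by
    obtain ⟨c, -, hc⟩ := LinearMap.exists_map_addHaar_eq_smul_addHaar T.toLinearMap
      (volume : Measure (EuclideanSpace ℝ ι)) (volume : Measure (EuclideanSpace ℝ ι))
      (surjective_toEuclideanCLM_sqrt hC)
    change (volume : Measure (EuclideanSpace ℝ ι)).map T = _ at hc
    rw [hc]
    exact Measure.smul_absolutelyContinuous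
  have h3 : multivariateGaussian m C
      = ((stdGaussian (EuclideanSpace ℝ ι)).map T).map (fun x => m + x) := by
    rw [Measure.map_map (by fun_prop) (by fun_prop)]
    rfl
  rw [h3]
  have h4 := ((h1.map (f := T) (by fun_prop)).trans h2).map (f := fun x => m + x) (by fun_prop)
  rwa [map_add_left_eq_self volume] at h4

open scoped MatrixOrder in
theorem isOpenPosMeasure_multivariateGaussian {ι : Type*} [Fintype ι] [DecidableEq ι]
    {C : Matrix ι ι ℝ} (hC : C.PosDef) (m : EuclideanSpace ℝ ι) :
    (multivariateGaussian m C).IsOpenPosMeasure := by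
  have h1 : (volume : Measure (EuclideanSpace ℝ ι)) ≪ stdGaussian (EuclideanSpace ℝ ι) := by
    rw [stdGaussian_eq_withDensity]
    refine withDensity_absolutelyContinuous' (by fun_prop) (.of_forall fun x => ?_)
    have : (0 : ℝ) < (2 * Real.pi) ^ (-(Module.finrank ℝ (EuclideanSpace ℝ ι) / 2 : ℝ))
      * Real.exp (-(1 / 2) * ‖x‖ ^ 2) := by positivity
    simpa using this
  have := h1.isOpenPosMeasure
  refine Continuous.isOpenPosMeasure_map (by fun_prop) ?_
  intro z
  obtain ⟨x, hx⟩ := surjective_toEuclideanCLM_sqrt hC (z - m)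
  exact ⟨x, by simp [hx]⟩

/-- **Stein's lemma** in the first of two independent variables, the first of them Gaussian. -/
theorem integral_inv_mulVec_mul_prod_left {ι E : Type*} [Fintype ι] [DecidableEq ι]
    [NormedAddCommGroup E] [NormedSpace ℝ E] [MeasurableSpace E] [BorelSpace E]
    [SecondCountableTopology E]
    {C : Matrix ι ι ℝ} (hC : C.PosDef) (m : EuclideanSpace ℝ ι) (ν : Measure E)
    [IsFiniteMeasure ν] {f : EuclideanSpace ℝ ι × E → ℝ}
    (hf : ContDiff ℝ 1 f) (hc : HasCompactSupport f) (k : ι) :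
    ∫ z, (C⁻¹ *ᵥ ⇑(z.1 - m)) k * f z ∂((multivariateGaussian m C).prod ν)
      = ∫ z, fderiv ℝ f z (EuclideanSpace.single k 1, 0)
        ∂((multivariateGaussian m C).prod ν) := by
  have hfc := hf.continuous
  have h1 : Continuous fun z : EuclideanSpace ℝ ι × E => (C⁻¹ *ᵥ ⇑(z.1 - m)) k := by
    simp only [Matrix.mulVec, dotProduct]
    fun_prop
  have h2 : Continuous fun z => fderiv ℝ f z (EuclideanSpace.single k 1, 0) :=
    (hf.continuous_fderiv one_ne_zero).clm_apply continuous_const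
  have h3 : Integrable (fun z => (C⁻¹ *ᵥ ⇑(z.1 - m)) k * f z)
      ((multivariateGaussian m C).prod ν) :=
    (h1.mul hfc).integrable_of_hasCompactSupport hc.mul_left
  rw [integral_prod_symm _ h3,
    integral_prod_symm _ (h2.integrable_of_hasCompactSupport (hc.fderiv_apply (𝕜 := ℝ) _))]
  refine integral_congr_ae (.of_forall fun y => ?_)
  have hemb : Topology.IsClosedEmbedding fun x : EuclideanSpace ℝ ι => (x, y) :=
    ⟨isEmbedding_prodMkLeft y, by
      have : Set.range (fun x : EuclideanSpace ℝ ι => (x, y)) = {z | z.2 = y} := by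
        ext z; simp [Prod.ext_iff, eq_comm]
      rw [this]; exact isClosed_eq continuous_snd continuous_const⟩
  simp only
  rw [integral_inv_mulVec_mul_multivariateGaussian hC m (f := fun x => f (x, y))
    (hf.comp (by fun_prop)) (hc.comp_isClosedEmbedding hemb)]
  refine integral_congr_ae (.of_forall fun x => ?_)
  have h : HasFDerivAt (fun x : EuclideanSpace ℝ ι => (x, y))
      (ContinuousLinearMap.inl ℝ (EuclideanSpace ℝ ι) E) x := hasFDerivAt_prodMk_left x y
  have := ((hf.differentiable one_ne_zero (x, y)).hasFDerivAt.comp x h).fderiv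
  simp only
  rw [show (fun x => f (x, y)) = f ∘ fun x => (x, y) from rfl, this]
  simp

/-- **Stein's lemma** in the second of two independent variables, the second of them Gaussian. -/
theorem integral_inv_mulVec_mul_prod_right {ι E : Type*} [Fintype ι] [DecidableEq ι]
    [NormedAddCommGroup E] [NormedSpace ℝ E] [MeasurableSpace E] [BorelSpace E]
    [SecondCountableTopology E]
    {C : Matrix ι ι ℝ} (hC : C.PosDef) (m : EuclideanSpace ℝ ι) (ν : Measure E)
    [IsFiniteMeasure ν] {f : E × EuclideanSpace ℝ ι → ℝ}
    (hf : ContDiff ℝ 1 f) (hc : HasCompactSupport f) (k : ι) :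
    ∫ z, (C⁻¹ *ᵥ ⇑(z.2 - m)) k * f z ∂(ν.prod (multivariateGaussian m C))
      = ∫ z, fderiv ℝ f z (0, EuclideanSpace.single k 1)
        ∂(ν.prod (multivariateGaussian m C)) := by
  have h := integral_inv_mulVec_mul_prod_left hC m ν (f := fun z => f z.swap)
    (hf.comp (ContinuousLinearEquiv.prodComm ℝ (EuclideanSpace ℝ ι) E).contDiff)
    (hc.comp_homeomorph (Homeomorph.prodComm _ _)) k
  rw [← integral_prod_swap, ← integral_prod_swap (f := fun z =>
    fderiv ℝ f z (0, EuclideanSpace.single k 1))]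
  simp only [Prod.snd_swap]
  rw [h]
  refine integral_congr_ae (.of_forall fun z => ?_)
  let e := ContinuousLinearEquiv.prodComm ℝ (EuclideanSpace ℝ ι) E
  have := ((hf.differentiable one_ne_zero (e z)).hasFDerivAt.comp z e.hasFDerivAt).fderiv
  simp only
  rw [show (fun z : EuclideanSpace ℝ ι × E => f z.swap) = f ∘ e from rfl, this]
  rfl

/-! ### Differentiation of matrix-valued curves -/

/-- The entries of the matrix-valued curve `M` are differentiable at `t`, with the entries of `M'`
as derivatives. Working entrywise avoids the choice of a matrix norm. -/
def HasMatrixDerivAt {m n : Type*} (M : ℝ → Matrix m n ℝ) (M' : Matrix m n ℝ) (t : ℝ) : Prop :=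
  ∀ i j, HasDerivAt (fun u => M u i j) (M' i j) t

namespace HasMatrixDerivAt

variable {l m n : Type*} {t : ℝ}

theorem const (M : Matrix m n ℝ) (t : ℝ) : HasMatrixDerivAt (fun _ => M) 0 t :=
  fun _ _ => hasDerivAt_const _ _

theorem add_smul (M B : Matrix m n ℝ) (t : ℝ) : HasMatrixDerivAt (fun u => M + u • B) B t := by
  intro i j
  have := ((hasDerivAt_id t).mul_const (B i j)).const_add (M i j)
  simpa using this

theorem transpose {M : ℝ → Matrix m n ℝ} {M' : Matrix m n ℝ} (h : HasMatrixDerivAt M M' t) :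
    HasMatrixDerivAt (fun u => (M u)ᵀ) M'ᵀ t :=
  fun i j => h j i

theorem mul [Fintype m] {M : ℝ → Matrix l m ℝ} {M' : Matrix l m ℝ} {L : ℝ → Matrix m n ℝ}
    {L' : Matrix m n ℝ} (hM : HasMatrixDerivAt M M' t) (hL : HasMatrixDerivAt L L' t) :
    HasMatrixDerivAt (fun u => M u * L u) (M' * L t + M t * L') t := by
  intro i j
  simp only [Matrix.mul_apply, Matrix.add_apply, ← Finset.sum_add_distrib]
  exact HasDerivAt.fun_sum fun k _ => (hM i k).mul (hL k j)

theorem trace [Fintype m] {M : ℝ → Matrix m m ℝ} {M' : Matrix m m ℝ}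
    (hM : HasMatrixDerivAt M M' t) : HasDerivAt (fun u => (M u).trace) M'.trace t := by
  simp only [Matrix.trace, Matrix.diag_apply]
  exact HasDerivAt.fun_sum fun i _ => hM i i

theorem unique {M : ℝ → Matrix m n ℝ} {M' M'' : Matrix m n ℝ} (h : HasMatrixDerivAt M M' t)
    (h' : HasMatrixDerivAt M M'' t) : M' = M'' := by
  ext i j
  exact (h i j).unique (h' i j)

theorem congr_deriv {M : ℝ → Matrix m n ℝ} {M' M'' : Matrix m n ℝ} (h : HasMatrixDerivAt M M' t)
    (e : M' = M'') : HasMatrixDerivAt M M'' t := e ▸ h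

/-- **Jacobi's formula** for the derivative of a determinant. -/
theorem det [Fintype m] [DecidableEq m] {M : ℝ → Matrix m m ℝ} {M' : Matrix m m ℝ}
    (hM : HasMatrixDerivAt M M' t) :
    HasDerivAt (fun u => (M u).det) ((M t).adjugate * M').trace t := by
  have h1 : HasDerivAt (fun u => (M u).det)
      (∑ σ : Equiv.Perm m, Equiv.Perm.sign σ •
        ∑ i, (∏ j ∈ Finset.univ.erase i, M t (σ j) j) • M' (σ i) i) t := by
    simp only [Matrix.det_apply]
    refine HasDerivAt.fun_sum fun σ _ => HasDerivAt.fun_const_smul _ ?_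
    exact HasDerivAt.fun_finsetProd fun i _ => hM (σ i) i
  convert h1 using 1
  have h2 : ∀ i, ((M t).adjugate * M') i i = ((M t).updateCol i fun k => M' k i).det := by
    intro i
    rw [← Matrix.cramer_apply, Matrix.cramer_eq_adjugate_mulVec]
    rfl
  simp only [Matrix.trace, Matrix.diag_apply, h2, Matrix.det_apply]
  rw [Finset.sum_comm]
  refine Finset.sum_congr rfl fun σ _ => ?_
  rw [← Finset.smul_sum]
  congr 1
  refine Finset.sum_congr rfl fun i _ => ?_
  rw [← Finset.mul_prod_erase _ _ (Finset.mem_univ i), mul_comm, Matrix.updateCol_self, smul_eq_mul]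
  congr 1
  refine Finset.prod_congr rfl fun j hj => ?_
  rw [Matrix.updateCol_ne (Finset.ne_of_mem_erase hj)]

end HasMatrixDerivAt

section ContDiff

variable {E : Type*} [NormedAddCommGroup E] [NormedSpace ℝ E] {k : WithTop ℕ∞} {z : E}
  {l m n : Type*}

theorem contDiffAt_matrix_mul [Fintype m] {M : E → Matrix l m ℝ} {L : E → Matrix m n ℝ}
    (hM : ∀ i j, ContDiffAt ℝ k (fun y => M y i j) z)
    (hL : ∀ i j, ContDiffAt ℝ k (fun y => L y i j) z) (i : l) (j : n) :
    ContDiffAt ℝ k (fun y => (M y * L y) i j) z := by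
  simp only [Matrix.mul_apply]
  exact ContDiffAt.sum fun a _ => (hM i a).mul (hL a j)

theorem contDiffAt_matrix_trace [Fintype m] {M : E → Matrix m m ℝ}
    (hM : ∀ i j, ContDiffAt ℝ k (fun y => M y i j) z) :
    ContDiffAt ℝ k (fun y => (M y).trace) z := by
  simp only [Matrix.trace, Matrix.diag_apply]
  exact ContDiffAt.sum fun a _ => hM a a

theorem contDiffAt_matrix_det [Fintype m] [DecidableEq m] {M : E → Matrix m m ℝ}
    (hM : ∀ i j, ContDiffAt ℝ k (fun y => M y i j) z) :
    ContDiffAt ℝ k (fun y => (M y).det) z := by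
  simp only [Matrix.det_apply]
  exact ContDiffAt.sum fun σ _ => (contDiffAt_prod fun i _ => hM (σ i) i).const_smul _

theorem contDiffAt_matrix_inv [Fintype m] [DecidableEq m] {M : E → Matrix m m ℝ}
    (hM : ∀ i j, ContDiffAt ℝ k (fun y => M y i j) z) (hdet : (M z).det ≠ 0) (i j : m) :
    ContDiffAt ℝ k (fun y => (M y)⁻¹ i j) z := by
  simp only [Matrix.inv_def, Ring.inverse_eq_inv', Matrix.smul_apply, smul_eq_mul,
    Matrix.adjugate_apply]
  refine ((contDiffAt_matrix_det hM).inv hdet).mul (contDiffAt_matrix_det fun a b => ?_)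
  simp only [Matrix.updateRow_apply]
  split_ifs
  · exact contDiffAt_const
  · exact hM a b

end ContDiff

/-! ### Moore–Penrose inverses -/

section MoorePenrose

variable {m n : Type*} [Fintype m] [Fintype n]

theorem IsMoorePenrose.moorePenrose_eq {A : Matrix m n ℝ} {B : Matrix n m ℝ}
    (h : IsMoorePenrose A B) : moorePenrose A = B :=
  (moorePenrose_spec A).unique h

theorem moorePenrose_transpose (A : Matrix m n ℝ) : moorePenrose Aᵀ = (moorePenrose A)ᵀ := by
  have h := moorePenrose_spec A
  refine IsMoorePenrose.moorePenrose_eq ⟨?_, ?_, ?_, ?_⟩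
  · rw [← Matrix.transpose_mul, ← Matrix.transpose_mul, ← Matrix.mul_assoc, h.mul_mul_left]
  · rw [← Matrix.transpose_mul, ← Matrix.transpose_mul, ← Matrix.mul_assoc, h.mul_mul_right]
  · rw [← Matrix.transpose_mul, h.symm_right, h.symm_right]
  · rw [← Matrix.transpose_mul, h.symm_left, h.symm_left]

theorem IsMoorePenrose.mul_mul_left' {A : Matrix m n ℝ} {B : Matrix n m ℝ}
    (h : IsMoorePenrose A B) : A * (B * A) = A := by rw [← Matrix.mul_assoc, h.mul_mul_left]

theorem IsMoorePenrose.mul_mul_right' {A : Matrix m n ℝ} {B : Matrix n m ℝ}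
    (h : IsMoorePenrose A B) : B * (A * B) = B := by rw [← Matrix.mul_assoc, h.mul_mul_right]

theorem IsMoorePenrose.transpose_mul_mul {A : Matrix m n ℝ} {B : Matrix n m ℝ}
    (h : IsMoorePenrose A B) : Aᵀ * Bᵀ * B = B := by
  rw [← Matrix.transpose_mul, h.symm_right, h.mul_mul_right]

theorem IsMoorePenrose.mul_mul_transpose {A : Matrix m n ℝ} {B : Matrix n m ℝ}
    (h : IsMoorePenrose A B) : B * Bᵀ * Aᵀ = B := by
  rw [Matrix.mul_assoc, ← Matrix.transpose_mul, h.symm_left, ← Matrix.mul_assoc, h.mul_mul_right]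

/-- With `S = Yᵀ Y`, the inverse `S⁺` is expressed by `Y⁺`, so that Stein's lemma in `Y` applies to
functions of `S⁺`. -/
theorem moorePenrose_transpose_mul_self (Y : Matrix m n ℝ) :
    moorePenrose (Yᵀ * Y) = moorePenrose Y * (moorePenrose Y)ᵀ := by
  have h := moorePenrose_spec Y
  set A := moorePenrose Y
  have e1 : Yᵀ * Y * (A * Aᵀ) = A * Y := by
    calc Yᵀ * Y * (A * Aᵀ) = Yᵀ * (Y * A) * Aᵀ := by simp only [Matrix.mul_assoc]
      _ = (Y * A * Y)ᵀ * Aᵀ := by rw [Matrix.transpose_mul (Y * A), h.symm_left]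
      _ = A * Y := by rw [h.mul_mul_left, ← Matrix.transpose_mul, h.symm_right]
  have e2 : A * Aᵀ * (Yᵀ * Y) = A * Y := by
    have := congrArg Matrix.transpose e1
    simpa [Matrix.transpose_mul, Matrix.mul_assoc, h.symm_right] using this
  refine IsMoorePenrose.moorePenrose_eq ⟨?_, ?_, ?_, ?_⟩
  · rw [Matrix.mul_assoc, e2, Matrix.mul_assoc, h.mul_mul_left']
  · rw [e2, ← Matrix.mul_assoc, h.mul_mul_right]
  · rw [e1, h.symm_right]
  · rw [e2, h.symm_right]

theorem transpose_mul_self_mul_moorePenrose (Y : Matrix m n ℝ) :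
    Yᵀ * Y * moorePenrose (Yᵀ * Y) = moorePenrose Y * Y := by
  have h := moorePenrose_spec Y
  rw [moorePenrose_transpose_mul_self, Matrix.mul_assoc, ← Matrix.mul_assoc Y, ← h.symm_left,
    ← Matrix.transpose_mul, ← h.symm_right, ← Matrix.transpose_mul, Matrix.transpose_mul,
    Matrix.transpose_mul, ← Matrix.transpose_mul, ← Matrix.mul_assoc, h.mul_mul_right,
    Matrix.transpose_mul]

theorem moorePenrose_eq_transpose_mul_inv [DecidableEq m] {Y : Matrix m n ℝ}
    (h : (Y * Yᵀ).det ≠ 0) : moorePenrose Y = Yᵀ * (Y * Yᵀ)⁻¹ := by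
  have h1 : Y * (Yᵀ * (Y * Yᵀ)⁻¹) = 1 := by
    rw [← Matrix.mul_assoc, Matrix.mul_nonsing_inv _ h.isUnit]
  refine IsMoorePenrose.moorePenrose_eq ⟨?_, ?_, ?_, ?_⟩
  · rw [h1, Matrix.one_mul]
  · rw [Matrix.mul_assoc, h1, Matrix.mul_one]
  · rw [h1, Matrix.transpose_one]
  · simp [Matrix.transpose_mul, Matrix.transpose_nonsing_inv, Matrix.mul_assoc]

theorem moorePenrose_eq_inv_mul_transpose [DecidableEq n] {Y : Matrix m n ℝ}
    (h : (Yᵀ * Y).det ≠ 0) : moorePenrose Y = (Yᵀ * Y)⁻¹ * Yᵀ := by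
  have := moorePenrose_eq_transpose_mul_inv (Y := Yᵀ) (by rwa [Matrix.transpose_transpose])
  rw [moorePenrose_transpose, Matrix.transpose_transpose] at this
  rw [← Matrix.transpose_transpose (moorePenrose Y), this]
  simp [Matrix.transpose_mul, Matrix.transpose_nonsing_inv]

/-- The derivative of the Moore–Penrose inverse along a curve on which it is differentiable,
obtained by differentiating the Penrose equations. -/
theorem HasMatrixDerivAt.moorePenrose_eq [DecidableEq m] [DecidableEq n] {Y : ℝ → Matrix m n ℝ}
    {B : Matrix m n ℝ} {A' : Matrix n m ℝ} {t : ℝ} (hY : HasMatrixDerivAt Y B t)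
    (hA : HasMatrixDerivAt (fun u => moorePenrose (Y u)) A' t) :
    A' = -(moorePenrose (Y t) * B * moorePenrose (Y t))
      + (1 - moorePenrose (Y t) * Y t) * Bᵀ * (moorePenrose (Y t))ᵀ * moorePenrose (Y t)
      + moorePenrose (Y t) * (moorePenrose (Y t))ᵀ * Bᵀ * (1 - Y t * moorePenrose (Y t)) := by
  have h := moorePenrose_spec (Y t)
  have d1 := (hA.mul hY).mul hA
  have d2 := (hY.transpose.mul hA.transpose).mul hA
  have d3 := (hA.mul hA.transpose).mul hY.transpose
  simp only [(moorePenrose_spec (Y _)).mul_mul_right] at d1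
  simp only [(moorePenrose_spec (Y _)).transpose_mul_mul] at d2
  simp only [(moorePenrose_spec (Y _)).mul_mul_transpose] at d3
  replace d1 := hA.unique d1
  replace d2 := hA.unique d2
  replace d3 := hA.unique d3
  generalize hAdef : moorePenrose (Y t) = A at *
  generalize hYdef : Y t = y at *
  have z1 : (1 - A * y) * yᵀ = 0 := by
    rw [← h.symm_right, Matrix.sub_mul, Matrix.one_mul, ← Matrix.transpose_mul, h.mul_mul_left',
      sub_self]
  have z2 : yᵀ * (1 - y * A) = 0 := by
    rw [← h.symm_left, Matrix.mul_sub, Matrix.mul_one, ← Matrix.transpose_mul, h.mul_mul_left,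
      sub_self]
  have e1 : A * y * A' * (y * A) = -(A * B * A) := by
    have := congrArg (fun M => A * y * M * (y * A)) d1
    simp only [Matrix.add_mul, Matrix.mul_add] at this
    have f1 : A * y * (A' * y * A) * (y * A) = A * y * A' * (y * A) := by
      have : y * A * (y * A) = y * A := by rw [← Matrix.mul_assoc, h.mul_mul_left]
      calc _ = A * y * A' * (y * A * (y * A)) := by simp only [Matrix.mul_assoc]
        _ = _ := by rw [this]
    have f2 : A * y * (A * B * A) * (y * A) = A * B * A := by
      calc _ = (A * y * A) * B * (A * y * A) := by simp only [Matrix.mul_assoc]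
        _ = _ := by rw [h.mul_mul_right]
    have f3 : A * y * (A * y * A') * (y * A) = A * y * A' * (y * A) := by
      calc _ = (A * y * A) * y * A' * (y * A) := by simp only [Matrix.mul_assoc]
        _ = _ := by rw [h.mul_mul_right]
    rw [f1, f2, f3] at this
    have h3 : A * y * A' * (y * A) + A * B * A = 0 := by
      have := sub_eq_zero.2 this
      rw [← neg_eq_zero, ← this]
      abel
    exact eq_neg_of_add_eq_zero_left h3
  have e2 : (1 - A * y) * A' = (1 - A * y) * Bᵀ * Aᵀ * A := by
    calc (1 - A * y) * A' = (1 - A * y) * ((Bᵀ * Aᵀ + yᵀ * A'ᵀ) * A + yᵀ * Aᵀ * A') := by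
          rw [← d2]
      _ = (1 - A * y) * Bᵀ * Aᵀ * A + ((1 - A * y) * yᵀ) * (A'ᵀ * A)
          + ((1 - A * y) * yᵀ) * (Aᵀ * A') := by
        simp only [Matrix.add_mul, Matrix.mul_add, Matrix.mul_assoc]
      _ = _ := by rw [z1]; simp
  have e3 : A' * (1 - y * A) = A * Aᵀ * Bᵀ * (1 - y * A) := by
    calc A' * (1 - y * A) = ((A' * Aᵀ + A * A'ᵀ) * yᵀ + A * Aᵀ * Bᵀ) * (1 - y * A) := by
          rw [← d3]
      _ = (A' * Aᵀ + A * A'ᵀ) * (yᵀ * (1 - y * A)) + A * Aᵀ * Bᵀ * (1 - y * A) := by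
        simp only [Matrix.add_mul, Matrix.mul_assoc]
      _ = _ := by rw [z2]; simp
  have e4 : A * y * (A' * (1 - y * A)) = A * Aᵀ * Bᵀ * (1 - y * A) := by
    rw [e3]
    calc _ = (A * y * A) * Aᵀ * Bᵀ * (1 - y * A) := by simp only [Matrix.mul_assoc]
      _ = _ := by rw [h.mul_mul_right]
  calc A' = A * y * A' * (y * A) + (1 - A * y) * A' + A * y * (A' * (1 - y * A)) := by
        simp only [Matrix.sub_mul, Matrix.mul_sub, Matrix.one_mul, Matrix.mul_one, Matrix.mul_assoc]
        abel
    _ = _ := by rw [e1, e2, e4]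

end MoorePenrose

/-! ### Matrices of full rank -/

section FullRank

variable {m n : Type*} [Fintype m] [Fintype n] [DecidableEq m] [DecidableEq n]

/-- The determinant of the smaller of the two Gram matrices `Y Yᵀ` and `Yᵀ Y`. It is nonnegative,
and it is nonzero exactly when `Y` has the largest possible rank. -/
noncomputable def gramDet (Y : Matrix m n ℝ) : ℝ :=
  if Fintype.card m ≤ Fintype.card n then (Y * Yᵀ).det else (Yᵀ * Y).det

theorem gramDet_nonneg (Y : Matrix m n ℝ) : 0 ≤ gramDet Y := by
  unfold gramDet
  split_ifs
  · have := Matrix.posSemidef_self_mul_conjTranspose Y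
    rw [Matrix.conjTranspose_eq_transpose_of_trivial] at this
    exact this.det_nonneg
  · have := Matrix.posSemidef_conjTranspose_mul_self Y
    rw [Matrix.conjTranspose_eq_transpose_of_trivial] at this
    exact this.det_nonneg

/-- The projection `Y⁺ Y` has trace equal to the rank, here for `Y` of full rank. -/
theorem trace_moorePenrose_mul_self {Y : Matrix m n ℝ} (h : gramDet Y ≠ 0) :
    (moorePenrose Y * Y).trace = (min (Fintype.card m) (Fintype.card n) : ℕ) := by
  unfold gramDet at h
  split_ifs at h with hc
  · rw [moorePenrose_eq_transpose_mul_inv h, Matrix.trace_mul_comm, ← Matrix.mul_assoc,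
      Matrix.mul_nonsing_inv _ h.isUnit, Matrix.trace_one, min_eq_left hc]
  · rw [moorePenrose_eq_inv_mul_transpose h, Matrix.mul_assoc,
      Matrix.nonsing_inv_mul _ h.isUnit, Matrix.trace_one, min_eq_right (by omega)]

/-- The logarithmic derivative of `gramDet` is `2 tr(Y⁺ B)`, whichever Gram matrix is the smaller. -/
theorem HasMatrixDerivAt.gramDet {Y : ℝ → Matrix m n ℝ} {B : Matrix m n ℝ} {t : ℝ}
    (hY : HasMatrixDerivAt Y B t) (h : gramDet (Y t) ≠ 0) :
    HasDerivAt (fun u => gramDet (Y u))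
      (2 * gramDet (Y t) * (moorePenrose (Y t) * B).trace) t := by
  unfold _root_.gramDet at h ⊢
  split_ifs at h ⊢ with hc
  · convert (hY.mul hY.transpose).det using 1
    rw [moorePenrose_eq_transpose_mul_inv h]
    have e : (Y t * (Y t)ᵀ).adjugate = (Y t * (Y t)ᵀ).det • (Y t * (Y t)ᵀ)⁻¹ := by
      rw [Matrix.inv_def, smul_smul, Ring.mul_inverse_cancel _ h.isUnit, one_smul]
    have hs : ((Y t * (Y t)ᵀ)⁻¹)ᵀ = (Y t * (Y t)ᵀ)⁻¹ := by
      rw [Matrix.transpose_nonsing_inv, Matrix.transpose_mul, Matrix.transpose_transpose]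
    rw [e, Matrix.smul_mul, Matrix.trace_smul, smul_eq_mul, mul_comm 2, mul_assoc]
    congr 1
    rw [Matrix.mul_add, Matrix.trace_add, ← Matrix.trace_transpose (_ * (Y t * Bᵀ))]
    rw [Matrix.transpose_mul, Matrix.transpose_mul, hs, Matrix.transpose_transpose,
      Matrix.trace_mul_comm (B * _), Matrix.mul_assoc, Matrix.trace_mul_comm, Matrix.mul_assoc]
    ring
  · convert (hY.transpose.mul hY).det using 1
    rw [moorePenrose_eq_inv_mul_transpose h]
    have e : ((Y t)ᵀ * Y t).adjugate = ((Y t)ᵀ * Y t).det • ((Y t)ᵀ * Y t)⁻¹ := by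
      rw [Matrix.inv_def, smul_smul, Ring.mul_inverse_cancel _ h.isUnit, one_smul]
    have hs : (((Y t)ᵀ * Y t)⁻¹)ᵀ = ((Y t)ᵀ * Y t)⁻¹ := by
      rw [Matrix.transpose_nonsing_inv, Matrix.transpose_mul, Matrix.transpose_transpose]
    rw [e, Matrix.smul_mul, Matrix.trace_smul, smul_eq_mul, mul_comm 2, mul_assoc]
    congr 1
    rw [Matrix.mul_add, Matrix.trace_add, ← Matrix.trace_transpose (_ * (Bᵀ * Y t))]
    rw [Matrix.transpose_mul, Matrix.transpose_mul, hs, Matrix.transpose_transpose,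
      Matrix.trace_mul_comm _ (_)⁻¹, ← Matrix.mul_assoc]
    ring

variable {E : Type*} [NormedAddCommGroup E] [NormedSpace ℝ E] {k : WithTop ℕ∞} {z : E}

theorem contDiffAt_gramDet {Y : E → Matrix m n ℝ}
    (hY : ∀ i j, ContDiffAt ℝ k (fun y => Y y i j) z) :
    ContDiffAt ℝ k (fun y => gramDet (Y y)) z := by
  unfold gramDet
  split_ifs
  · exact contDiffAt_matrix_det (contDiffAt_matrix_mul hY fun i j => hY j i)
  · exact contDiffAt_matrix_det (contDiffAt_matrix_mul (fun i j => hY j i) hY)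

theorem contDiffAt_moorePenrose {Y : E → Matrix m n ℝ}
    (hY : ∀ i j, ContDiffAt ℝ k (fun y => Y y i j) z) (h : gramDet (Y z) ≠ 0) (i : n) (j : m) :
    ContDiffAt ℝ k (fun y => moorePenrose (Y y) i j) z := by
  have hev : ∀ᶠ y in nhds z, gramDet (Y y) ≠ 0 :=
    (contDiffAt_gramDet hY).continuousAt.eventually_ne h
  unfold gramDet at h hev
  split_ifs at h hev
  · exact (contDiffAt_matrix_mul (fun i j => hY j i) (contDiffAt_matrix_inv
      (contDiffAt_matrix_mul hY fun i j => hY j i) h) i j).congr_of_eventuallyEq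
      (hev.mono fun y hy => congrFun (congrFun (moorePenrose_eq_transpose_mul_inv hy) i) j)
  · exact (contDiffAt_matrix_mul (contDiffAt_matrix_inv
      (contDiffAt_matrix_mul (fun i j => hY j i) hY) h) (fun i j => hY j i)
      i j).congr_of_eventuallyEq
      (hev.mono fun y hy => congrFun (congrFun (moorePenrose_eq_inv_mul_transpose hy) i) j)

end FullRank

/-! ### Almost every matrix has full rank -/

/-- The matrix whose entries are the coordinates of a Euclidean vector indexed by pairs; this is
inverse to `entryVec`. -/
def entryMat {m n : Type*} (x : EuclideanSpace ℝ (m × n)) : Matrix m n ℝ :=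
  Matrix.of fun i j => x (i, j)

section entryMat

variable {m n : Type*}

@[simp]
theorem entryMat_apply (x : EuclideanSpace ℝ (m × n)) (i : m) (j : n) :
    entryMat x i j = x (i, j) := rfl

@[simp]
theorem entryMat_entryVec (A : Matrix m n ℝ) : entryMat (entryVec A) = A := rfl

@[simp]
theorem entryVec_entryMat (x : EuclideanSpace ℝ (m × n)) : entryVec (entryMat x) = x := rfl

theorem entryMat_add (x y : EuclideanSpace ℝ (m × n)) :
    entryMat (x + y) = entryMat x + entryMat y := rfl

theorem entryMat_smul (t : ℝ) (x : EuclideanSpace ℝ (m × n)) :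
    entryMat (t • x) = t • entryMat x := rfl

theorem entryMat_sub (x y : EuclideanSpace ℝ (m × n)) :
    entryMat (x - y) = entryMat x - entryMat y := rfl

theorem entryMat_single [DecidableEq m] [DecidableEq n] (i : m) (j : n) :
    entryMat (EuclideanSpace.single (i, j) (1 : ℝ)) = Matrix.single i j 1 := by
  ext a b
  simp [Matrix.single_apply, Prod.ext_iff, eq_comm]

end entryMat

theorem finite_setOf_det_add_smul_one_eq_zero {m : Type*} [Fintype m] [DecidableEq m]
    (M : Matrix m m ℝ) :
    {t : ℝ | (M + t • (1 : Matrix m m ℝ)).det = 0}.Finite := by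
  refine ((-M).charpoly.roots.toFinset.finite_toSet).subset fun t ht => ?_
  simp only [Finset.mem_coe, Multiset.mem_toFinset,
    Polynomial.mem_roots (Matrix.charpoly_monic (-M)).ne_zero, Polynomial.IsRoot]
  rw [Matrix.eval_charpoly, Matrix.scalar_apply, ← Matrix.smul_one_eq_diagonal, sub_neg_eq_add,
    add_comm]
  exact ht

/-- A matrix depending continuously on a parameter is almost everywhere invertible if it moves by
multiples of `1` along some direction `v`: on each line parallel to `v` its determinant is a monic
polynomial, which has finitely many zeros. -/
theorem ae_det_ne_zero_of_line {m F : Type*} [Fintype m] [DecidableEq m]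
    [NormedAddCommGroup F] [NormedSpace ℝ F] [FiniteDimensional ℝ F] [MeasurableSpace F]
    [BorelSpace F] (ν : Measure F) [ν.IsAddHaarMeasure]
    (M : F → Matrix m m ℝ) (hM : ∀ i j, Continuous fun y => M y i j) (v : F)
    (hv : ∀ y (t : ℝ), M (y + t • v) = M y + t • (1 : Matrix m m ℝ)) :
    ∀ᵐ y ∂ν, (M y).det ≠ 0 := by
  have hc : Continuous fun y => (M y).det := Continuous.matrix_det (continuous_matrix hM)
  refine ae_mem_of_ae_add_linearMap_mem (s := {y | (M y).det ≠ 0})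
    (LinearMap.toSpanSingleton ℝ F v) (volume : Measure ℝ) ν
    ((isOpen_ne_fun hc continuous_const).measurableSet) fun y => ?_
  have := (finite_setOf_det_add_smul_one_eq_zero (M y)).measure_zero (volume : Measure ℝ)
  rw [ae_iff]
  refine measure_mono_null (fun t ht => ?_) this
  simpa [hv] using ht

/-- A wide matrix with a nonzero maximal minor has an invertible Gram matrix. -/
theorem det_mul_transpose_ne_zero_of_submatrix {m n : Type*} [Fintype m] [Fintype n]
    [DecidableEq m] {Y : Matrix m n ℝ} (e : m → n)
    (h : (Y.submatrix id e).det ≠ 0) : (Y * Yᵀ).det ≠ 0 := by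
  contrapose! h
  rw [← Matrix.exists_vecMul_eq_zero_iff] at h ⊢
  obtain ⟨v, hv, h⟩ := h
  refine ⟨v, hv, ?_⟩
  have h0 : v ᵥ* Y = 0 := by
    have := Matrix.vecMul_self_mul_conjTranspose_eq_zero Y v
    rw [Matrix.conjTranspose_eq_transpose_of_trivial] at this
    exact this.1 h
  ext j
  exact congrFun h0 (e j)

section FullRankAE

variable {m n : Type*} [Fintype m] [Fintype n] [DecidableEq m] [DecidableEq n]

theorem ae_gramDet_ne_zero :
    ∀ᵐ y : EuclideanSpace ℝ (m × n), gramDet (entryMat y) ≠ 0 := by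
  unfold gramDet
  split_ifs with hc
  · obtain ⟨e⟩ := Function.Embedding.nonempty_of_card_le hc
    have := ae_det_ne_zero_of_line (volume : Measure (EuclideanSpace ℝ (m × n)))
      (fun y => (entryMat y).submatrix id e) (fun i j => by simp; fun_prop)
      (entryVec (Matrix.of fun i j => if j = e i then 1 else 0)) (fun y t => by
        ext i j
        simp [entryMat_add, entryMat_smul, Matrix.one_apply, eq_comm])
    exact this.mono fun y hy => det_mul_transpose_ne_zero_of_submatrix e hy
  · obtain ⟨e⟩ := Function.Embedding.nonempty_of_card_le (not_le.1 hc).le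
    have := ae_det_ne_zero_of_line (volume : Measure (EuclideanSpace ℝ (m × n)))
      (fun y => (entryMat y)ᵀ.submatrix id e) (fun i j => by simp; fun_prop)
      (entryVec (Matrix.of fun i j => if i = e j then 1 else 0)) (fun y t => by
        ext i j
        simp [entryMat_add, entryMat_smul, Matrix.one_apply, eq_comm])
    refine this.mono fun y hy => ?_
    have := det_mul_transpose_ne_zero_of_submatrix e hy
    rwa [Matrix.transpose_transpose] at this

end FullRankAE

/-! ### The vector fields of the integration by parts -/

section TraceIdentities

variable {m n : Type*} [Fintype m] [Fintype n]

theorem trace_transpose_mul_eq_sum (C D : Matrix m n ℝ) :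
    (Cᵀ * D).trace = ∑ i, ∑ j, C i j * D i j := by
  simp only [Matrix.trace, Matrix.diag_apply, Matrix.mul_apply, Matrix.transpose_apply]
  exact Finset.sum_comm

theorem trace_transpose_mul_self_nonneg (C : Matrix m n ℝ) : 0 ≤ (Cᵀ * C).trace := by
  rw [trace_transpose_mul_eq_sum]
  exact Finset.sum_nonneg fun i _ => Finset.sum_nonneg fun j _ => mul_self_nonneg _

variable [DecidableEq m] [DecidableEq n]

theorem sum_mul_single_mul (C : Matrix m m ℝ) (D : Matrix n n ℝ) :
    ∑ i, ∑ j, (C * (Matrix.single i j 1 : Matrix m n ℝ) * D) i j = C.trace * D.trace := by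
  simp only [Matrix.trace, Matrix.diag_apply, Finset.sum_mul_sum]
  refine Finset.sum_congr rfl fun i _ => Finset.sum_congr rfl fun j _ => ?_
  rw [Matrix.mul_assoc, Matrix.mul_apply, Finset.sum_eq_single i]
  · rw [Matrix.single_mul_apply_same, one_mul]
  · intro k _ hk
    rw [Matrix.single_mul_apply_of_ne _ _ _ _ _ hk, mul_zero]
  · simp

theorem sum_mul_single_transpose_mul (C D : Matrix m n ℝ) :
    ∑ i, ∑ j, (C * (Matrix.single i j 1 : Matrix m n ℝ)ᵀ * D) i j = (Cᵀ * D).trace := by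
  have h : ∀ i j, (C * (Matrix.single i j 1 : Matrix m n ℝ)ᵀ * D) i j = C i j * D i j := by
    intro i j
    rw [Matrix.transpose_single, Matrix.mul_assoc, Matrix.mul_apply, Finset.sum_eq_single j]
    · rw [Matrix.single_mul_apply_same, one_mul]
    · intro k _ hk
      rw [Matrix.single_mul_apply_of_ne _ _ _ _ _ hk, mul_zero]
    · simp
  simp only [h, Matrix.trace, Matrix.diag_apply, Matrix.mul_apply, Matrix.transpose_apply]
  exact Finset.sum_comm

/-- Submultiplicativity of the Frobenius norm, in terms of traces. -/
theorem trace_transpose_mul_self_mul_le {l m n : Type*} [Fintype l] [Fintype m] [Fintype n]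
    (C : Matrix m n ℝ) (D : Matrix n l ℝ) :
    ((C * D)ᵀ * (C * D)).trace ≤ (Cᵀ * C).trace * (Dᵀ * D).trace := by
  have hD : (Dᵀ * D).trace = ∑ j, ∑ k, D k j ^ 2 := by
    rw [trace_transpose_mul_eq_sum, Finset.sum_comm]
    simp only [sq]
  have hC : (Cᵀ * C).trace = ∑ i, ∑ k, C i k ^ 2 := by
    rw [trace_transpose_mul_eq_sum]
    simp only [sq]
  rw [hC, hD, trace_transpose_mul_eq_sum, Finset.sum_mul_sum]
  refine Finset.sum_le_sum fun i _ => Finset.sum_le_sum fun j _ => ?_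
  rw [← sq, Matrix.mul_apply]
  exact Finset.sum_mul_sq_le_sq_mul_sq Finset.univ (fun k => C i k) fun k => D k j

end TraceIdentities

section Fields

variable {ι κ l : Type*} [Fintype ι] [Fintype κ] [Fintype l]

/-- The statistic `tr(Xᵀ S⁺ X)` for `S = Yᵀ Y`, in terms of the Moore–Penrose inverse of `Y`. -/
noncomputable def gramF (X : Matrix κ l ℝ) (Y : Matrix ι κ ℝ) : ℝ :=
  (Xᵀ * (moorePenrose Y * (moorePenrose Y)ᵀ) * X).trace

/-- The projection `S S⁺ X` of the columns of `X` to the row space of `Y`, for `S = Yᵀ Y`. -/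
noncomputable def projField (X : Matrix κ l ℝ) (Y : Matrix ι κ ℝ) : Matrix κ l ℝ :=
  moorePenrose Y * Y * X

/-- The field `(Y⁺)ᵀ X Xᵀ Y⁺ Y` in the variable `Y`. Its divergence turns the quadratic term of the
loss into a multiple of `gramF`. -/
noncomputable def dualField (X : Matrix κ l ℝ) (Y : Matrix ι κ ℝ) : Matrix ι κ ℝ :=
  (moorePenrose Y)ᵀ * (X * Xᵀ) * moorePenrose Y * Y

/-- The trace of the square of `(Y⁺)ᵀ X Xᵀ Y⁺`, whose trace is `gramF X Y`. -/
noncomputable def gramT (X : Matrix κ l ℝ) (Y : Matrix ι κ ℝ) : ℝ :=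
  ((moorePenrose Y)ᵀ * (X * Xᵀ) * moorePenrose Y *
    ((moorePenrose Y)ᵀ * (X * Xᵀ) * moorePenrose Y)).trace

/-- The squared Frobenius norm of `projField`. -/
noncomputable def projSq (X : Matrix κ l ℝ) (Y : Matrix ι κ ℝ) : ℝ :=
  ((projField X Y)ᵀ * projField X Y).trace

variable (X : Matrix κ l ℝ) (Y : Matrix ι κ ℝ)

theorem gramF_eq : gramF X Y = (((moorePenrose Y)ᵀ * X)ᵀ * ((moorePenrose Y)ᵀ * X)).trace := by
  rw [gramF, Matrix.transpose_mul, Matrix.transpose_transpose]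
  simp only [Matrix.mul_assoc]

theorem gramF_eq' : gramF X Y = (moorePenrose Y * (moorePenrose Y)ᵀ * (X * Xᵀ)).trace := by
  rw [gramF, Matrix.mul_assoc, Matrix.trace_mul_comm]
  simp only [Matrix.mul_assoc]

theorem gramF_nonneg : 0 ≤ gramF X Y := by
  rw [gramF_eq]; exact trace_transpose_mul_self_nonneg _

theorem gramT_eq : gramT X Y = (((((moorePenrose Y)ᵀ * X) * ((moorePenrose Y)ᵀ * X)ᵀ))ᵀ *
    (((moorePenrose Y)ᵀ * X) * ((moorePenrose Y)ᵀ * X)ᵀ)).trace := by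
  simp only [gramT, Matrix.transpose_mul, Matrix.transpose_transpose, Matrix.mul_assoc]

theorem gramT_nonneg : 0 ≤ gramT X Y := by
  rw [gramT_eq]; exact trace_transpose_mul_self_nonneg _

theorem gramT_le : gramT X Y ≤ gramF X Y ^ 2 := by
  rw [gramT_eq]
  refine (trace_transpose_mul_self_mul_le _ _).trans_eq ?_
  rw [Matrix.trace_mul_comm (((moorePenrose Y)ᵀ * X)ᵀᵀ), Matrix.transpose_transpose, ← gramF_eq, sq]

theorem projSq_nonneg : 0 ≤ projSq X Y := trace_transpose_mul_self_nonneg _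

theorem projSq_le : projSq X Y ≤ (Yᵀ * Y).trace * gramF X Y := by
  have e : projField X Y = Yᵀ * ((moorePenrose Y)ᵀ * X) := by
    rw [projField, ← (moorePenrose_spec Y).symm_right, Matrix.transpose_mul, Matrix.mul_assoc]
  rw [projSq, e, gramF_eq]
  refine (trace_transpose_mul_self_mul_le _ _).trans_eq ?_
  rw [Matrix.transpose_transpose, Matrix.trace_mul_comm Y]

/-- The derivative of `‖X‖² / 2` along `projField`. -/
theorem trace_transpose_mul_projField : (Xᵀ * projField X Y).trace = projSq X Y := by
  rw [projSq, projField, Matrix.transpose_mul, (moorePenrose_spec Y).symm_right]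
  have : moorePenrose Y * Y * (moorePenrose Y * Y) = moorePenrose Y * Y := by
    rw [← Matrix.mul_assoc, (moorePenrose_spec Y).mul_mul_right]
  rw [Matrix.mul_assoc Xᵀ, ← Matrix.mul_assoc (moorePenrose Y * Y) _ X, this]

/-- The quadratic term of the loss is `tr(Sig⁻¹ G Gᵀ)` with `G = projField X Y`; this factorization
puts it into the form required by Stein's lemma in `Y`. -/
theorem transpose_mul_dualField :
    Yᵀ * dualField X Y = projField X Y * (projField X Y)ᵀ := by
  rw [dualField, projField, Matrix.transpose_mul, (moorePenrose_spec Y).symm_right]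
  have := congrArg (fun M => M * (X * Xᵀ) * moorePenrose Y * Y) (moorePenrose_spec Y).symm_right
  simpa only [Matrix.transpose_mul, Matrix.mul_assoc] using this

/-- The derivative of `‖Y‖² / 2` along `dualField`; it is nonnegative, so a cutoff at large `Y` only
helps. -/
theorem trace_transpose_mul_dualField : (Yᵀ * dualField X Y).trace = projSq X Y := by
  rw [transpose_mul_dualField, Matrix.trace_mul_comm, projSq]

/-- Half of the logarithmic derivative of `gramDet` along `dualField`. -/
theorem trace_moorePenrose_mul_dualField :
    (moorePenrose Y * dualField X Y).trace = gramF X Y := by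
  rw [dualField, ← Matrix.mul_assoc, Matrix.trace_mul_comm, gramF_eq', ← Matrix.mul_assoc,
    ← Matrix.mul_assoc, ← Matrix.mul_assoc, ← Matrix.mul_assoc, Matrix.trace_mul_comm,
    ← Matrix.mul_assoc, ← Matrix.mul_assoc, ← Matrix.mul_assoc, ← Matrix.mul_assoc,
    (moorePenrose_spec Y).mul_mul_right]
  simp only [Matrix.mul_assoc]

/-- The derivative of the Moore–Penrose inverse at `Y` in the direction `B`, on the set of matrices
of full rank. -/
noncomputable def moorePenroseDeriv [DecidableEq ι] [DecidableEq κ] (Y B : Matrix ι κ ℝ) :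
    Matrix κ ι ℝ :=
  -(moorePenrose Y * B * moorePenrose Y)
    + (1 - moorePenrose Y * Y) * Bᵀ * (moorePenrose Y)ᵀ * moorePenrose Y
    + moorePenrose Y * (moorePenrose Y)ᵀ * Bᵀ * (1 - Y * moorePenrose Y)

variable {Y}

theorem hasMatrixDerivAt_moorePenrose [DecidableEq ι] [DecidableEq κ] (h : gramDet Y ≠ 0)
    (B : Matrix ι κ ℝ) :
    HasMatrixDerivAt (fun t : ℝ => moorePenrose (Y + t • B)) (moorePenroseDeriv Y B) 0 := by
  have hY := HasMatrixDerivAt.add_smul Y B 0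
  have hA : HasMatrixDerivAt (fun t : ℝ => moorePenrose (Y + t • B))
      (Matrix.of fun i j => deriv (fun t : ℝ => moorePenrose (Y + t • B) i j) 0) 0 := by
    intro i j
    refine ((contDiffAt_moorePenrose (E := ℝ) (k := 1) (z := 0) (Y := fun t => Y + t • B)
      (fun i j => ?_) (by simpa using h) i j).differentiableAt one_ne_zero).hasDerivAt
    simp only [Matrix.add_apply, Matrix.smul_apply, smul_eq_mul]
    fun_prop
  refine hA.congr_deriv ?_
  have := HasMatrixDerivAt.moorePenrose_eq hY hA
  simpa [moorePenroseDeriv] using this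

theorem moorePenroseDeriv_dualField [DecidableEq ι] [DecidableEq κ] :
    moorePenroseDeriv Y (dualField X Y)
      = -(moorePenrose Y * ((moorePenrose Y)ᵀ * (X * Xᵀ) * moorePenrose Y)) := by
  have h := moorePenrose_spec Y
  set A := moorePenrose Y with hA
  have e : (dualField X Y)ᵀ = A * Y * (X * Xᵀ) * A := by
    have h1 : dualField X Y = (A * Y * (X * Xᵀ) * A)ᵀ := by
      rw [Matrix.transpose_mul, Matrix.transpose_mul, h.symm_right, Matrix.transpose_mul,
        Matrix.transpose_transpose, dualField]
      simp only [← hA, Matrix.mul_assoc]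
    rw [h1, Matrix.transpose_transpose]
  have z1 : (1 - A * Y) * (A * Y * (X * Xᵀ) * A) = 0 := by
    have : (1 - A * Y) * A = 0 := by rw [Matrix.sub_mul, h.mul_mul_right, Matrix.one_mul, sub_self]
    rw [Matrix.mul_assoc A, Matrix.mul_assoc A, ← Matrix.mul_assoc, this, Matrix.zero_mul]
  have z2 : A * Y * (X * Xᵀ) * A * (1 - Y * A) = 0 := by
    have : A * (1 - Y * A) = 0 := by rw [Matrix.mul_sub, h.mul_mul_right', Matrix.mul_one, sub_self]
    rw [Matrix.mul_assoc _ A, this, Matrix.mul_zero]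
  have z3 : A * dualField X Y * A = A * (Aᵀ * (X * Xᵀ) * A) := by
    rw [dualField, ← hA, Matrix.mul_assoc A, Matrix.mul_assoc _ Y A, Matrix.mul_assoc _ A (Y * A),
      h.mul_mul_right']
  rw [moorePenroseDeriv, ← hA, e, z1, Matrix.mul_assoc (A * Aᵀ), z2, z3]
  simp

/-- The divergence of `dualField` in the variable `Y`: the product rule and the formula for the
derivative of `Y⁺` turn it into traces of products of `Y`, `Y⁺` and `X Xᵀ`. -/
theorem sum_deriv_dualField [DecidableEq ι] [DecidableEq κ] (h : gramDet Y ≠ 0) :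
    ∑ i, ∑ j, ((moorePenroseDeriv Y (Matrix.single i j 1 : Matrix ι κ ℝ))ᵀ * (X * Xᵀ)
        * moorePenrose Y * Y
      + (moorePenrose Y)ᵀ * (X * Xᵀ) * moorePenroseDeriv Y (Matrix.single i j 1) * Y
      + (moorePenrose Y)ᵀ * (X * Xᵀ) * moorePenrose Y * (Matrix.single i j 1 : Matrix ι κ ℝ)) i j
      = ((Fintype.card ι : ℝ) + Fintype.card κ
        - 2 * (min (Fintype.card ι) (Fintype.card κ) : ℕ) - 1) * gramF X Y := by
  have hs := moorePenrose_spec Y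
  have htr := trace_moorePenrose_mul_self h
  have hF := gramF_eq' X Y
  set A := moorePenrose Y with hA
  set M := X * Xᵀ with hM
  have z1 : A * Y * (1 - A * Y) = 0 := by
    rw [Matrix.mul_sub, Matrix.mul_one, ← Matrix.mul_assoc, hs.mul_mul_right, sub_self]
  have z2 : (1 - Y * A) * Y = 0 := by
    rw [Matrix.sub_mul, Matrix.one_mul, hs.mul_mul_left, sub_self]
  -- group the terms as `C * B * D` and `C * Bᵀ * D`, whose sums over `B = single i j 1` are traces
  have expand : ∀ B : Matrix ι κ ℝ,
      (moorePenroseDeriv Y B)ᵀ * M * A * Y + Aᵀ * M * moorePenroseDeriv Y B * Y + Aᵀ * M * A * B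
      = -(Aᵀ * Bᵀ * (Aᵀ * M * A * Y)) + Aᵀ * A * B * ((1 - A * Y) * M * A * Y)
        + (1 - Y * A) * B * (A * Aᵀ * M * A * Y) - Aᵀ * M * A * B * (A * Y)
        + Aᵀ * M * (1 - A * Y) * Bᵀ * (Aᵀ * A * Y)
        + Aᵀ * M * A * B * (1 : Matrix κ κ ℝ) := by
    intro B
    have e1 : (moorePenroseDeriv Y B)ᵀ = -(Aᵀ * Bᵀ * Aᵀ) + Aᵀ * A * B * (1 - A * Y)
        + (1 - Y * A) * B * (A * Aᵀ) := by
      simp only [moorePenroseDeriv, ← hA, Matrix.transpose_add, Matrix.transpose_neg,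
        Matrix.transpose_sub, Matrix.transpose_one, Matrix.transpose_transpose,
        hs.symm_left, hs.symm_right, Matrix.transpose_mul (_ * _) _,
        Matrix.transpose_mul A B, Matrix.transpose_mul (1 - A * Y) Bᵀ, Matrix.transpose_mul A Aᵀ]
      simp only [Matrix.mul_assoc]
    have e2 : moorePenroseDeriv Y B * Y = -(A * B * (A * Y)) + (1 - A * Y) * Bᵀ * (Aᵀ * A * Y) := by
      rw [moorePenroseDeriv, ← hA, Matrix.add_mul, Matrix.add_mul, Matrix.mul_assoc _ (1 - Y * A) Y,
        z2]
      simp only [Matrix.mul_zero, add_zero, Matrix.neg_mul, Matrix.mul_assoc]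
    rw [Matrix.mul_assoc _ (moorePenroseDeriv Y B) Y, e2, e1]
    simp only [Matrix.add_mul, Matrix.mul_add, Matrix.neg_mul, Matrix.mul_neg, Matrix.mul_one]
    simp only [Matrix.mul_assoc]
    abel
  have tF : (A * Aᵀ * M * A * Y).trace = gramF X Y := by
    have e : A * Y * (A * Aᵀ * M) = A * Aᵀ * M := by
      rw [← Matrix.mul_assoc (A * Y) _ M, ← Matrix.mul_assoc (A * Y) A, hs.mul_mul_right]
    rw [hF, Matrix.mul_assoc _ A Y, Matrix.trace_mul_comm, e]
  have tF' : (Aᵀ * M * A).trace = gramF X Y := by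
    rw [hF, Matrix.trace_mul_comm, ← Matrix.mul_assoc]
  simp only [expand]
  simp only [Matrix.add_apply, Matrix.sub_apply, Matrix.neg_apply, Finset.sum_add_distrib,
    Finset.sum_sub_distrib, Finset.sum_neg_distrib, sum_mul_single_mul,
    sum_mul_single_transpose_mul]
  have t1 : (Aᵀᵀ * (Aᵀ * M * A * Y)).trace = gramF X Y := by
    rw [Matrix.transpose_transpose, ← tF]; simp only [Matrix.mul_assoc]
  have t2 : ((1 - A * Y) * M * A * Y).trace = 0 := by
    rw [Matrix.mul_assoc _ A Y, Matrix.trace_mul_comm, ← Matrix.mul_assoc, z1, Matrix.zero_mul,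
      Matrix.trace_zero]
  have t5 : ((Aᵀ * M * (1 - A * Y))ᵀ * (Aᵀ * A * Y)).trace = 0 := by
    rw [Matrix.transpose_mul, Matrix.transpose_sub, Matrix.transpose_one, hs.symm_right,
      Matrix.mul_assoc (1 - A * Y), Matrix.trace_mul_comm, Matrix.mul_assoc, Matrix.mul_assoc Aᵀ,
      Matrix.mul_assoc Aᵀ, z1]
    simp
  have t3 : (1 - Y * A).trace = (Fintype.card ι : ℝ)
      - (min (Fintype.card ι) (Fintype.card κ) : ℕ) := by
    rw [Matrix.trace_sub, Matrix.trace_one, Matrix.trace_mul_comm, htr]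
  rw [t1, t2, t5, t3, tF, tF', htr, Matrix.trace_one]
  ring

/-! ### Directional derivatives along the fields -/

theorem hasDerivAt_gramF_dualField [DecidableEq ι] [DecidableEq κ] (h : gramDet Y ≠ 0) :
    HasDerivAt (fun t : ℝ => gramF X (Y + t • dualField X Y)) (-2 * gramT X Y) 0 := by
  have hA := hasMatrixDerivAt_moorePenrose h (dualField X Y)
  have := (((HasMatrixDerivAt.const Xᵀ 0).mul (hA.mul hA.transpose)).mul
    (HasMatrixDerivAt.const X 0)).trace
  refine this.congr_deriv ?_
  rw [moorePenroseDeriv_dualField]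
  simp only [zero_smul, add_zero, Matrix.zero_mul, zero_add, Matrix.mul_zero]
  set A := moorePenrose Y with hA
  have e1 : (Xᵀ * (A * (Aᵀ * (X * Xᵀ) * A) * Aᵀ) * X).trace = gramT X Y := by
    rw [gramT, ← hA, ← Matrix.trace_mul_comm X,
      show X * (Xᵀ * (A * (Aᵀ * (X * Xᵀ) * A) * Aᵀ)) =
      (X * Xᵀ * A * (Aᵀ * (X * Xᵀ) * A)) * Aᵀ by simp only [Matrix.mul_assoc],
      Matrix.trace_mul_comm]
    simp only [Matrix.mul_assoc]
  have e2 : (A * (Aᵀ * (X * Xᵀ) * A))ᵀ = (Aᵀ * (X * Xᵀ) * A) * Aᵀ := by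
    simp only [Matrix.transpose_mul, Matrix.transpose_transpose, Matrix.mul_assoc]
  rw [Matrix.transpose_neg, e2, Matrix.mul_neg, Matrix.neg_mul, ← Matrix.mul_assoc A _ Aᵀ,
    ← neg_add, ← two_smul ℝ, Matrix.mul_neg, Matrix.neg_mul, Matrix.mul_smul, Matrix.smul_mul,
    Matrix.trace_neg, Matrix.trace_smul, e1]
  simp

theorem hasDerivAt_gramF_projField :
    HasDerivAt (fun t : ℝ => gramF (X + t • projField X Y) Y) (2 * gramF X Y) 0 := by
  have hX := HasMatrixDerivAt.add_smul X (projField X Y) 0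
  have := ((hX.transpose.mul
    (HasMatrixDerivAt.const (moorePenrose Y * (moorePenrose Y)ᵀ) 0)).mul hX).trace
  refine this.congr_deriv ?_
  have hs := moorePenrose_spec Y
  simp only [zero_smul, add_zero, Matrix.mul_zero]
  have e : (moorePenrose Y * (moorePenrose Y)ᵀ) * projField X Y
      = moorePenrose Y * (moorePenrose Y)ᵀ * X := by
    rw [projField, ← hs.symm_right, Matrix.transpose_mul, ← Matrix.mul_assoc, ← Matrix.mul_assoc,
      hs.mul_mul_transpose]
  have e' : (projField X Y)ᵀ * (moorePenrose Y * (moorePenrose Y)ᵀ)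
      = Xᵀ * (moorePenrose Y * (moorePenrose Y)ᵀ) := by
    have := congrArg Matrix.transpose e
    simpa [Matrix.transpose_mul, Matrix.mul_assoc] using this
  rw [e', Matrix.mul_assoc _ _ (projField X Y), e, Matrix.trace_add, ← Matrix.mul_assoc Xᵀ _ X,
    gramF]
  ring

end Fields

/-! ### Cutoff functions -/

open Real (smoothTransition)

theorem deriv_smoothTransition_nonneg (x : ℝ) : 0 ≤ deriv smoothTransition x :=
  Real.smoothTransition.monotone.deriv_nonneg

theorem deriv_smoothTransition_of_one_lt {x : ℝ} (h : 1 < x) : deriv smoothTransition x = 0 := by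
  have : smoothTransition =ᶠ[nhds x] fun _ => 1 :=
    (eventually_gt_nhds h).mono fun y hy => Real.smoothTransition.one_of_one_le hy.le
  rw [this.deriv_eq, deriv_const]

theorem deriv_smoothTransition_of_neg {x : ℝ} (h : x < 0) : deriv smoothTransition x = 0 := by
  have : smoothTransition =ᶠ[nhds x] fun _ => 0 :=
    (eventually_lt_nhds h).mono fun y hy => Real.smoothTransition.zero_of_nonpos hy.le
  rw [this.deriv_eq, deriv_const]

theorem exists_deriv_smoothTransition_le : ∃ C : ℝ, 0 ≤ C ∧ ∀ x, deriv smoothTransition x ≤ C := by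
  have hc : Continuous (deriv smoothTransition) :=
    (Real.smoothTransition.contDiff (n := 1)).continuous_deriv (by norm_num)
  obtain ⟨x₀, -, hx₀⟩ := (isCompact_Icc (a := (0 : ℝ)) (b := 1)).exists_isMaxOn
    ⟨0, by simp⟩ hc.continuousOn
  refine ⟨deriv smoothTransition x₀, deriv_smoothTransition_nonneg _, fun x => ?_⟩
  rcases lt_or_ge x 0 with h | h
  · rw [deriv_smoothTransition_of_neg h]; exact deriv_smoothTransition_nonneg _
  rcases lt_or_ge 1 x with h' | h'
  · rw [deriv_smoothTransition_of_one_lt h']; exact deriv_smoothTransition_nonneg _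
  · exact hx₀ ⟨h, h'⟩

theorem hasDerivAt_smoothTransition (x : ℝ) :
    HasDerivAt smoothTransition (deriv smoothTransition x) x :=
  ((Real.smoothTransition.contDiffAt (n := 1)).differentiableAt one_ne_zero).hasDerivAt

/-- A smooth cutoff at infinity: `1` on `(-∞, 1]` and `0` on `[2, ∞)`. -/
noncomputable def highCut (u : ℝ) : ℝ := smoothTransition (2 - u)

/-- A cutoff near `0`, of logarithmic type: its derivative at `u > 0` is at most a constant
multiple of `η / u`, and it tends to `1` on `(0, ∞)` as `η` tends to `0`. -/
noncomputable def lowCut (η u : ℝ) : ℝ := smoothTransition (2 * u ^ η - 1)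

theorem highCut_nonneg (u : ℝ) : 0 ≤ highCut u := Real.smoothTransition.nonneg _

theorem highCut_le_one (u : ℝ) : highCut u ≤ 1 := Real.smoothTransition.le_one _

theorem highCut_of_two_le {u : ℝ} (h : 2 ≤ u) : highCut u = 0 :=
  Real.smoothTransition.zero_of_nonpos (by linarith)

theorem highCut_of_le_one {u : ℝ} (h : u ≤ 1) : highCut u = 1 :=
  Real.smoothTransition.one_of_one_le (by linarith)

theorem contDiff_highCut : ContDiff ℝ 1 highCut :=
  Real.smoothTransition.contDiff.comp (contDiff_const.sub contDiff_id)

theorem hasDerivAt_highCut (u : ℝ) :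
    HasDerivAt highCut (-deriv smoothTransition (2 - u)) u := by
  have := (hasDerivAt_smoothTransition (2 - u)).comp u ((hasDerivAt_id u).const_sub 2)
  exact this.congr_deriv (by simp)

theorem lowCut_nonneg (η u : ℝ) : 0 ≤ lowCut η u := Real.smoothTransition.nonneg _

theorem lowCut_le_one (η u : ℝ) : lowCut η u ≤ 1 := Real.smoothTransition.le_one _

theorem eventually_lowCut_eq_zero {η : ℝ} (hη : 0 < η) : ∀ᶠ u in nhds (0 : ℝ), lowCut η u = 0 := by
  have hc : ContinuousAt (fun u : ℝ => 2 * u ^ η - 1) 0 :=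
    ((Real.continuousAt_rpow_const 0 η (Or.inr hη.le)).const_mul 2).sub continuousAt_const
  have h0 : 2 * (0 : ℝ) ^ η - 1 < 0 := by rw [Real.zero_rpow hη.ne']; norm_num
  exact (hc.eventually_lt continuousAt_const h0).mono fun u hu =>
    Real.smoothTransition.zero_of_nonpos hu.le

theorem contDiffAt_lowCut (η : ℝ) {u : ℝ} (hu : 0 < u) : ContDiffAt ℝ 1 (lowCut η) u :=
  Real.smoothTransition.contDiffAt.comp u
    ((contDiffAt_const.mul (Real.contDiffAt_rpow_const (Or.inl hu.ne'))).sub contDiffAt_const)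

theorem hasDerivAt_lowCut (η : ℝ) {u : ℝ} (hu : 0 < u) :
    HasDerivAt (lowCut η)
      (deriv smoothTransition (2 * u ^ η - 1) * (2 * (η * u ^ (η - 1)))) u :=
  (hasDerivAt_smoothTransition _).comp u
    (((Real.hasDerivAt_rpow_const (Or.inl hu.ne')).const_mul 2).sub_const 1)

/-- The reason for the logarithmic cutoff: its logarithmic derivative is `O(η)`, uniformly in `u`. -/
theorem mul_deriv_lowCut_le {η u C : ℝ} (hη : 0 ≤ η) (hu : 0 < u)
    (hC : ∀ x, deriv smoothTransition x ≤ C) :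
    u * (deriv smoothTransition (2 * u ^ η - 1) * (2 * (η * u ^ (η - 1)))) ≤ 2 * C * η := by
  have hC0 : 0 ≤ C := (deriv_smoothTransition_nonneg 0).trans (hC 0)
  have e : u * (deriv smoothTransition (2 * u ^ η - 1) * (2 * (η * u ^ (η - 1))))
      = 2 * η * (deriv smoothTransition (2 * u ^ η - 1) * u ^ η) := by
    rw [Real.rpow_sub_one hu.ne']
    field_simp
  rw [e]
  have : deriv smoothTransition (2 * u ^ η - 1) * u ^ η ≤ C := by
    rcases le_or_gt (u ^ η) 1 with h | h
    · calc _ ≤ C * 1 := mul_le_mul (hC _) h (Real.rpow_nonneg hu.le _) hC0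
        _ = C := mul_one C
    · rw [deriv_smoothTransition_of_one_lt (by linarith), zero_mul]
      exact hC0
  nlinarith

theorem tendsto_lowCut {u : ℝ} (hu : 0 < u) {η : ℕ → ℝ}
    (hη : Filter.Tendsto η Filter.atTop (nhds 0)) :
    Filter.Tendsto (fun k => lowCut (η k) u) Filter.atTop (nhds 1) := by
  have hc : Continuous fun x : ℝ => lowCut x u :=
    Real.smoothTransition.continuous.comp
      ((continuous_const.mul (Real.continuous_const_rpow hu.ne')).sub continuous_const)
  have : lowCut 0 u = 1 := by
    rw [lowCut, Real.rpow_zero]; norm_num [Real.smoothTransition.one]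
  rw [← this]
  exact (hc.tendsto 0).comp hη

/-! ### The shrinkage weight and its directional derivatives -/

section Weight

variable {ι κ l : Type*} [Fintype ι] [Fintype κ] [Fintype l]

open scoped RealInnerProductSpace in
theorem inner_entryVec {m n : Type*} [Fintype m] [Fintype n] (x : EuclideanSpace ℝ (m × n))
    (V : Matrix m n ℝ) : ⟪x, entryVec V⟫ = ((entryMat x)ᵀ * V).trace := by
  rw [trace_transpose_mul_eq_sum, PiLp.inner_apply, Fintype.sum_prod_type]
  simp [entryVec, mul_comm]

theorem norm_sq_eq_trace {m n : Type*} [Fintype m] [Fintype n] (x : EuclideanSpace ℝ (m × n)) :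
    ‖x‖ ^ 2 = ((entryMat x)ᵀ * entryMat x).trace := by
  rw [← inner_entryVec, entryVec_entryMat, real_inner_self_eq_norm_sq]

theorem contDiffAt_entryMat_fst
    {z : EuclideanSpace ℝ (κ × l) × EuclideanSpace ℝ (ι × κ)} (i : κ) (j : l) : ContDiffAt ℝ 1
    (fun z : EuclideanSpace ℝ (κ × l) × EuclideanSpace ℝ (ι × κ) => entryMat z.1 i j) z := by
  simp only [entryMat_apply]; fun_prop

theorem contDiffAt_entryMat_snd
    {z : EuclideanSpace ℝ (κ × l) × EuclideanSpace ℝ (ι × κ)} (i : ι) (j : κ) : ContDiffAt ℝ 1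
    (fun z : EuclideanSpace ℝ (κ × l) × EuclideanSpace ℝ (ι × κ) => entryMat z.2 i j) z := by
  simp only [entryMat_apply]; fun_prop

variable [DecidableEq ι] [DecidableEq κ]

/-- The factor `s(F)` of the shrinkage estimator, cut off for large `X`, for large `Y` and for `Y`
close to a matrix of lower rank. -/
noncomputable def shrinkWeight (s : ℝ → ℝ) (η a d : ℝ)
    (z : EuclideanSpace ℝ (κ × l) × EuclideanSpace ℝ (ι × κ)) : ℝ :=
  highCut (‖z.1‖ ^ 2 / a) * highCut (‖z.2‖ ^ 2 / d) * lowCut η (gramDet (entryMat z.2)) *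
    s (gramF (entryMat z.1) (entryMat z.2))

variable {s : ℝ → ℝ} {η a d : ℝ} {z : EuclideanSpace ℝ (κ × l) × EuclideanSpace ℝ (ι × κ)}

theorem shrinkWeight_of_le_norm_fst (ha : 0 < a) (h : 2 * a ≤ ‖z.1‖ ^ 2) :
    shrinkWeight s η a d z = 0 := by
  rw [shrinkWeight, highCut_of_two_le ((le_div_iff₀ ha).2 h)]; simp

theorem shrinkWeight_of_le_norm_snd (hd : 0 < d) (h : 2 * d ≤ ‖z.2‖ ^ 2) :
    shrinkWeight s η a d z = 0 := by
  rw [shrinkWeight, highCut_of_two_le ((le_div_iff₀ hd).2 h)]; simp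

theorem hasCompactSupport_of_shrinkWeight (ha : 0 < a) (hd : 0 < d)
    {f : EuclideanSpace ℝ (κ × l) × EuclideanSpace ℝ (ι × κ) → ℝ}
    (hf : ∀ z, shrinkWeight s η a d z = 0 → f z = 0) : HasCompactSupport f := by
  refine HasCompactSupport.intro
    (K := Metric.closedBall 0 (Real.sqrt (2 * a)) ×ˢ Metric.closedBall 0 (Real.sqrt (2 * d)))
    ((isCompact_closedBall _ _).prod (isCompact_closedBall _ _)) fun z hz => hf z ?_
  rw [Set.mem_prod, not_and_or, mem_closedBall_zero_iff, mem_closedBall_zero_iff, not_le,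
    not_le] at hz
  rcases hz with h | h
  · refine shrinkWeight_of_le_norm_fst ha ?_
    rw [← Real.sq_sqrt (by positivity : 0 ≤ 2 * a)]
    gcongr
  · refine shrinkWeight_of_le_norm_snd hd ?_
    rw [← Real.sq_sqrt (by positivity : 0 ≤ 2 * d)]
    gcongr

theorem contDiffAt_gramF (h : gramDet (entryMat z.2) ≠ 0) : ContDiffAt ℝ 1
    (fun z : EuclideanSpace ℝ (κ × l) × EuclideanSpace ℝ (ι × κ) =>
      gramF (entryMat z.1) (entryMat z.2)) z := by
  have hA := contDiffAt_moorePenrose (contDiffAt_entryMat_snd (z := z)) h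
  exact contDiffAt_matrix_trace (contDiffAt_matrix_mul (contDiffAt_matrix_mul
    (fun i j => contDiffAt_entryMat_fst j i) (contDiffAt_matrix_mul hA fun i j => hA j i))
    contDiffAt_entryMat_fst)

theorem contDiffAt_projField (h : gramDet (entryMat z.2) ≠ 0) (i : κ) (j : l) : ContDiffAt ℝ 1
    (fun z : EuclideanSpace ℝ (κ × l) × EuclideanSpace ℝ (ι × κ) =>
      projField (entryMat z.1) (entryMat z.2) i j) z :=
  contDiffAt_matrix_mul (contDiffAt_matrix_mul
    (contDiffAt_moorePenrose (contDiffAt_entryMat_snd (z := z)) h) contDiffAt_entryMat_snd)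
    contDiffAt_entryMat_fst i j

theorem contDiffAt_dualField (h : gramDet (entryMat z.2) ≠ 0) (i : ι) (j : κ) : ContDiffAt ℝ 1
    (fun z : EuclideanSpace ℝ (κ × l) × EuclideanSpace ℝ (ι × κ) =>
      dualField (entryMat z.1) (entryMat z.2) i j) z := by
  have hA := contDiffAt_moorePenrose (contDiffAt_entryMat_snd (z := z)) h
  exact contDiffAt_matrix_mul (contDiffAt_matrix_mul (contDiffAt_matrix_mul (fun i j => hA j i)
    (contDiffAt_matrix_mul contDiffAt_entryMat_fst fun i j => contDiffAt_entryMat_fst j i)) hA)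
    contDiffAt_entryMat_snd i j

theorem contDiffAt_shrinkWeight (hs : ContDiff ℝ 1 s) (h : gramDet (entryMat z.2) ≠ 0) :
    ContDiffAt ℝ 1 (shrinkWeight s η a d) z := by
  refine ((ContDiffAt.mul ?_ ?_).mul ?_).mul (hs.contDiffAt.comp z (contDiffAt_gramF h))
  · exact contDiff_highCut.contDiffAt.comp z ((contDiffAt_fst.norm_sq ℝ).div_const a)
  · exact contDiff_highCut.contDiffAt.comp z ((contDiffAt_snd.norm_sq ℝ).div_const d)
  · exact ContDiffAt.comp (g := lowCut η) z
      (contDiffAt_lowCut η ((gramDet_nonneg _).lt_of_ne' h))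
      (contDiffAt_gramDet contDiffAt_entryMat_snd)

theorem eventually_shrinkWeight_eq_zero (hη : 0 < η) (h : gramDet (entryMat z.2) = 0) :
    ∀ᶠ z' in nhds z, shrinkWeight s η a d z' = 0 := by
  have hc : ContinuousAt (fun z : EuclideanSpace ℝ (κ × l) × EuclideanSpace ℝ (ι × κ) =>
      gramDet (entryMat z.2)) z :=
    (contDiffAt_gramDet contDiffAt_entryMat_snd).continuousAt
  have : ∀ᶠ u in nhds (gramDet (entryMat z.2)), lowCut η u = 0 := by
    rw [h]; exact eventually_lowCut_eq_zero hη
  exact (hc.eventually this).mono fun z' hz' => by simp only [shrinkWeight, hz']; simp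

/-- A function that vanishes with the weight and is smooth at matrices `Y` of full rank is
smooth. -/
theorem contDiff_of_shrinkWeight (hη : 0 < η)
    {f : EuclideanSpace ℝ (κ × l) × EuclideanSpace ℝ (ι × κ) → ℝ}
    (hf : ∀ z, shrinkWeight s η a d z = 0 → f z = 0)
    (hf' : ∀ z, gramDet (entryMat z.2) ≠ 0 → ContDiffAt ℝ 1 f z) : ContDiff ℝ 1 f := by
  rw [contDiff_iff_contDiffAt]
  intro z
  by_cases h : gramDet (entryMat z.2) = 0
  · refine (contDiffAt_const (c := (0 : ℝ))).congr_of_eventuallyEq ?_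
    exact (eventually_shrinkWeight_eq_zero (s := s) (a := a) (d := d) hη h).mono
      fun z' hz' => hf z' hz'
  · exact hf' z h

theorem shrinkWeight_nonneg (hs : ∀ t, 0 ≤ t → 0 ≤ s t) : 0 ≤ shrinkWeight s η a d z :=
  mul_nonneg (mul_nonneg (mul_nonneg (highCut_nonneg _) (highCut_nonneg _)) (lowCut_nonneg _ _))
    (hs _ (gramF_nonneg _ _))

open scoped RealInnerProductSpace in
theorem hasDerivAt_norm_add_smul_sq {E : Type*} [NormedAddCommGroup E] [InnerProductSpace ℝ E]
    (x v : E) : HasDerivAt (fun t : ℝ => ‖x + t • v‖ ^ 2) (2 * ⟪x, v⟫) 0 := by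
  have h : HasDerivAt (fun t : ℝ => x + t • v) v 0 := by
    simpa using ((hasDerivAt_id (0 : ℝ)).smul_const v).const_add x
  simpa using h.norm_sq

/-- The derivative of the weight in the direction of `projField`, in the variable `X`. -/
theorem fderiv_shrinkWeight_projField (hs : ContDiff ℝ 1 s) (h : gramDet (entryMat z.2) ≠ 0) :
    fderiv ℝ (shrinkWeight s η a d) z (entryVec (projField (entryMat z.1) (entryMat z.2)), 0)
      = -deriv smoothTransition (2 - ‖z.1‖ ^ 2 / a)
          * (2 * projSq (entryMat z.1) (entryMat z.2) / a) * highCut (‖z.2‖ ^ 2 / d)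
          * lowCut η (gramDet (entryMat z.2)) * s (gramF (entryMat z.1) (entryMat z.2))
        + highCut (‖z.1‖ ^ 2 / a) * highCut (‖z.2‖ ^ 2 / d)
          * lowCut η (gramDet (entryMat z.2))
          * (deriv s (gramF (entryMat z.1) (entryMat z.2))
            * (2 * gramF (entryMat z.1) (entryMat z.2))) := by
  have hd := (contDiffAt_shrinkWeight (η := η) (a := a) (d := d) hs h).differentiableAt one_ne_zero
  rw [← hd.lineDeriv_eq_fderiv]
  refine HasLineDerivAt.lineDeriv (?_ : HasDerivAt _ _ _)
  set x := z.1
  set y := z.2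
  set V := projField (entryMat x) (entryMat y) with hV
  have e : ∀ t : ℝ, z + t • (entryVec V, (0 : EuclideanSpace ℝ (ι × κ)))
      = (x + t • entryVec V, y) := by
    intro t; ext <;> simp [x, y]
  simp only [e, shrinkWeight, entryMat_add, entryMat_smul, entryMat_entryVec]
  have h1 := (hasDerivAt_norm_add_smul_sq x (entryVec V)).div_const a
  rw [inner_entryVec, hV, trace_transpose_mul_projField, ← hV] at h1
  have h2 := (hasDerivAt_highCut (‖x + (0 : ℝ) • entryVec V‖ ^ 2 / a)).comp 0 h1
  have h3 := hasDerivAt_gramF_projField (entryMat x) (Y := entryMat y)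
  rw [← hV] at h3
  have h4 := ((hs.differentiable one_ne_zero
    (gramF (entryMat x + (0 : ℝ) • V) (entryMat y))).hasDerivAt).comp 0 h3
  have h5 := ((h2.mul_const (highCut (‖y‖ ^ 2 / d))).mul_const
    (lowCut η (gramDet (entryMat y)))).mul h4
  refine h5.congr_deriv ?_
  simp only [zero_smul, add_zero, Function.comp_apply]

/-- The derivative of the weight in the direction of `dualField`, in the variable `Y`. -/
theorem fderiv_shrinkWeight_dualField (hs : ContDiff ℝ 1 s) (h : gramDet (entryMat z.2) ≠ 0) :
    fderiv ℝ (shrinkWeight s η a d) z (0, entryVec (dualField (entryMat z.1) (entryMat z.2)))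
      = highCut (‖z.1‖ ^ 2 / a) * (-deriv smoothTransition (2 - ‖z.2‖ ^ 2 / d)
          * (2 * projSq (entryMat z.1) (entryMat z.2) / d)) * lowCut η (gramDet (entryMat z.2))
          * s (gramF (entryMat z.1) (entryMat z.2))
        + highCut (‖z.1‖ ^ 2 / a) * highCut (‖z.2‖ ^ 2 / d)
          * (deriv smoothTransition (2 * gramDet (entryMat z.2) ^ η - 1)
              * (2 * (η * gramDet (entryMat z.2) ^ (η - 1)))
            * (2 * gramDet (entryMat z.2) * gramF (entryMat z.1) (entryMat z.2)))
          * s (gramF (entryMat z.1) (entryMat z.2))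
        + highCut (‖z.1‖ ^ 2 / a) * highCut (‖z.2‖ ^ 2 / d)
          * lowCut η (gramDet (entryMat z.2))
          * (deriv s (gramF (entryMat z.1) (entryMat z.2))
            * (-2 * gramT (entryMat z.1) (entryMat z.2))) := by
  have hd := (contDiffAt_shrinkWeight (η := η) (a := a) (d := d) hs h).differentiableAt one_ne_zero
  rw [← hd.lineDeriv_eq_fderiv]
  refine HasLineDerivAt.lineDeriv (?_ : HasDerivAt _ _ _)
  set x := z.1
  set y := z.2
  set V := dualField (entryMat x) (entryMat y) with hV
  have e : ∀ t : ℝ, z + t • ((0 : EuclideanSpace ℝ (κ × l)), entryVec V)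
      = (x, y + t • entryVec V) := by
    intro t; ext <;> simp [x, y]
  simp only [e, shrinkWeight, entryMat_add, entryMat_smul, entryMat_entryVec]
  have h1 := (hasDerivAt_norm_add_smul_sq y (entryVec V)).div_const d
  rw [inner_entryVec, hV, trace_transpose_mul_dualField, ← hV] at h1
  have h2 := (hasDerivAt_highCut (‖y + (0 : ℝ) • entryVec V‖ ^ 2 / d)).comp 0 h1
  have h3 := hasDerivAt_gramF_dualField (entryMat x) h
  rw [← hV] at h3
  have h4 := ((hs.differentiable one_ne_zero
    (gramF (entryMat x) (entryMat y + (0 : ℝ) • V))).hasDerivAt).comp 0 h3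
  have h6 := (HasMatrixDerivAt.add_smul (entryMat y) V 0).gramDet (by simpa using h)
  have hp : 0 < gramDet (entryMat y + (0 : ℝ) • V) := by
    simpa using (gramDet_nonneg _).lt_of_ne' h
  have h7 := (hasDerivAt_lowCut η hp).comp 0 h6
  have h5 := ((h2.const_mul (highCut (‖x‖ ^ 2 / a))).mul h7).mul h4
  have htr : (moorePenrose (entryMat y) * V).trace = gramF (entryMat x) (entryMat y) :=
    trace_moorePenrose_mul_dualField _ _
  refine h5.congr_deriv ?_
  simp only [zero_smul, add_zero, htr, Function.comp_apply, Pi.mul_apply]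
  ring

end Weight

/-! ### The divergence inequality -/

theorem sum_smul_single {m n : Type*} [Fintype m] [Fintype n] [DecidableEq m] [DecidableEq n]
    (V : Matrix m n ℝ) :
    ∑ i, ∑ j, V i j • EuclideanSpace.single (i, j) (1 : ℝ) = entryVec V := by
  rw [← Fintype.sum_prod_type' (f := fun i j => V i j • EuclideanSpace.single (i, j) (1 : ℝ))]
  ext ⟨a, b⟩
  simp only [WithLp.ofLp_sum, WithLp.ofLp_smul, Finset.sum_apply, Pi.smul_apply]
  rw [Finset.sum_eq_single (a, b)]
  · simp [entryVec]
  · intro k _ hk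
    simp [hk.symm]
  · simp

/-- The divergence of `w • V` in a group of variables, given the diagonal derivatives `D` of `V`. -/
theorem sum_fderiv_mul {m n E : Type*} [Fintype m] [Fintype n] [DecidableEq m] [DecidableEq n]
    [NormedAddCommGroup E] [NormedSpace ℝ E] (L : EuclideanSpace ℝ (m × n) →L[ℝ] E)
    {w : E → ℝ} {V : E → Matrix m n ℝ} {D : m → n → ℝ} {z : E} (hw : DifferentiableAt ℝ w z)
    (hV : ∀ i j, DifferentiableAt ℝ (fun z => V z i j) z)
    (hD : ∀ i j, HasDerivAt (fun t : ℝ => V (z + t • L (EuclideanSpace.single (i, j) 1)) i j)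
      (D i j) 0) :
    ∑ i, ∑ j, fderiv ℝ (fun z => w z * V z i j) z (L (EuclideanSpace.single (i, j) 1))
      = w z * ∑ i, ∑ j, D i j + fderiv ℝ w z (L (entryVec (V z))) := by
  have h : ∀ i j, fderiv ℝ (fun z => w z * V z i j) z (L (EuclideanSpace.single (i, j) 1))
      = w z * D i j + V z i j * fderiv ℝ w z (L (EuclideanSpace.single (i, j) 1)) := by
    intro i j
    have h1 : fderiv ℝ (fun z => V z i j) z (L (EuclideanSpace.single (i, j) 1)) = D i j := by
      rw [← (hV i j).lineDeriv_eq_fderiv]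
      exact HasLineDerivAt.lineDeriv (hD i j)
    rw [fderiv_fun_mul hw (hV i j)]
    simp [h1]
  simp only [h, Finset.sum_add_distrib, ← Finset.mul_sum]
  rw [← sum_smul_single (V z)]
  simp only [map_sum, map_smul, smul_eq_mul]

section Divergence

variable {ι κ l : Type*} [Fintype ι] [Fintype κ] [Fintype l] [DecidableEq ι] [DecidableEq κ]
variable {s : ℝ → ℝ} {η a d : ℝ} {z : EuclideanSpace ℝ (κ × l) × EuclideanSpace ℝ (ι × κ)}

theorem sum_fderiv_projField [DecidableEq l] (hs : ContDiff ℝ 1 s) (h : gramDet (entryMat z.2) ≠ 0) :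
    ∑ i, ∑ j, fderiv ℝ (fun z => shrinkWeight s η a d z
        * projField (entryMat z.1) (entryMat z.2) i j) z (EuclideanSpace.single (i, j) 1, 0)
      = shrinkWeight s η a d z
          * (Fintype.card l * (min (Fintype.card ι) (Fintype.card κ) : ℕ))
        + fderiv ℝ (shrinkWeight s η a d) z
          (entryVec (projField (entryMat z.1) (entryMat z.2)), 0) := by
  have hD : ∀ i j, HasDerivAt (fun t : ℝ => projField
      (entryMat (z + t • ContinuousLinearMap.inl ℝ (EuclideanSpace ℝ (κ × l))
        (EuclideanSpace ℝ (ι × κ)) (EuclideanSpace.single (i, j) 1)).1)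
      (entryMat (z + t • ContinuousLinearMap.inl ℝ (EuclideanSpace ℝ (κ × l))
        (EuclideanSpace ℝ (ι × κ)) (EuclideanSpace.single (i, j) 1)).2) i j)
      ((moorePenrose (entryMat z.2) * entryMat z.2 * (Matrix.single i j 1 : Matrix κ l ℝ)
        * (1 : Matrix l l ℝ)) i j) 0 := by
    intro i j
    have h1 := (HasMatrixDerivAt.const (moorePenrose (entryMat z.2) * entryMat z.2) 0).mul
      (HasMatrixDerivAt.add_smul (entryMat z.1) (Matrix.single i j 1 : Matrix κ l ℝ) 0)
    have h2 := h1 i j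
    simp only [Matrix.zero_mul, zero_add] at h2
    rw [Matrix.mul_one]
    refine h2.congr_of_eventuallyEq (.of_forall fun t => ?_)
    simp [projField, entryMat_add, entryMat_smul, entryMat_single]
  have := sum_fderiv_mul (ContinuousLinearMap.inl ℝ (EuclideanSpace ℝ (κ × l))
    (EuclideanSpace ℝ (ι × κ))) (w := shrinkWeight s η a d)
    (V := fun z => projField (entryMat z.1) (entryMat z.2))
    ((contDiffAt_shrinkWeight hs h).differentiableAt one_ne_zero)
    (fun i j => (contDiffAt_projField h i j).differentiableAt one_ne_zero) hD
  rw [sum_mul_single_mul, trace_moorePenrose_mul_self h, Matrix.trace_one] at this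
  simp only [ContinuousLinearMap.inl_apply] at this
  rw [this]
  ring

theorem sum_fderiv_dualField (hs : ContDiff ℝ 1 s) (h : gramDet (entryMat z.2) ≠ 0) :
    ∑ i, ∑ j, fderiv ℝ (fun z => shrinkWeight s η a d z ^ 2
        * dualField (entryMat z.1) (entryMat z.2) i j) z (0, EuclideanSpace.single (i, j) 1)
      = shrinkWeight s η a d z ^ 2 * (((Fintype.card ι : ℝ) + Fintype.card κ
          - 2 * (min (Fintype.card ι) (Fintype.card κ) : ℕ) - 1)
            * gramF (entryMat z.1) (entryMat z.2))
        + 2 * shrinkWeight s η a d z * fderiv ℝ (shrinkWeight s η a d) z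
          (0, entryVec (dualField (entryMat z.1) (entryMat z.2))) := by
  have hw := (contDiffAt_shrinkWeight (η := η) (a := a) (d := d) hs h).differentiableAt one_ne_zero
  set A := moorePenrose (entryMat z.2) with hA
  have hD : ∀ i j, HasDerivAt (fun t : ℝ => dualField
      (entryMat (z + t • ContinuousLinearMap.inr ℝ (EuclideanSpace ℝ (κ × l))
        (EuclideanSpace ℝ (ι × κ)) (EuclideanSpace.single (i, j) 1)).1)
      (entryMat (z + t • ContinuousLinearMap.inr ℝ (EuclideanSpace ℝ (κ × l))
        (EuclideanSpace ℝ (ι × κ)) (EuclideanSpace.single (i, j) 1)).2) i j)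
      (((moorePenroseDeriv (entryMat z.2) (Matrix.single i j 1 : Matrix ι κ ℝ))ᵀ
          * (entryMat z.1 * (entryMat z.1)ᵀ) * A * entryMat z.2
        + Aᵀ * (entryMat z.1 * (entryMat z.1)ᵀ)
          * moorePenroseDeriv (entryMat z.2) (Matrix.single i j 1 : Matrix ι κ ℝ) * entryMat z.2
        + Aᵀ * (entryMat z.1 * (entryMat z.1)ᵀ) * A
          * (Matrix.single i j 1 : Matrix ι κ ℝ)) i j) 0 := by
    intro i j
    have h0 := hasMatrixDerivAt_moorePenrose h (Matrix.single i j 1 : Matrix ι κ ℝ)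
    have h1 := ((h0.transpose.mul (HasMatrixDerivAt.const
      (entryMat z.1 * (entryMat z.1)ᵀ) 0)).mul h0).mul
      (HasMatrixDerivAt.add_smul (entryMat z.2) (Matrix.single i j 1 : Matrix ι κ ℝ) 0)
    have h2 := h1 i j
    simp only [Matrix.mul_zero, add_zero, zero_smul, Matrix.add_mul] at h2
    refine h2.congr_of_eventuallyEq (.of_forall fun t => ?_)
    simp [dualField, entryMat_add, entryMat_smul, entryMat_single]
  have := sum_fderiv_mul (ContinuousLinearMap.inr ℝ (EuclideanSpace ℝ (κ × l))
    (EuclideanSpace ℝ (ι × κ))) (w := fun z => shrinkWeight s η a d z ^ 2)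
    (V := fun z => dualField (entryMat z.1) (entryMat z.2)) (hw.pow 2)
    (fun i j => (contDiffAt_dualField h i j).differentiableAt one_ne_zero) hD
  rw [sum_deriv_dualField _ h] at this
  simp only [ContinuousLinearMap.inr_apply] at this
  rw [this, fderiv_fun_pow _ hw]
  simp

theorem fderiv_eq_zero_of_shrinkWeight (hη : 0 < η) (h : gramDet (entryMat z.2) = 0)
    {f : EuclideanSpace ℝ (κ × l) × EuclideanSpace ℝ (ι × κ) → ℝ}
    (hf : ∀ z, shrinkWeight s η a d z = 0 → f z = 0) : fderiv ℝ f z = 0 := by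
  have : f =ᶠ[nhds z] fun _ => 0 :=
    (eventually_shrinkWeight_eq_zero (s := s) (a := a) (d := d) hη h).mono fun z' hz' => hf z' hz'
  rw [this.fderiv_eq, fderiv_const_apply]

/-- The lower bound for the decrease of the loss. With `F = gramF X Y`, `w = r(F) / F`, `q` the number
of columns of `X`, `m` the smaller and `M` the larger dimension of `Y`, it is
`(r(F) / F) * (2 * (q * m - 2) - (M - m + 3) / q * r(F))`. -/
noncomputable def shrinkGain (X : Matrix κ l ℝ) (Y : Matrix ι κ ℝ) (w : ℝ) : ℝ :=
  w * (2 * (Fintype.card l * (min (Fintype.card ι) (Fintype.card κ) : ℕ) - 2)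
    - ((Fintype.card ι : ℝ) + Fintype.card κ
      - 2 * (min (Fintype.card ι) (Fintype.card κ) : ℕ) + 3) / Fintype.card l
      * (w * gramF X Y))

/-- The inequality `divergence_le` at a point with `Y` of full rank, in terms of the values there of
the cutoffs `hX`, `hY`, `ψ` and their derivatives `-h₁`, `-h₂`, `ψ'`, and of `F = gramF`,
`T = gramT`, `Q = projSq`, `D = gramDet`, `y = ‖Y‖²`. The constant `c - 4` comes from the divergence
of `dualField`; bounding `-2 T` times the derivative of `s` adds the missing `4`. -/
theorem divergence_bound_aux {s s' F T Q D ψ' hX hY ψ h₁ h₂ q m c b B a d C η y : ℝ}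
    (hq : 0 < q) (ha : 0 < a) (hd : 0 < d) (hη : 0 ≤ η)
    (hX0 : 0 ≤ hX) (hX1 : hX ≤ 1) (hY0 : 0 ≤ hY) (hY1 : hY ≤ 1) (hψ0 : 0 ≤ ψ) (hψ1 : ψ ≤ 1)
    (hs0 : 0 ≤ s) (hsB : s ≤ B) (hsb : F * s ≤ b) (hs' : 0 ≤ s + F * s') (hF : 0 ≤ F)
    (hT0 : 0 ≤ T) (hT : T ≤ F ^ 2) (hQ0 : 0 ≤ Q) (hQ : Q ≤ y * F) (hy : 2 * d ≤ y → hY = 0)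
    (h₁0 : 0 ≤ h₁) (h₁C : h₁ ≤ C) (h₂0 : 0 ≤ h₂) (hψ' : D * ψ' ≤ 2 * C * η) :
    -2 * (hX * hY * ψ * s * (q * m)
        + (-h₁ * (2 * Q / a) * hY * ψ * s + hX * hY * ψ * (s' * (2 * F))))
      + q⁻¹ * ((hX * hY * ψ * s) ^ 2 * ((c - 4) * F)
        + 2 * (hX * hY * ψ * s) * (hX * (-h₂ * (2 * Q / d)) * ψ * s
          + hX * hY * (ψ' * (2 * D * F)) * s + hX * hY * ψ * (s' * (-2 * T))))
      ≤ -(hX * hY * ψ * s * (2 * (q * m - 2) - c / q * (hX * hY * ψ * s * F)))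
        + (8 * C * b * d / a + q⁻¹ * (8 * C * η * b * B)) := by
  have hC0 : 0 ≤ C := h₁0.trans h₁C
  have hb0 : 0 ≤ b := (mul_nonneg hF hs0).trans hsb
  set k := hX * hY * ψ with hk
  have hk0 : 0 ≤ k := by positivity
  have hk1 : k ≤ 1 := mul_le_one₀ (mul_le_one₀ hX1 hY0 hY1) hψ0 hψ1
  -- the cutoff in `X`
  have e1 : h₁ * (2 * Q / a) * hY * ψ * s ≤ 4 * C * b * d / a := by
    have hYQ : hY * Q ≤ 2 * d * F := by
      rcases le_or_gt (2 * d) y with h | h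
      · rw [hy h, zero_mul]; positivity
      · calc hY * Q ≤ 1 * Q := mul_le_mul_of_nonneg_right hY1 hQ0
          _ ≤ y * F := by rw [one_mul]; exact hQ
          _ ≤ 2 * d * F := mul_le_mul_of_nonneg_right h.le hF
    calc h₁ * (2 * Q / a) * hY * ψ * s = h₁ * ψ * (2 / a) * ((hY * Q) * s) := by ring
      _ ≤ C * 1 * (2 / a) * ((2 * d * F) * s) := by gcongr
      _ = 4 * C * d / a * (F * s) := by ring
      _ ≤ 4 * C * d / a * b := by gcongr
      _ = 4 * C * b * d / a := by ring
  -- monotonicity of `t * s t`, in the variable `X`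
  have e2 : -(k * (s' * (2 * F))) ≤ 2 * (k * s) := by nlinarith
  -- monotonicity of `t * s t`, in the variable `Y`
  have e3 : -(s' * T) ≤ s * F := by
    rcases le_or_gt 0 s' with h | h
    · nlinarith [mul_nonneg h hT0, mul_nonneg hs0 hF]
    · nlinarith [mul_le_mul_of_nonneg_left hT (neg_nonneg.2 h.le), mul_nonneg hF hs']
  have hks : 0 ≤ k * s := mul_nonneg hk0 hs0
  have e3' : 2 * (k * s) * (k * (s' * (-2 * T))) ≤ 4 * ((k * s) ^ 2 * F) := by
    nlinarith [mul_le_mul_of_nonneg_left e3 (mul_nonneg hks hk0)]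
  -- the cutoff at large `Y` has a favourable sign
  have e4 : 2 * (k * s) * (hX * (-h₂ * (2 * Q / d)) * ψ * s) ≤ 0 := by
    have : 0 ≤ 2 * (k * s) * (hX * (h₂ * (2 * Q / d)) * ψ * s) := by positivity
    nlinarith
  -- the cutoff near matrices of lower rank
  have e5 : 2 * (k * s) * (hX * hY * (ψ' * (2 * D * F)) * s) ≤ 8 * C * η * b * B := by
    have hB0 : 0 ≤ B := hs0.trans hsB
    calc 2 * (k * s) * (hX * hY * (ψ' * (2 * D * F)) * s)
        = (4 * (k * s) * (hX * hY) * (F * s)) * (D * ψ') := by ring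
      _ ≤ (4 * (k * s) * (hX * hY) * (F * s)) * (2 * C * η) := by gcongr
      _ ≤ (4 * (1 * B) * (1 * 1) * b) * (2 * C * η) := by gcongr
      _ = _ := by ring
  have e6 : (k * s) ^ 2 * ((c - 4) * F)
        + 2 * (k * s) * (hX * (-h₂ * (2 * Q / d)) * ψ * s
          + hX * hY * (ψ' * (2 * D * F)) * s + k * (s' * (-2 * T)))
      ≤ c * ((k * s) ^ 2 * F) + 8 * C * η * b * B := by linarith
  have e7 := mul_le_mul_of_nonneg_left e6 (inv_nonneg.2 hq.le)
  have e8 : 8 * C * b * d / a = 2 * (4 * C * b * d / a) := by ring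
  have e9 : c / q * (k * s * F) * (k * s) = q⁻¹ * (c * ((k * s) ^ 2 * F)) := by ring
  linear_combination e7 + 2 * e1 + 2 * e2

/-- The expression to which Stein's lemma reduces the change of the loss is at most minus the gain,
up to an error caused by the cutoffs at large `X` and at matrices of lower rank. -/
theorem divergence_le [DecidableEq l] (hη : 0 < η) (ha : 0 < a) (hd : 0 < d) {b B C : ℝ}
    (hl : 0 < Fintype.card l) (hs : ContDiff ℝ 1 s) (hs0 : ∀ t, 0 ≤ t → 0 ≤ s t)
    (hsB : ∀ t, 0 ≤ t → s t ≤ B) (hsb : ∀ t, 0 ≤ t → t * s t ≤ b)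
    (hs' : ∀ t, 0 ≤ t → 0 ≤ s t + t * deriv s t) (hC : ∀ x, deriv smoothTransition x ≤ C) :
    -2 * ∑ i, ∑ j, fderiv ℝ (fun z => shrinkWeight s η a d z
        * projField (entryMat z.1) (entryMat z.2) i j) z (EuclideanSpace.single (i, j) 1, 0)
      + (Fintype.card l : ℝ)⁻¹ * ∑ i, ∑ j, fderiv ℝ (fun z => shrinkWeight s η a d z ^ 2
        * dualField (entryMat z.1) (entryMat z.2) i j) z (0, EuclideanSpace.single (i, j) 1)
      ≤ -shrinkGain (entryMat z.1) (entryMat z.2) (shrinkWeight s η a d z)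
        + (8 * C * b * d / a + (Fintype.card l : ℝ)⁻¹ * (8 * C * η * b * B)) := by
  have hC0 : 0 ≤ C := (deriv_smoothTransition_nonneg 0).trans (hC 0)
  have hb0 : 0 ≤ b := by simpa using hsb 0 le_rfl
  have hB0 : 0 ≤ B := (hs0 0 le_rfl).trans (hsB 0 le_rfl)
  by_cases h : gramDet (entryMat z.2) = 0
  · have hw : shrinkWeight s η a d z = 0 := (eventually_shrinkWeight_eq_zero hη h).self_of_nhds
    have h1 : ∀ i j, fderiv ℝ (fun z => shrinkWeight s η a d z
        * projField (entryMat z.1) (entryMat z.2) i j) z = 0 := fun i j =>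
      fderiv_eq_zero_of_shrinkWeight (s := s) (a := a) (d := d) hη h
        fun z hz => by rw [hz, zero_mul]
    have h2 : ∀ i j, fderiv ℝ (fun z => shrinkWeight s η a d z ^ 2
        * dualField (entryMat z.1) (entryMat z.2) i j) z = 0 := fun i j =>
      fderiv_eq_zero_of_shrinkWeight (s := s) (a := a) (d := d) hη h
        fun z hz => by rw [hz]; simp
    simp only [h1, h2, hw, shrinkGain]
    simp
    positivity
  · have hF := gramF_nonneg (entryMat z.1) (entryMat z.2)
    rw [sum_fderiv_projField hs h, sum_fderiv_dualField hs h, fderiv_shrinkWeight_projField hs h,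
      fderiv_shrinkWeight_dualField hs h]
    have := divergence_bound_aux (q := Fintype.card l)
      (m := (min (Fintype.card ι) (Fintype.card κ) : ℕ))
      (c := (Fintype.card ι : ℝ) + Fintype.card κ
        - 2 * (min (Fintype.card ι) (Fintype.card κ) : ℕ) + 3) (y := ‖z.2‖ ^ 2)
      (by exact_mod_cast hl) ha hd hη.le
      (highCut_nonneg (‖z.1‖ ^ 2 / a)) (highCut_le_one _)
      (highCut_nonneg (‖z.2‖ ^ 2 / d)) (highCut_le_one _)
      (lowCut_nonneg η (gramDet (entryMat z.2))) (lowCut_le_one _ _)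
      (hs0 _ hF) (hsB _ hF) (hsb _ hF) (hs' _ hF) hF (gramT_nonneg _ _) (gramT_le _ _)
      (projSq_nonneg _ _) ((projSq_le (entryMat z.1) (entryMat z.2)).trans_eq
        (by rw [norm_sq_eq_trace])) (fun hy => highCut_of_two_le ((le_div_iff₀ hd).2 hy))
      (deriv_smoothTransition_nonneg (2 - ‖z.1‖ ^ 2 / a)) (hC _)
      (deriv_smoothTransition_nonneg (2 - ‖z.2‖ ^ 2 / d))
      (mul_deriv_lowCut_le hη.le ((gramDet_nonneg _).lt_of_ne' h) hC)
    refine le_trans (le_of_eq ?_) (this.trans (le_of_eq ?_))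
    · simp only [shrinkWeight]
      ring
    · simp only [shrinkGain, shrinkWeight]

end Divergence

/-! ### The integral inequality for the regularized estimators -/

theorem inv_kronecker_one_mulVec {m n : Type*} [Fintype m] [Fintype n] [DecidableEq m]
    [DecidableEq n] (C : Matrix m m ℝ) (x : EuclideanSpace ℝ (m × n)) (i : m) (j : n) :
    ((C ⊗ₖ (1 : Matrix n n ℝ))⁻¹ *ᵥ ⇑x) (i, j) = (C⁻¹ * entryMat x) i j := by
  rw [Matrix.inv_kronecker, inv_one]
  simp [Matrix.mulVec, dotProduct, Fintype.sum_prod_type, Matrix.mul_apply,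
    Matrix.one_apply]

theorem inv_one_kronecker_mulVec {m n : Type*} [Fintype m] [Fintype n] [DecidableEq m]
    [DecidableEq n] {C : Matrix n n ℝ} (hC : C.PosDef) {c : ℝ} (hc : 0 < c)
    (x : EuclideanSpace ℝ (m × n)) (i : m) (j : n) :
    (((1 : Matrix m m ℝ) ⊗ₖ (c⁻¹ • C))⁻¹ *ᵥ ⇑x) (i, j) = c * (entryMat x * C⁻¹) i j := by
  have hs : (C⁻¹)ᵀ = C⁻¹ := by
    rw [← Matrix.conjTranspose_eq_transpose_of_trivial]; exact hC.inv.isHermitian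
  have hinv : (c⁻¹ • C)⁻¹ = c • C⁻¹ := by
    refine Matrix.inv_eq_left_inv ?_
    rw [Matrix.smul_mul, Matrix.mul_smul, smul_smul, mul_inv_cancel₀ hc.ne', one_smul,
      Matrix.nonsing_inv_mul _ ((Matrix.isUnit_iff_isUnit_det _).1 hC.isUnit)]
  rw [Matrix.inv_kronecker, inv_one, hinv]
  simp only [Matrix.mulVec, dotProduct, Fintype.sum_prod_type, Matrix.mul_apply,
    Matrix.one_apply, Matrix.kroneckerMap_apply, Matrix.smul_apply, smul_eq_mul, entryMat_apply]
  rw [Finset.sum_eq_single i]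
  · simp only [if_true, one_mul, Finset.mul_sum]
    refine Finset.sum_congr rfl fun k _ => ?_
    rw [← congrFun (congrFun hs k) j, Matrix.transpose_apply]
    ring
  · intro b _ hb
    simp [hb.symm]
  · simp

section Risk

variable {p q N : ℕ} {Sig : Matrix (Fin p) (Fin p) ℝ}

/-- The law of the pair `(X, Y)`, as vectors of matrix entries. -/
noncomputable def pairLaw (N : ℕ) (Sig : Matrix (Fin p) (Fin p) ℝ) (θ : Matrix (Fin p) (Fin q) ℝ) :
    Measure (EuclideanSpace ℝ (Fin p × Fin q) × EuclideanSpace ℝ (Fin N × Fin p)) :=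
  (multivariateGaussian (entryVec θ) (Sig ⊗ₖ (1 : Matrix (Fin q) (Fin q) ℝ))).prod
    (multivariateGaussian (entryVec 0) ((1 : Matrix (Fin N) (Fin N) ℝ) ⊗ₖ ((q : ℝ)⁻¹ • Sig)))

instance (θ : Matrix (Fin p) (Fin q) ℝ) : IsProbabilityMeasure (pairLaw N Sig θ) := by
  unfold pairLaw; infer_instance

theorem posDef_smul_inv (hSig : Sig.PosDef) (hq : 0 < q) : ((q : ℝ)⁻¹ • Sig).PosDef :=
  hSig.smul (by positivity)

/-- Stein's identity for a matrix field in the variable `X`. -/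
theorem integral_stein_fst (hSig : Sig.PosDef) (θ : Matrix (Fin p) (Fin q) ℝ)
    {V : EuclideanSpace ℝ (Fin p × Fin q) × EuclideanSpace ℝ (Fin N × Fin p) →
      Matrix (Fin p) (Fin q) ℝ}
    (hV : ∀ i j, ContDiff ℝ 1 fun z => V z i j) (hc : ∀ i j, HasCompactSupport fun z => V z i j) :
    ∫ z, ∑ i, ∑ j, (Sig⁻¹ * (entryMat z.1 - θ)) i j * V z i j ∂(pairLaw N Sig θ)
      = ∫ z, ∑ i, ∑ j, fderiv ℝ (fun z => V z i j) z (EuclideanSpace.single (i, j) 1, 0)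
        ∂(pairLaw N Sig θ) := by
  have hi1 : ∀ i j, Integrable (fun z => (Sig⁻¹ * (entryMat z.1 - θ)) i j * V z i j)
      (pairLaw N Sig θ) := fun i j => by
    have : Continuous fun z : EuclideanSpace ℝ (Fin p × Fin q) × EuclideanSpace ℝ (Fin N × Fin p)
        => (Sig⁻¹ * (entryMat z.1 - θ)) i j := by
      simp only [Matrix.mul_apply, Matrix.sub_apply, entryMat_apply]
      fun_prop
    exact (this.mul (hV i j).continuous).integrable_of_hasCompactSupport (hc i j).mul_left
  have hi2 : ∀ i j, Integrable (fun z => fderiv ℝ (fun z => V z i j) z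
      (EuclideanSpace.single (i, j) 1, 0)) (pairLaw N Sig θ) := fun i j =>
    (((hV i j).continuous_fderiv one_ne_zero).clm_apply
      continuous_const).integrable_of_hasCompactSupport ((hc i j).fderiv_apply (𝕜 := ℝ) _)
  rw [integral_finsetSum _ fun i _ => integrable_finsetSum _ fun j _ => hi1 i j,
    integral_finsetSum _ fun i _ => integrable_finsetSum _ fun j _ => hi2 i j]
  refine Finset.sum_congr rfl fun i _ => ?_
  rw [integral_finsetSum _ fun j _ => hi1 i j, integral_finsetSum _ fun j _ => hi2 i j]
  refine Finset.sum_congr rfl fun j _ => ?_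
  rw [pairLaw, ← integral_inv_mulVec_mul_prod_left (hSig.kronecker Matrix.PosDef.one) _ _ (hV i j)
    (hc i j)]
  refine integral_congr_ae (.of_forall fun z => ?_)
  simp only
  rw [inv_kronecker_one_mulVec, entryMat_sub, entryMat_entryVec]

/-- Stein's identity for a matrix field in the variable `Y`. -/
theorem integral_stein_snd (hSig : Sig.PosDef) (hq : 0 < q) (θ : Matrix (Fin p) (Fin q) ℝ)
    {V : EuclideanSpace ℝ (Fin p × Fin q) × EuclideanSpace ℝ (Fin N × Fin p) →
      Matrix (Fin N) (Fin p) ℝ}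
    (hV : ∀ i j, ContDiff ℝ 1 fun z => V z i j) (hc : ∀ i j, HasCompactSupport fun z => V z i j) :
    ∫ z, ∑ i, ∑ j, (entryMat z.2 * Sig⁻¹) i j * V z i j ∂(pairLaw N Sig θ)
      = (q : ℝ)⁻¹ * ∫ z, ∑ i, ∑ j, fderiv ℝ (fun z => V z i j) z
        (0, EuclideanSpace.single (i, j) 1) ∂(pairLaw N Sig θ) := by
  have hi1 : ∀ i j, Integrable (fun z => (entryMat z.2 * Sig⁻¹) i j * V z i j)
      (pairLaw N Sig θ) := fun i j => by
    have : Continuous fun z : EuclideanSpace ℝ (Fin p × Fin q) × EuclideanSpace ℝ (Fin N × Fin p)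
        => (entryMat z.2 * Sig⁻¹) i j := by
      simp only [Matrix.mul_apply, entryMat_apply]
      fun_prop
    exact (this.mul (hV i j).continuous).integrable_of_hasCompactSupport (hc i j).mul_left
  have hi2 : ∀ i j, Integrable (fun z => fderiv ℝ (fun z => V z i j) z
      (0, EuclideanSpace.single (i, j) 1)) (pairLaw N Sig θ) := fun i j =>
    (((hV i j).continuous_fderiv one_ne_zero).clm_apply
      continuous_const).integrable_of_hasCompactSupport ((hc i j).fderiv_apply (𝕜 := ℝ) _)
  have hq' : (0 : ℝ) < q := by exact_mod_cast hq
  rw [integral_finsetSum _ fun i _ => integrable_finsetSum _ fun j _ => hi1 i j,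
    integral_finsetSum _ fun i _ => integrable_finsetSum _ fun j _ => hi2 i j, Finset.mul_sum]
  refine Finset.sum_congr rfl fun i _ => ?_
  rw [integral_finsetSum _ fun j _ => hi1 i j, integral_finsetSum _ fun j _ => hi2 i j,
    Finset.mul_sum]
  refine Finset.sum_congr rfl fun j _ => ?_
  rw [pairLaw, ← integral_inv_mulVec_mul_prod_right
    (Matrix.PosDef.one.kronecker (posDef_smul_inv hSig hq)) (entryVec 0) _ (hV i j) (hc i j),
    ← integral_const_mul]
  refine integral_congr_ae (.of_forall fun z => ?_)
  simp only
  rw [inv_one_kronecker_mulVec hSig hq', entryMat_sub, entryMat_entryVec, sub_zero]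
  field_simp

theorem quadLoss_eq_sum (θ δ : Matrix (Fin p) (Fin q) ℝ) (hs : (Sig⁻¹)ᵀ = Sig⁻¹) :
    quadLoss Sig θ δ = ∑ i, ∑ j, (Sig⁻¹ * (δ - θ)) i j * (δ - θ) i j := by
  rw [← trace_transpose_mul_eq_sum, Matrix.transpose_mul, hs, quadLoss]

theorem quadLoss_nonneg (hSig : Sig.PosDef) (θ δ : Matrix (Fin p) (Fin q) ℝ) :
    0 ≤ quadLoss Sig θ δ := by
  have := (hSig.inv.posSemidef.conjTranspose_mul_mul_same (δ - θ)).trace_nonneg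
  rwa [Matrix.conjTranspose_eq_transpose_of_trivial] at this

/-- The estimator `X` has finite risk. -/
theorem integrable_quadLoss (hSig : Sig.PosDef) (θ : Matrix (Fin p) (Fin q) ℝ) :
    Integrable (fun z => quadLoss Sig θ (entryMat z.1)) (pairLaw N Sig θ) := by
  have hs : (Sig⁻¹)ᵀ = Sig⁻¹ := by
    rw [← Matrix.conjTranspose_eq_transpose_of_trivial]; exact hSig.inv.isHermitian
  have hL : ∀ i j, MemLp (fun x : EuclideanSpace ℝ (Fin p × Fin q) => (entryMat x - θ) i j) 2
      (multivariateGaussian (entryVec θ) (Sig ⊗ₖ (1 : Matrix (Fin q) (Fin q) ℝ))) := by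
    intro i j
    have h := (EuclideanSpace.proj (𝕜 := ℝ) (i, j) :
      EuclideanSpace ℝ (Fin p × Fin q) →L[ℝ] ℝ).comp_memLp'
      (IsGaussian.memLp_two_id (μ := multivariateGaussian (entryVec θ)
        (Sig ⊗ₖ (1 : Matrix (Fin q) (Fin q) ℝ))))
    exact h.sub (memLp_const (θ i j))
  have : Integrable (fun x => quadLoss Sig θ (entryMat x))
      (multivariateGaussian (entryVec θ) (Sig ⊗ₖ (1 : Matrix (Fin q) (Fin q) ℝ))) := by
    simp only [quadLoss_eq_sum _ _ hs]
    refine integrable_finsetSum _ fun i _ => integrable_finsetSum _ fun j _ => ?_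
    refine MemLp.integrable_mul (p := 2) (q := 2) ?_ (hL i j)
    simp only [Matrix.mul_apply]
    exact memLp_finsetSum _ fun k _ => (hL k j).const_mul _
  exact this.comp_fst _

/-- The expansion of the loss of a shrinkage estimator. -/
theorem quadLoss_sub_smul_projField (hs : (Sig⁻¹)ᵀ = Sig⁻¹) (θ X : Matrix (Fin p) (Fin q) ℝ)
    (Y : Matrix (Fin N) (Fin p) ℝ) (w : ℝ) :
    quadLoss Sig θ (X - w • projField X Y) = quadLoss Sig θ X
      + (-2 * ∑ i, ∑ j, (Sig⁻¹ * (X - θ)) i j * (w * projField X Y i j)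
        + ∑ i, ∑ j, (Y * Sig⁻¹) i j * (w ^ 2 * dualField X Y i j)) := by
  have e1 : ∑ i, ∑ j, (Sig⁻¹ * (X - θ)) i j * (w * projField X Y i j)
      = w * ((X - θ)ᵀ * Sig⁻¹ * projField X Y).trace := by
    rw [← hs, ← Matrix.transpose_mul, trace_transpose_mul_eq_sum]
    simp only [Finset.mul_sum, hs]
    exact Finset.sum_congr rfl fun i _ => Finset.sum_congr rfl fun j _ => by ring
  have e2 : ∑ i, ∑ j, (Y * Sig⁻¹) i j * (w ^ 2 * dualField X Y i j)
      = w ^ 2 * ((projField X Y)ᵀ * Sig⁻¹ * projField X Y).trace := by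
    rw [Matrix.mul_assoc, Matrix.trace_mul_comm, Matrix.mul_assoc, ← transpose_mul_dualField,
      ← hs, ← Matrix.mul_assoc, ← Matrix.transpose_mul, trace_transpose_mul_eq_sum]
    simp only [Finset.mul_sum, hs]
    exact Finset.sum_congr rfl fun i _ => Finset.sum_congr rfl fun j _ => by ring
  have e3 : ((projField X Y)ᵀ * Sig⁻¹ * (X - θ)).trace
      = ((X - θ)ᵀ * Sig⁻¹ * projField X Y).trace := by
    rw [← Matrix.trace_transpose]
    simp only [Matrix.transpose_mul, Matrix.transpose_transpose, hs, Matrix.mul_assoc]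
  rw [e1, e2, quadLoss, quadLoss, show X - w • projField X Y - θ = (X - θ) - w • projField X Y by
    abel]
  generalize X - θ = D at e3 ⊢
  simp only [Matrix.transpose_sub, Matrix.transpose_smul, Matrix.sub_mul, Matrix.mul_sub,
    Matrix.smul_mul, Matrix.mul_smul, Matrix.trace_sub, Matrix.trace_smul, smul_eq_mul]
  rw [e3]
  ring

variable {s : ℝ → ℝ} {η a d : ℝ}

/-- The risk inequality for the regularized shrinkage estimators, up to an error caused by the
cutoffs. -/
theorem lintegral_quadLoss_shrinkWeight_le (hSig : Sig.PosDef) (hq : 0 < q)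
    (θ : Matrix (Fin p) (Fin q) ℝ) (hη : 0 < η) (ha : 0 < a) (hd : 0 < d) {b B C : ℝ}
    (hs : ContDiff ℝ 1 s) (hs0 : ∀ t, 0 ≤ t → 0 ≤ s t)
    (hsB : ∀ t, 0 ≤ t → s t ≤ B) (hsb : ∀ t, 0 ≤ t → t * s t ≤ b)
    (hs' : ∀ t, 0 ≤ t → 0 ≤ s t + t * deriv s t) (hC : ∀ x, deriv smoothTransition x ≤ C)
    (hgain : ∀ z : EuclideanSpace ℝ (Fin p × Fin q) × EuclideanSpace ℝ (Fin N × Fin p),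
      0 ≤ shrinkGain (entryMat z.1) (entryMat z.2) (shrinkWeight s η a d z)) :
    ∫⁻ z, (ENNReal.ofReal (quadLoss Sig θ (entryMat z.1
          - shrinkWeight s η a d z • projField (entryMat z.1) (entryMat z.2)))
        + ENNReal.ofReal (shrinkGain (entryMat z.1) (entryMat z.2) (shrinkWeight s η a d z)))
        ∂(pairLaw N Sig θ)
      ≤ ∫⁻ z, ENNReal.ofReal (quadLoss Sig θ (entryMat z.1)) ∂(pairLaw N Sig θ)
        + ENNReal.ofReal (8 * C * b * d / a + (q : ℝ)⁻¹ * (8 * C * η * b * B)) := by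
  have hss : (Sig⁻¹)ᵀ = Sig⁻¹ := by
    rw [← Matrix.conjTranspose_eq_transpose_of_trivial]; exact hSig.inv.isHermitian
  have hC0 : 0 ≤ C := (deriv_smoothTransition_nonneg 0).trans (hC 0)
  have hb0 : 0 ≤ b := by simpa using hsb 0 le_rfl
  have hB0 : 0 ≤ B := (hs0 0 le_rfl).trans (hsB 0 le_rfl)
  set e : ℝ := 8 * C * b * d / a + (q : ℝ)⁻¹ * (8 * C * η * b * B) with he
  have he0 : 0 ≤ e := by positivity
  set w := shrinkWeight (κ := Fin p) (l := Fin q) (ι := Fin N) s η a d with hw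
  set V₁ : EuclideanSpace ℝ (Fin p × Fin q) × EuclideanSpace ℝ (Fin N × Fin p) →
    Matrix (Fin p) (Fin q) ℝ :=
    fun z => Matrix.of fun i j => w z * projField (entryMat z.1) (entryMat z.2) i j with hV₁
  set V₂ : EuclideanSpace ℝ (Fin p × Fin q) × EuclideanSpace ℝ (Fin N × Fin p) →
    Matrix (Fin N) (Fin p) ℝ :=
    fun z => Matrix.of fun i j => w z ^ 2 * dualField (entryMat z.1) (entryMat z.2) i j with hV₂
  have z1 : ∀ i j z, w z = 0 → V₁ z i j = 0 := fun i j z h => by simp [hV₁, h]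
  have z2 : ∀ i j z, w z = 0 → V₂ z i j = 0 := fun i j z h => by simp [hV₂, h]
  have d1 : ∀ i j, ContDiff ℝ 1 fun z => V₁ z i j := fun i j =>
    contDiff_of_shrinkWeight hη (z1 i j) fun z h =>
      (contDiffAt_shrinkWeight hs h).mul (contDiffAt_projField h i j)
  have d2 : ∀ i j, ContDiff ℝ 1 fun z => V₂ z i j := fun i j =>
    contDiff_of_shrinkWeight hη (z2 i j) fun z h =>
      ((contDiffAt_shrinkWeight hs h).pow 2).mul (contDiffAt_dualField h i j)
  have c1 : ∀ i j, HasCompactSupport fun z => V₁ z i j := fun i j =>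
    hasCompactSupport_of_shrinkWeight ha hd (z1 i j)
  have c2 : ∀ i j, HasCompactSupport fun z => V₂ z i j := fun i j =>
    hasCompactSupport_of_shrinkWeight ha hd (z2 i j)
  have st1 := integral_stein_fst hSig θ d1 c1
  have st2 := integral_stein_snd hSig hq θ d2 c2
  set D₁ : EuclideanSpace ℝ (Fin p × Fin q) × EuclideanSpace ℝ (Fin N × Fin p) → ℝ := fun z =>
    ∑ i, ∑ j, fderiv ℝ (fun z => V₁ z i j) z (EuclideanSpace.single (i, j) 1, 0) with hD₁
  set D₂ : EuclideanSpace ℝ (Fin p × Fin q) × EuclideanSpace ℝ (Fin N × Fin p) → ℝ := fun z =>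
    ∑ i, ∑ j, fderiv ℝ (fun z => V₂ z i j) z (0, EuclideanSpace.single (i, j) 1) with hD₂
  set R₁ : EuclideanSpace ℝ (Fin p × Fin q) × EuclideanSpace ℝ (Fin N × Fin p) → ℝ := fun z =>
    ∑ i, ∑ j, (Sig⁻¹ * (entryMat z.1 - θ)) i j * V₁ z i j with hR₁
  set R₂ : EuclideanSpace ℝ (Fin p × Fin q) × EuclideanSpace ℝ (Fin N × Fin p) → ℝ := fun z =>
    ∑ i, ∑ j, (entryMat z.2 * Sig⁻¹) i j * V₂ z i j with hR₂
  have iD₁ : Integrable D₁ (pairLaw N Sig θ) :=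
    integrable_finsetSum _ fun i _ => integrable_finsetSum _ fun j _ =>
      (((d1 i j).continuous_fderiv one_ne_zero).clm_apply
        continuous_const).integrable_of_hasCompactSupport ((c1 i j).fderiv_apply (𝕜 := ℝ) _)
  have iD₂ : Integrable D₂ (pairLaw N Sig θ) :=
    integrable_finsetSum _ fun i _ => integrable_finsetSum _ fun j _ =>
      (((d2 i j).continuous_fderiv one_ne_zero).clm_apply
        continuous_const).integrable_of_hasCompactSupport ((c2 i j).fderiv_apply (𝕜 := ℝ) _)
  have iR₁ : Integrable R₁ (pairLaw N Sig θ) := by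
    refine integrable_finsetSum _ fun i _ => integrable_finsetSum _ fun j _ => ?_
    have : Continuous fun z : EuclideanSpace ℝ (Fin p × Fin q) × EuclideanSpace ℝ (Fin N × Fin p)
        => (Sig⁻¹ * (entryMat z.1 - θ)) i j := by
      simp only [Matrix.mul_apply, Matrix.sub_apply, entryMat_apply]
      fun_prop
    exact (this.mul (d1 i j).continuous).integrable_of_hasCompactSupport (c1 i j).mul_left
  have iR₂ : Integrable R₂ (pairLaw N Sig θ) := by
    refine integrable_finsetSum _ fun i _ => integrable_finsetSum _ fun j _ => ?_
    have : Continuous fun z : EuclideanSpace ℝ (Fin p × Fin q) × EuclideanSpace ℝ (Fin N × Fin p)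
        => (entryMat z.2 * Sig⁻¹) i j := by
      simp only [Matrix.mul_apply, entryMat_apply]
      fun_prop
    exact (this.mul (d2 i j).continuous).integrable_of_hasCompactSupport (c2 i j).mul_left
  have iL := integrable_quadLoss (N := N) hSig θ
  have hloss : ∀ z, quadLoss Sig θ (entryMat z.1 - w z • projField (entryMat z.1) (entryMat z.2))
      = quadLoss Sig θ (entryMat z.1) + (-2 * R₁ z + R₂ z) := fun z =>
    quadLoss_sub_smul_projField hss θ _ _ _
  have hdiv : ∀ z, shrinkGain (entryMat z.1) (entryMat z.2) (w z)
      ≤ e - (-2 * D₁ z + (q : ℝ)⁻¹ * D₂ z) := by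
    intro z
    have := divergence_le (κ := Fin p) (l := Fin q) (ι := Fin N) (z := z) hη ha hd
      (by simpa using hq) hs hs0 hsB hsb hs' hC
    simp only [Fintype.card_fin] at this
    have h' : -2 * D₁ z + (q : ℝ)⁻¹ * D₂ z
      ≤ -shrinkGain (entryMat z.1) (entryMat z.2) (w z) + e := this
    linarith
  have iR : Integrable (fun z => -2 * R₁ z + R₂ z) (pairLaw N Sig θ) := (iR₁.const_mul _).add iR₂
  have iD' : Integrable (fun z => -2 * D₁ z + (q : ℝ)⁻¹ * D₂ z) (pairLaw N Sig θ) :=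
    (iD₁.const_mul _).add (iD₂.const_mul _)
  have iL' : Integrable (fun z => quadLoss Sig θ (entryMat z.1) + (-2 * R₁ z + R₂ z))
      (pairLaw N Sig θ) := iL.add iR
  have iD : Integrable (fun z => e - (-2 * D₁ z + (q : ℝ)⁻¹ * D₂ z)) (pairLaw N Sig θ) :=
    (integrable_const e).sub iD'
  calc _ ≤ ∫⁻ z, (ENNReal.ofReal (quadLoss Sig θ (entryMat z.1) + (-2 * R₁ z + R₂ z))
        + ENNReal.ofReal (e - (-2 * D₁ z + (q : ℝ)⁻¹ * D₂ z))) ∂(pairLaw N Sig θ) := by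
        refine lintegral_mono fun z => ?_
        rw [← hloss]
        exact add_le_add le_rfl (ENNReal.ofReal_le_ofReal (hdiv z))
    _ = ENNReal.ofReal (∫ z, (quadLoss Sig θ (entryMat z.1) + (-2 * R₁ z + R₂ z))
          ∂(pairLaw N Sig θ))
        + ENNReal.ofReal (∫ z, (e - (-2 * D₁ z + (q : ℝ)⁻¹ * D₂ z)) ∂(pairLaw N Sig θ)) := by
        rw [lintegral_add_left' iL'.aestronglyMeasurable.aemeasurable.ennreal_ofReal,
          ofReal_integral_eq_lintegral_ofReal iL', ofReal_integral_eq_lintegral_ofReal iD]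
        · exact .of_forall fun z => (hgain z).trans (hdiv z)
        · exact .of_forall fun z => by
            simp only [Pi.zero_apply, ← hloss]; exact quadLoss_nonneg hSig _ _
    _ = ENNReal.ofReal (∫ z, quadLoss Sig θ (entryMat z.1) ∂(pairLaw N Sig θ) + e) := by
        rw [← ENNReal.ofReal_add]
        · congr 1
          rw [integral_add iL iR,
            integral_add (iR₁.const_mul _) iR₂, integral_const_mul,
            integral_sub (integrable_const e) iD',
            integral_add (iD₁.const_mul _) (iD₂.const_mul _), integral_const_mul,
            integral_const_mul, st1, st2]
          simp
        · exact integral_nonneg fun z => by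
            simp only [Pi.zero_apply, ← hloss]; exact quadLoss_nonneg hSig _ _
        · exact integral_nonneg fun z => (hgain z).trans (hdiv z)
    _ = _ := by
        rw [ENNReal.ofReal_add (integral_nonneg fun z => quadLoss_nonneg hSig _ _) he0,
          ofReal_integral_eq_lintegral_ofReal iL (.of_forall fun z => quadLoss_nonneg hSig _ _)]

end Risk

/-! ### Measurability of the Moore–Penrose inverse -/

section Measurability

variable {Ω l m n : Type*} [MeasurableSpace Ω] [Fintype m]

theorem measurable_matrix_mul {M : Ω → Matrix l m ℝ} {L : Ω → Matrix m n ℝ}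
    (hM : ∀ i j, Measurable fun ω => M ω i j) (hL : ∀ i j, Measurable fun ω => L ω i j)
    (i : l) (j : n) : Measurable fun ω => (M ω * L ω) i j := by
  simp only [Matrix.mul_apply]
  exact Finset.measurable_sum _ fun k _ => (hM i k).mul (hL k j)

theorem measurable_matrix_trace {M : Ω → Matrix m m ℝ}
    (hM : ∀ i j, Measurable fun ω => M ω i j) : Measurable fun ω => (M ω).trace := by
  simp only [Matrix.trace, Matrix.diag_apply]
  exact Finset.measurable_sum _ fun k _ => hM k k

variable [Fintype n]

theorem isClosed_setOf_isMoorePenrose :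
    IsClosed {z : EuclideanSpace ℝ (m × n) × EuclideanSpace ℝ (n × m) |
      IsMoorePenrose (entryMat z.1) (entryMat z.2)} := by
  have h1 : Continuous fun z : EuclideanSpace ℝ (m × n) × EuclideanSpace ℝ (n × m) =>
      entryMat z.1 := continuous_matrix fun i j => by simp only [entryMat_apply]; fun_prop
  have h2 : Continuous fun z : EuclideanSpace ℝ (m × n) × EuclideanSpace ℝ (n × m) =>
      entryMat z.2 := continuous_matrix fun i j => by simp only [entryMat_apply]; fun_prop
  have e : {z : EuclideanSpace ℝ (m × n) × EuclideanSpace ℝ (n × m) |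
      IsMoorePenrose (entryMat z.1) (entryMat z.2)}
      = {z | entryMat z.1 * entryMat z.2 * entryMat z.1 = entryMat z.1} ∩
        {z | entryMat z.2 * entryMat z.1 * entryMat z.2 = entryMat z.2} ∩
        {z | (entryMat z.1 * entryMat z.2)ᵀ = entryMat z.1 * entryMat z.2} ∩
        {z | (entryMat z.2 * entryMat z.1)ᵀ = entryMat z.2 * entryMat z.1} := by
    ext z
    exact ⟨fun h => ⟨⟨⟨h.1, h.2⟩, h.3⟩, h.4⟩, fun h => ⟨h.1.1.1, h.1.1.2, h.1.2, h.2⟩⟩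
  rw [e]
  exact (((isClosed_eq ((h1.matrix_mul h2).matrix_mul h1) h1).inter
    (isClosed_eq ((h2.matrix_mul h1).matrix_mul h2) h2)).inter
    (isClosed_eq (h1.matrix_mul h2).matrix_transpose (h1.matrix_mul h2))).inter
    (isClosed_eq (h2.matrix_mul h1).matrix_transpose (h2.matrix_mul h1))

/-- The Moore–Penrose inverse is not continuous, but its graph is closed, so it is measurable by
the Lusin–Souslin theorem. -/
theorem measurable_entryVec_moorePenrose :
    Measurable fun x : EuclideanSpace ℝ (m × n) => entryVec (moorePenrose (entryMat x)) := by
  set K := {z : EuclideanSpace ℝ (m × n) × EuclideanSpace ℝ (n × m) |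
      IsMoorePenrose (entryMat z.1) (entryMat z.2)} with hK
  have hKp : PolishSpace K := isClosed_setOf_isMoorePenrose.polishSpace
  have hf : MeasurableEmbedding fun z : K => z.1.1 := by
    refine Measurable.measurableEmbedding (by fun_prop) ?_
    rintro ⟨⟨x, y⟩, h⟩ ⟨⟨x', y'⟩, h'⟩ hxx
    simp only at hxx
    subst hxx
    have : entryMat y = entryMat y' := IsMoorePenrose.unique h h'
    have : y = y' := by rw [← entryVec_entryMat y, this, entryVec_entryMat]
    subst this
    rfl
  intro B hB
  have e : (fun x : EuclideanSpace ℝ (m × n) => entryVec (moorePenrose (entryMat x))) ⁻¹' B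
      = (fun z : K => z.1.1) '' {z : K | z.1.2 ∈ B} := by
    ext x
    constructor
    · intro hx
      exact ⟨⟨(x, entryVec (moorePenrose (entryMat x))), moorePenrose_spec _⟩, hx, rfl⟩
    · rintro ⟨⟨⟨x', y⟩, h⟩, hy, rfl⟩
      have : moorePenrose (entryMat x') = entryMat y := IsMoorePenrose.moorePenrose_eq h
      simp only [Set.mem_preimage, this, entryVec_entryMat]
      exact hy
  rw [e, hf.measurableSet_image]
  have : Measurable fun z : K => z.1.2 := by fun_prop
  exact this hB

theorem measurable_moorePenrose_apply {Y : Ω → Matrix m n ℝ}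
    (hY : ∀ i j, Measurable fun ω => Y ω i j) (i : n) (j : m) :
    Measurable fun ω => moorePenrose (Y ω) i j := by
  have h1 : Measurable fun ω => entryVec (Y ω) :=
    (WithLp.measurable_toLp 2 _).comp (measurable_pi_lambda _ fun ij => hY ij.1 ij.2)
  have h2 := measurable_entryVec_moorePenrose.comp h1
  have h3 : Measurable fun x : EuclideanSpace ℝ (n × m) => x (i, j) := by fun_prop
  exact h3.comp h2

end Measurability

/-! ### Regularization of the shrinkage function -/

/-- A continuous monotone bounded `r` on `(0, ∞)` is approximated by functions `t * s k t`, where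
the `s k` are continuously differentiable and vanish near `0`. They arise by averaging `r` over
short intervals and multiplying by a monotone cutoff near `0`, which preserves monotonicity and
the bounds. -/
theorem exists_regularization {r : ℝ → ℝ} {b : ℝ}
    (hr_bound : ∀ t, 0 < t → 0 ≤ r t ∧ r t ≤ b) (hr_mono : MonotoneOn r (Set.Ioi 0))
    (hr_cont : ∀ t, 0 < t → ContinuousAt r t) :
    ∃ s : ℕ → ℝ → ℝ, (∀ k, ContDiff ℝ 1 (s k)) ∧ (∀ k t, 0 ≤ t → 0 ≤ s k t) ∧
      (∀ k t, 0 ≤ t → s k t ≤ b * (k + 1)) ∧ (∀ k t, 0 ≤ t → t * s k t ≤ b) ∧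
      (∀ k t, 0 ≤ t → 0 ≤ s k t + t * deriv (s k) t) ∧ (∀ k, s k 0 = 0) ∧
      ∀ t, 0 < t → Filter.Tendsto (fun k => s k t) Filter.atTop (nhds (r t / t)) := by
  have hb0 : 0 ≤ b := (hr_bound 1 one_pos).1.trans (hr_bound 1 one_pos).2
  have hrc : ContinuousOn r (Set.Ioi 0) := fun t ht => (hr_cont t ht).continuousWithinAt
  obtain ⟨R, hR⟩ : ∃ R : ℝ → ℝ, ∀ t, 0 < t → HasDerivAt R (r t) t := by
    refine ⟨fun t => ∫ x in (1 : ℝ)..t, r x, fun t ht => ?_⟩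
    refine intervalIntegral.integral_hasDerivAt_right ?_ ?_ (hr_cont t ht)
    · refine (hrc.mono fun x hx => ?_).intervalIntegrable
      exact lt_of_lt_of_le (lt_min one_pos ht) hx.1
    · exact hrc.stronglyMeasurableAtFilter isOpen_Ioi t ht
  have hR1 : ∀ t, 0 < t → ContDiffAt ℝ 1 R t := by
    intro t ht
    rw [contDiffAt_one_iff]
    refine ⟨fun x => ContinuousLinearMap.toSpanSingleton ℝ (r x), Set.Ioi 0, Ioi_mem_nhds ht, ?_,
      fun x hx => (hR x hx).hasFDerivAt⟩
    exact (ContinuousLinearMap.toSpanSingletonCLE (𝕜 := ℝ) (E := ℝ)).continuous.comp_continuousOn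
      hrc
  -- the average of `r` over `[t, t + 1 / (k + 1)]`
  set m : ℕ → ℝ → ℝ := fun k t => (k + 1) * (R (t + 1 / (k + 1)) - R t) with hm
  have hk : ∀ k : ℕ, (0 : ℝ) < k + 1 := fun k => by positivity
  have hslope : ∀ (k : ℕ) (t : ℝ), 0 < t →
      ∃ c ∈ Set.Ioo t (t + 1 / ((k : ℝ) + 1)), m k t = r c := by
    intro k t ht
    have hlt : t < t + 1 / ((k : ℝ) + 1) := by have := hk k; simp; positivity
    obtain ⟨c, hc, hce⟩ := exists_hasDerivAt_eq_slope R r hlt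
      (fun x hx => (hR x (ht.trans_le hx.1)).continuousAt.continuousWithinAt)
      (fun x hx => hR x (ht.trans hx.1))
    refine ⟨c, hc, ?_⟩
    rw [hce, hm]
    have := (hk k).ne'
    field_simp
    ring
  have hm0 : ∀ k t, 0 < t → 0 ≤ m k t ∧ m k t ≤ b := by
    intro k t ht
    obtain ⟨c, hc, e⟩ := hslope k t ht
    rw [e]
    exact hr_bound c (ht.trans hc.1)
  have hmd : ∀ (k : ℕ) (t : ℝ), 0 < t →
      HasDerivAt (m k) ((k + 1) * (r (t + 1 / (k + 1)) - r t)) t := by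
    intro k t ht
    have h1 : HasDerivAt (fun t => R (t + 1 / ((k : ℝ) + 1))) (r (t + 1 / (k + 1))) t := by
      have := hk k
      exact (hR (t + 1 / (k + 1)) (by positivity)).comp_add_const t _
    exact (h1.sub (hR t ht)).const_mul _
  have hmc : ∀ k t, 0 < t → ContDiffAt ℝ 1 (m k) t := by
    intro k t ht
    have h1 : ContDiffAt ℝ 1 (fun t => R (t + 1 / ((k : ℝ) + 1))) t := by
      have := hk k
      exact (hR1 (t + 1 / (k + 1)) (by positivity)).comp t (contDiffAt_id.add contDiffAt_const)
    exact contDiffAt_const.mul (h1.sub (hR1 t ht))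
  set s : ℕ → ℝ → ℝ := fun k t => smoothTransition ((k + 1) * t - 1) * (m k t / t) with hs
  have hs_zero : ∀ (k : ℕ) (t : ℝ), ((k : ℝ) + 1) * t ≤ 1 → s k t = 0 := fun k t h => by
    simp only [hs]
    rw [Real.smoothTransition.zero_of_nonpos (by linarith), zero_mul]
  have hts : ∀ (k : ℕ) (t : ℝ), 0 < t →
      t * s k t = smoothTransition (((k : ℝ) + 1) * t - 1) * m k t := by
    intro k t ht
    simp only [hs]
    field_simp
  have hs_contDiff : ∀ k, ContDiff ℝ 1 (s k) := by
    intro k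
    rw [contDiff_iff_contDiffAt]
    intro t
    rcases lt_or_ge 0 t with ht | ht
    · refine ContDiffAt.mul ?_ ((hmc k t ht).div contDiffAt_id ht.ne')
      exact Real.smoothTransition.contDiffAt.comp t
        ((contDiffAt_const.mul contDiffAt_id).sub contDiffAt_const)
    · refine (contDiffAt_const (c := (0 : ℝ))).congr_of_eventuallyEq ?_
      have hc : ContinuousAt (fun u : ℝ => ((k : ℝ) + 1) * u) t := by fun_prop
      have hlt : ((k : ℝ) + 1) * t < 1 := by nlinarith [hk k]
      exact (hc.eventually_lt continuousAt_const hlt).mono fun u hu => hs_zero k u hu.le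
  have hs_nonneg : ∀ k t, 0 ≤ t → 0 ≤ s k t := by
    intro k t ht
    rcases ht.eq_or_lt with rfl | ht
    · rw [hs_zero k 0 (by simp)]
    · exact mul_nonneg (Real.smoothTransition.nonneg _) (div_nonneg (hm0 k t ht).1 ht.le)
  have hts_le : ∀ k t, 0 ≤ t → t * s k t ≤ b := by
    intro k t ht
    rcases ht.eq_or_lt with rfl | ht
    · simpa using hb0
    · rw [hts k t ht]
      calc _ ≤ 1 * m k t :=
            mul_le_mul_of_nonneg_right (Real.smoothTransition.le_one _) (hm0 k t ht).1
        _ ≤ b := by rw [one_mul]; exact (hm0 k t ht).2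
  refine ⟨s, hs_contDiff, hs_nonneg, ?_, hts_le, ?_, fun k => hs_zero k 0 (by simp), ?_⟩
  · intro k t ht
    rcases le_or_gt (((k : ℝ) + 1) * t) 1 with h | h
    · rw [hs_zero k t h]; have := hk k; positivity
    · calc s k t ≤ s k t * ((k + 1) * t) := le_mul_of_one_le_right (hs_nonneg k t ht) h.le
        _ = (t * s k t) * (k + 1) := by ring
        _ ≤ b * (k + 1) := mul_le_mul_of_nonneg_right (hts_le k t ht) (hk k).le
  · intro k t ht
    rcases ht.eq_or_lt with rfl | ht
    · rw [hs_zero k 0 (by simp)]; simp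
    have h1 : HasDerivAt (fun t => t * s k t) (1 * s k t + t * deriv (s k) t) t :=
      (hasDerivAt_id t).mul ((hs_contDiff k).differentiable one_ne_zero t).hasDerivAt
    have h0 : HasDerivAt (fun t : ℝ => ((k : ℝ) + 1) * t - 1) (k + 1) t := by
      simpa using ((hasDerivAt_id t).const_mul ((k : ℝ) + 1)).sub_const 1
    have h2 := ((hasDerivAt_smoothTransition (((k : ℝ) + 1) * t - 1)).comp t h0).mul (hmd k t ht)
    have h3 := h1.unique (h2.congr_of_eventuallyEq ((eventually_gt_nhds ht).mono
      fun u hu => hts k u hu))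
    rw [one_mul] at h3
    rw [h3]
    have h4 : r t ≤ r (t + 1 / (k + 1)) := by
      have := hk k
      have h5 : (0 : ℝ) < 1 / (k + 1) := by positivity
      exact hr_mono ht (by simp only [Set.mem_Ioi]; linarith) (by linarith)
    have h5 := deriv_smoothTransition_nonneg (((k : ℝ) + 1) * t - 1)
    have h6 := Real.smoothTransition.nonneg (((k : ℝ) + 1) * t - 1)
    have h7 := (hm0 k t ht).1
    exact add_nonneg (mul_nonneg (mul_nonneg h5 (hk k).le) h7)
      (mul_nonneg h6 (mul_nonneg (hk k).le (sub_nonneg.2 h4)))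
  · intro t ht
    have hev : ∀ᶠ k : ℕ in Filter.atTop, smoothTransition (((k : ℝ) + 1) * t - 1) = 1 := by
      obtain ⟨K, hK⟩ := exists_nat_ge (2 / t)
      filter_upwards [Filter.eventually_ge_atTop K] with k hkK
      refine Real.smoothTransition.one_of_one_le ?_
      have : 2 / t ≤ k := hK.trans (by exact_mod_cast hkK)
      rw [div_le_iff₀ ht] at this
      nlinarith
    have hlim : Filter.Tendsto (fun k => m k t) Filter.atTop (nhds (r t)) := by
      choose c hc hce using fun k => hslope k t ht
      simp only [hce]
      refine (hr_cont t ht).tendsto.comp ?_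
      refine tendsto_of_tendsto_of_tendsto_of_le_of_le tendsto_const_nhds ?_
        (fun k => (hc k).1.le) (fun k => (hc k).2.le)
      simpa using (tendsto_const_nhds (x := t)).add
        (tendsto_one_div_add_atTop_nhds_zero_nat (𝕜 := ℝ))
    refine (hlim.div_const t).congr' ?_
    filter_upwards [hev] with k hk
    simp only [hs, hk, one_mul]

/-! ### The risk inequality -/

section Limit

variable {p q N : ℕ} {Sig : Matrix (Fin p) (Fin p) ℝ}

theorem measurable_gramF : Measurable
    fun z : EuclideanSpace ℝ (Fin p × Fin q) × EuclideanSpace ℝ (Fin N × Fin p) =>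
      gramF (entryMat z.1) (entryMat z.2) := by
  have h1 : ∀ i j, Measurable
      fun z : EuclideanSpace ℝ (Fin p × Fin q) × EuclideanSpace ℝ (Fin N × Fin p) =>
        entryMat z.1 i j := fun i j => by simp only [entryMat_apply]; fun_prop
  have h2 : ∀ i j, Measurable
      fun z : EuclideanSpace ℝ (Fin p × Fin q) × EuclideanSpace ℝ (Fin N × Fin p) =>
        entryMat z.2 i j := fun i j => by simp only [entryMat_apply]; fun_prop
  have h3 := measurable_moorePenrose_apply h2
  exact measurable_matrix_trace (measurable_matrix_mul (measurable_matrix_mul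
    (fun i j => h1 j i) (measurable_matrix_mul h3 fun i j => h3 j i)) h1)

theorem measurable_projField (i : Fin p) (j : Fin q) : Measurable
    fun z : EuclideanSpace ℝ (Fin p × Fin q) × EuclideanSpace ℝ (Fin N × Fin p) =>
      projField (entryMat z.1) (entryMat z.2) i j := by
  have h1 : ∀ i j, Measurable
      fun z : EuclideanSpace ℝ (Fin p × Fin q) × EuclideanSpace ℝ (Fin N × Fin p) =>
        entryMat z.1 i j := fun i j => by simp only [entryMat_apply]; fun_prop
  have h2 : ∀ i j, Measurable
      fun z : EuclideanSpace ℝ (Fin p × Fin q) × EuclideanSpace ℝ (Fin N × Fin p) =>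
        entryMat z.2 i j := fun i j => by simp only [entryMat_apply]; fun_prop
  exact measurable_matrix_mul (measurable_matrix_mul (measurable_moorePenrose_apply h2) h2) h1 i j

theorem measurable_quadLoss {Ω : Type*} [MeasurableSpace Ω] (θ : Matrix (Fin p) (Fin q) ℝ)
    {δ : Ω → Matrix (Fin p) (Fin q) ℝ} (hδ : ∀ i j, Measurable fun ω => δ ω i j) :
    Measurable fun ω => quadLoss Sig θ (δ ω) := by
  have h : ∀ i j, Measurable fun ω => (δ ω - θ) i j := fun i j => (hδ i j).sub_const _
  exact measurable_matrix_trace (measurable_matrix_mul (measurable_matrix_mul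
    (fun i j => h j i) fun i j => measurable_const) h)

theorem continuous_quadLoss (θ : Matrix (Fin p) (Fin q) ℝ) :
    Continuous fun δ : Matrix (Fin p) (Fin q) ℝ => quadLoss Sig θ δ := by
  unfold quadLoss
  fun_prop

theorem ae_pairLaw_gramDet_ne_zero (hSig : Sig.PosDef) (hq : 0 < q)
    (θ : Matrix (Fin p) (Fin q) ℝ) :
    ∀ᵐ z ∂(pairLaw N Sig θ), gramDet (entryMat z.2) ≠ 0 :=
  Measure.quasiMeasurePreserving_snd.ae
    ((multivariateGaussian_absolutelyContinuous
      (Matrix.PosDef.one.kronecker (posDef_smul_inv hSig hq)) _).ae_le ae_gramDet_ne_zero)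

theorem shrinkGain_nonneg {X : Matrix (Fin p) (Fin q) ℝ} {Y : Matrix (Fin N) (Fin p) ℝ} {b w : ℝ}
    (hc : (0 : ℝ) ≤ (N : ℝ) + p - 2 * (min N p : ℕ) + 3)
    (hb : ((N : ℝ) + p - 2 * (min N p : ℕ) + 3) / q * b ≤ 2 * (q * (min N p : ℕ) - 2))
    (hw : 0 ≤ w) (hwb : gramF X Y * w ≤ b) : 0 ≤ shrinkGain X Y w := by
  simp only [shrinkGain, Fintype.card_fin]
  refine mul_nonneg hw (sub_nonneg.2 (le_trans ?_ hb))
  exact mul_le_mul_of_nonneg_left (by rwa [mul_comm]) (by positivity)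

/-- The risk inequality, with the gain as an explicit term: the regularized inequality survives
the passage to the limit by Fatou's lemma. -/
theorem lintegral_quadLoss_add_shrinkGain_le (hSig : Sig.PosDef) (hq : 0 < q)
    (θ : Matrix (Fin p) (Fin q) ℝ) {r : ℝ → ℝ} {b : ℝ}
    (hr_bound : ∀ t, 0 < t → 0 ≤ r t ∧ r t ≤ b) (hr_mono : MonotoneOn r (Set.Ioi 0))
    (hr_cont : ∀ t, 0 < t → ContinuousAt r t)
    (hc : (0 : ℝ) ≤ (N : ℝ) + p - 2 * (min N p : ℕ) + 3)
    (hb : ((N : ℝ) + p - 2 * (min N p : ℕ) + 3) / q * b ≤ 2 * (q * (min N p : ℕ) - 2)) :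
    ∫⁻ z, (ENNReal.ofReal (quadLoss Sig θ (entryMat z.1
          - (r (gramF (entryMat z.1) (entryMat z.2)) / gramF (entryMat z.1) (entryMat z.2)) •
            projField (entryMat z.1) (entryMat z.2)))
        + ENNReal.ofReal (shrinkGain (entryMat z.1) (entryMat z.2)
          (r (gramF (entryMat z.1) (entryMat z.2)) / gramF (entryMat z.1) (entryMat z.2))))
        ∂(pairLaw N Sig θ)
      ≤ ∫⁻ z, ENNReal.ofReal (quadLoss Sig θ (entryMat z.1)) ∂(pairLaw N Sig θ) := by
  obtain ⟨s, hs, hs0, hsB, hsb, hs', hsz, hlim⟩ := exists_regularization hr_bound hr_mono hr_cont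
  obtain ⟨C, -, hC⟩ := exists_deriv_smoothTransition_le
  -- the rates are chosen so that `d / a → 0` and `η * (k + 1) → 0`
  set η : ℕ → ℝ := fun k => 1 / ((k : ℝ) + 1) ^ 2 with hη
  set a : ℕ → ℝ := fun k => ((k : ℝ) + 1) ^ 4 with ha
  set d : ℕ → ℝ := fun k => ((k : ℝ) + 1) ^ 2 with hd
  have hk : ∀ k : ℕ, (0 : ℝ) < k + 1 := fun k => by positivity
  have hη0 : ∀ k, 0 < η k := fun k => by have := hk k; positivity
  have ha0 : ∀ k, 0 < a k := fun k => by have := hk k; positivity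
  have hd0 : ∀ k, 0 < d k := fun k => by have := hk k; positivity
  have hinv : Filter.Tendsto (fun k : ℕ => 1 / ((k : ℝ) + 1)) Filter.atTop (nhds 0) :=
    tendsto_one_div_add_atTop_nhds_zero_nat
  have hηlim : Filter.Tendsto η Filter.atTop (nhds 0) := by
    have := hinv.pow 2
    simpa [hη] using this
  set w : ℕ → EuclideanSpace ℝ (Fin p × Fin q) × EuclideanSpace ℝ (Fin N × Fin p) → ℝ :=
    fun k => shrinkWeight (s k) (η k) (a k) (d k) with hw
  have hw0 : ∀ k z, 0 ≤ w k z := fun k z => shrinkWeight_nonneg (hs0 k)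
  have hwb : ∀ k z, gramF (entryMat z.1) (entryMat z.2) * w k z ≤ b := by
    intro k z
    refine le_trans (mul_le_mul_of_nonneg_left ?_ (gramF_nonneg _ _)) (hsb k _ (gramF_nonneg _ _))
    refine mul_le_of_le_one_left (hs0 k _ (gramF_nonneg _ _)) ?_
    exact mul_le_one₀ (mul_le_one₀ (highCut_le_one _) (highCut_nonneg _) (highCut_le_one _))
      (lowCut_nonneg _ _) (lowCut_le_one _ _)
  have hgain : ∀ k z, 0 ≤ shrinkGain (entryMat z.1) (entryMat z.2) (w k z) := fun k z =>
    shrinkGain_nonneg hc hb (hw0 k z) (hwb k z)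
  have hwm : ∀ k, Measurable (w k) := fun k =>
    (contDiff_of_shrinkWeight (hη0 k) (fun z h => h)
      fun z h => contDiffAt_shrinkWeight (hs k) h).continuous.measurable
  set f : ℕ → EuclideanSpace ℝ (Fin p × Fin q) × EuclideanSpace ℝ (Fin N × Fin p) → ℝ≥0∞ :=
    fun k z => ENNReal.ofReal (quadLoss Sig θ (entryMat z.1
        - w k z • projField (entryMat z.1) (entryMat z.2)))
      + ENNReal.ofReal (shrinkGain (entryMat z.1) (entryMat z.2) (w k z)) with hf
  have hfm : ∀ k, Measurable (f k) := by
    intro k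
    refine (measurable_quadLoss θ fun i j => ?_).ennreal_ofReal.add ?_
    · refine Measurable.sub ?_ ((hwm k).mul (measurable_projField i j))
      simp only [entryMat_apply]; fun_prop
    · refine Measurable.ennreal_ofReal ?_
      unfold shrinkGain
      exact (hwm k).mul (measurable_const.sub
        (measurable_const.mul ((hwm k).mul measurable_gramF)))
  have hle : ∀ k, ∫⁻ z, f k z ∂(pairLaw N Sig θ)
      ≤ ∫⁻ z, ENNReal.ofReal (quadLoss Sig θ (entryMat z.1)) ∂(pairLaw N Sig θ)
        + ENNReal.ofReal (8 * C * b * (1 / ((k : ℝ) + 1)) ^ 2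
          + (q : ℝ)⁻¹ * (8 * C * b ^ 2) * (1 / ((k : ℝ) + 1))) := by
    intro k
    have h := lintegral_quadLoss_shrinkWeight_le hSig hq θ (hη0 k) (ha0 k) (hd0 k) (hs k) (hs0 k)
      (hsB k) (hsb k) (hs' k) hC (hgain k)
    have e : 8 * C * b * d k / a k + (q : ℝ)⁻¹ * (8 * C * η k * b * (b * (k + 1)))
        = 8 * C * b * (1 / ((k : ℝ) + 1)) ^ 2
          + (q : ℝ)⁻¹ * (8 * C * b ^ 2) * (1 / ((k : ℝ) + 1)) := by
      have := (hk k).ne'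
      simp only [hη, ha, hd]
      field_simp
    rwa [e] at h
  have herr : Filter.Tendsto (fun k : ℕ =>
      ∫⁻ z, ENNReal.ofReal (quadLoss Sig θ (entryMat z.1)) ∂(pairLaw N Sig θ)
        + ENNReal.ofReal (8 * C * b * (1 / ((k : ℝ) + 1)) ^ 2
          + (q : ℝ)⁻¹ * (8 * C * b ^ 2) * (1 / ((k : ℝ) + 1)))) Filter.atTop
      (nhds (∫⁻ z, ENNReal.ofReal (quadLoss Sig θ (entryMat z.1)) ∂(pairLaw N Sig θ))) := by
    have h1 : Filter.Tendsto (fun k : ℕ => 8 * C * b * (1 / ((k : ℝ) + 1)) ^ 2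
          + (q : ℝ)⁻¹ * (8 * C * b ^ 2) * (1 / ((k : ℝ) + 1))) Filter.atTop (nhds 0) := by
      simpa using ((hinv.pow 2).const_mul (8 * C * b)).add
        (hinv.const_mul ((q : ℝ)⁻¹ * (8 * C * b ^ 2)))
    simpa using tendsto_const_nhds.add (ENNReal.tendsto_ofReal h1)
  have hwlim : ∀ z, gramDet (entryMat z.2) ≠ 0 → Filter.Tendsto (fun k => w k z) Filter.atTop
      (nhds (r (gramF (entryMat z.1) (entryMat z.2)) / gramF (entryMat z.1) (entryMat z.2))) := by
    intro z hz
    rcases (gramF_nonneg (entryMat z.1) (entryMat z.2)).eq_or_lt with h0 | h0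
    · simp only [hw, shrinkWeight, ← h0, hsz, mul_zero, div_zero]
      exact tendsto_const_nhds
    · have hcut : ∀ c : ℝ, ∀ e : ℕ, 1 ≤ e →
          ∀ᶠ k : ℕ in Filter.atTop, highCut (c / ((k : ℝ) + 1) ^ e) = 1 := by
        intro c e he
        obtain ⟨K, hK⟩ := exists_nat_ge c
        filter_upwards [Filter.eventually_ge_atTop K] with k hkK
        refine highCut_of_le_one ?_
        rw [div_le_one (by have := hk k; positivity)]
        have h1 : (K : ℝ) ≤ k := by exact_mod_cast hkK
        have h2 : (1 : ℝ) ≤ k + 1 := by simp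
        exact (hK.trans (h1.trans (by linarith))).trans (le_self_pow₀ h2 (by omega))
      have h1 := ((tendsto_lowCut ((gramDet_nonneg _).lt_of_ne' hz) hηlim).mul (hlim _ h0))
      rw [one_mul] at h1
      refine h1.congr' ?_
      filter_upwards [hcut (‖z.1‖ ^ 2) 4 (by norm_num), hcut (‖z.2‖ ^ 2) 2 (by norm_num)]
        with k hk1 hk2
      simp only [hw, shrinkWeight, ha, hd, hk1, hk2, one_mul]
  have hflim : ∀ z, gramDet (entryMat z.2) ≠ 0 → Filter.Tendsto (fun k => f k z) Filter.atTop
      (nhds (ENNReal.ofReal (quadLoss Sig θ (entryMat z.1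
          - (r (gramF (entryMat z.1) (entryMat z.2)) / gramF (entryMat z.1) (entryMat z.2)) •
            projField (entryMat z.1) (entryMat z.2)))
        + ENNReal.ofReal (shrinkGain (entryMat z.1) (entryMat z.2)
          (r (gramF (entryMat z.1) (entryMat z.2)) / gramF (entryMat z.1) (entryMat z.2))))) := by
    intro z hz
    have h1 := hwlim z hz
    refine (ENNReal.tendsto_ofReal ?_).add (ENNReal.tendsto_ofReal ?_)
    · exact ((continuous_quadLoss θ).tendsto _).comp (tendsto_const_nhds.sub (h1.smul_const _))
    · exact h1.mul (tendsto_const_nhds.sub (tendsto_const_nhds.mul (h1.mul_const _)))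
  calc _ ≤ ∫⁻ z, Filter.liminf (fun k => f k z) Filter.atTop ∂(pairLaw N Sig θ) := by
        refine lintegral_mono_ae ?_
        filter_upwards [ae_pairLaw_gramDet_ne_zero hSig hq θ] with z hz
        rw [(hflim z hz).liminf_eq]
    _ ≤ Filter.liminf (fun k => ∫⁻ z, f k z ∂(pairLaw N Sig θ)) Filter.atTop :=
        lintegral_liminf_le hfm
    _ ≤ Filter.liminf _ Filter.atTop := Filter.liminf_le_liminf (.of_forall hle)
    _ = _ := herr.liminf_eq

end Limit

/-! ### From the model to the law of the pair -/

section Transfer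

variable {p q N : ℕ} {Sig : Matrix (Fin p) (Fin p) ℝ}

theorem statF_transpose_mul_self (X : Matrix (Fin p) (Fin q) ℝ) (Y : Matrix (Fin N) (Fin p) ℝ) :
    statF X (Yᵀ * Y) = gramF X Y := by
  rw [statF, moorePenrose_transpose_mul_self, gramF]

theorem jamesStein_transpose_mul_self (r : ℝ → ℝ) (X : Matrix (Fin p) (Fin q) ℝ)
    (Y : Matrix (Fin N) (Fin p) ℝ) :
    jamesStein r X (Yᵀ * Y) = X - (r (gramF X Y) / gramF X Y) • projField X Y := by
  rw [jamesStein, statF_transpose_mul_self, transpose_mul_self_mul_moorePenrose, Matrix.sub_mul,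
    Matrix.one_mul, Matrix.smul_mul, projField]

/-- The risk as an integral over the law of the pair `(X, Y)` with `S = Yᵀ Y`. -/
theorem risk_eq_lintegral_pairLaw {Ω : Type*} [MeasurableSpace Ω] {n : ℕ} {P : Measure Ω}
    [IsProbabilityMeasure P] {X : Ω → Matrix (Fin p) (Fin q) ℝ} {S : Ω → Matrix (Fin p) (Fin p) ℝ}
    {θ : Matrix (Fin p) (Fin q) ℝ} (h : GaussianModel n P X S θ Sig)
    {δ : Matrix (Fin p) (Fin q) ℝ → Matrix (Fin p) (Fin p) ℝ → Matrix (Fin p) (Fin q) ℝ}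
    (hδ : ∀ i j, Measurable
      fun z : EuclideanSpace ℝ (Fin p × Fin q) × EuclideanSpace ℝ (Fin p × Fin p) =>
        δ (entryMat z.1) (entryMat z.2) i j) :
    risk P X S Sig δ θ
      = ∫⁻ z, ENNReal.ofReal (quadLoss Sig θ
          (δ (entryMat z.1) ((entryMat z.2)ᵀ * entryMat z.2))) ∂(pairLaw (n * q) Sig θ) := by
  obtain ⟨Y, hY, hSY⟩ := h.law_S
  have hX := h.law_X
  unfold IsMatrixNormal at hX hY
  set φ : EuclideanSpace ℝ (Fin (n * q) × Fin p) → EuclideanSpace ℝ (Fin p × Fin p) :=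
    fun y => entryVec ((entryMat y)ᵀ * entryMat y) with hφ
  have hφm : Measurable φ := by
    refine (WithLp.measurable_toLp 2 _).comp (measurable_pi_lambda _ fun ij => ?_)
    refine measurable_matrix_mul (M := fun y : EuclideanSpace ℝ (Fin (n * q) × Fin p) =>
      (entryMat y)ᵀ) (L := fun y => entryMat y) (fun i j => ?_) (fun i j => ?_) ij.1 ij.2
    · simp only [Matrix.transpose_apply, entryMat_apply]; fun_prop
    · simp only [entryMat_apply]; fun_prop
  have hSφ : (fun ω => entryVec (S ω)) = φ ∘ fun ω => entryVec (Y ω) := by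
    funext ω
    simp only [Function.comp_apply, hφ, entryMat_entryVec, hSY]
  have hSm : AEMeasurable (fun ω => entryVec (S ω)) P := by
    rw [hSφ]; exact hφm.comp_aemeasurable hY.aemeasurable
  have hlaw : P.map (fun ω => (entryVec (X ω), entryVec (S ω)))
      = (pairLaw (n * q) Sig θ).map (Prod.map id φ) := by
    have hSlaw : P.map (fun ω => entryVec (S ω)) = (multivariateGaussian (entryVec 0)
        ((1 : Matrix (Fin (n * q)) (Fin (n * q)) ℝ) ⊗ₖ ((q : ℝ)⁻¹ • Sig))).map φ := by
      rw [hSφ, ← AEMeasurable.map_map_of_aemeasurable hφm.aemeasurable hY.aemeasurable, hY.map_eq]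
    rw [(indepFun_iff_map_prod_eq_prod_map_map hX.aemeasurable hSm).1 h.indep, hX.map_eq, hSlaw,
      pairLaw, ← Measure.map_prod_map _ _ measurable_id hφm, Measure.map_id]
  have hm : Measurable
      fun z : EuclideanSpace ℝ (Fin p × Fin q) × EuclideanSpace ℝ (Fin p × Fin p) =>
        ENNReal.ofReal (quadLoss Sig θ (δ (entryMat z.1) (entryMat z.2))) :=
    (measurable_quadLoss θ hδ).ennreal_ofReal
  calc risk P X S Sig δ θ
      = ∫⁻ z, ENNReal.ofReal (quadLoss Sig θ (δ (entryMat z.1) (entryMat z.2)))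
          ∂(P.map fun ω => (entryVec (X ω), entryVec (S ω))) := by
        rw [lintegral_map' hm.aemeasurable (hX.aemeasurable.prodMk hSm)]
        rfl
    _ = _ := by
        rw [hlaw, lintegral_map hm (measurable_id.prodMap hφm)]
        rfl

theorem measurable_jamesStein {r : ℝ → ℝ} (hr : Measurable r) (i : Fin p) (j : Fin q) :
    Measurable fun z : EuclideanSpace ℝ (Fin p × Fin q) × EuclideanSpace ℝ (Fin p × Fin p) =>
      jamesStein r (entryMat z.1) (entryMat z.2) i j := by
  have h1 : ∀ i j, Measurable
      fun z : EuclideanSpace ℝ (Fin p × Fin q) × EuclideanSpace ℝ (Fin p × Fin p) =>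
        entryMat z.1 i j := fun i j => by simp only [entryMat_apply]; fun_prop
  have h2 : ∀ i j, Measurable
      fun z : EuclideanSpace ℝ (Fin p × Fin q) × EuclideanSpace ℝ (Fin p × Fin p) =>
        entryMat z.2 i j := fun i j => by simp only [entryMat_apply]; fun_prop
  have h3 := measurable_moorePenrose_apply h2
  have hF : Measurable
      fun z : EuclideanSpace ℝ (Fin p × Fin q) × EuclideanSpace ℝ (Fin p × Fin p) =>
        statF (entryMat z.1) (entryMat z.2) :=
    measurable_matrix_trace (measurable_matrix_mul (measurable_matrix_mul
      (fun i j => h1 j i) h3) h1)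
  exact measurable_matrix_mul (fun i j => measurable_const.sub
    (((hr.comp hF).div hF).mul (measurable_matrix_mul h2 h3 i j))) h1 i j

end Transfer

/-! ### Strictness -/

section Strict

variable {p q N : ℕ} {Sig : Matrix (Fin p) (Fin p) ℝ}

/-- The statistic `gramF` takes every positive value at pairs with `Y` of full rank. -/
theorem exists_gramF_eq (hm : 0 < min N p) (hq : 0 < q) {t : ℝ} (ht : 0 < t) :
    ∃ z : EuclideanSpace ℝ (Fin p × Fin q) × EuclideanSpace ℝ (Fin N × Fin p),
      gramDet (entryMat z.2) ≠ 0 ∧ gramF (entryMat z.1) (entryMat z.2) = t := by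
  obtain ⟨y, hy⟩ := (ae_gramDet_ne_zero (m := Fin N) (n := Fin p)).exists
  set A := moorePenrose (entryMat y) with hA
  have hA0 : A ≠ 0 := by
    intro h
    have := trace_moorePenrose_mul_self hy
    rw [← hA, h, Matrix.zero_mul, Matrix.trace_zero, Fintype.card_fin, Fintype.card_fin] at this
    exact hm.ne (by exact_mod_cast this)
  obtain ⟨i, k, hik⟩ : ∃ i k, A i k ≠ 0 := by
    by_contra! h
    exact hA0 (Matrix.ext h)
  set X : Matrix (Fin p) (Fin q) ℝ := Matrix.single i ⟨0, hq⟩ 1 with hX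
  have hF : 0 < gramF X (entryMat y) := by
    refine (gramF_nonneg _ _).lt_of_ne' fun h => ?_
    rw [gramF_eq, ← Matrix.conjTranspose_eq_transpose_of_trivial (_ * X),
      Matrix.trace_conjTranspose_mul_self_eq_zero_iff] at h
    have := congrFun (congrFun h k) ⟨0, hq⟩
    rw [hX, Matrix.mul_single_apply_same, Matrix.transpose_apply, mul_one] at this
    exact hik this
  refine ⟨(entryVec (Real.sqrt (t / gramF X (entryMat y)) • X), y), hy, ?_⟩
  rw [entryMat_entryVec]
  generalize hF' : gramF X (entryMat y) = F at hF
  rw [gramF, Matrix.transpose_smul, Matrix.smul_mul, Matrix.smul_mul, Matrix.mul_smul, smul_smul,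
    Real.mul_self_sqrt (by positivity), Matrix.trace_smul, ← gramF, hF', smul_eq_mul,
    div_mul_cancel₀ _ hF.ne']

/-- The gain has positive integral as soon as it is positive at one value of `gramF`. -/
theorem lintegral_shrinkGain_pos (hSig : Sig.PosDef) (hm : 0 < min N p) (hq : 0 < q)
    (θ : Matrix (Fin p) (Fin q) ℝ) {r : ℝ → ℝ} (hr : Measurable r)
    (hr_cont : ∀ t, 0 < t → ContinuousAt r t) {t : ℝ} (ht : 0 < t) (hrt : 0 < r t)
    (hrt' : ((N : ℝ) + p - 2 * (min N p : ℕ) + 3) / q * r t < 2 * (q * (min N p : ℕ) - 2)) :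
    0 < ∫⁻ z, ENNReal.ofReal (shrinkGain (entryMat z.1) (entryMat z.2)
          (r (gramF (entryMat z.1) (entryMat z.2)) / gramF (entryMat z.1) (entryMat z.2)))
        ∂(pairLaw N Sig θ) := by
  have h1 := isOpenPosMeasure_multivariateGaussian
    (hSig.kronecker (Matrix.PosDef.one (n := Fin q) (R := ℝ))) (entryVec θ)
  have h2 := isOpenPosMeasure_multivariateGaussian
    ((Matrix.PosDef.one (n := Fin N) (R := ℝ)).kronecker (posDef_smul_inv hSig hq)) (entryVec 0)
  have h3 : (pairLaw N Sig θ).IsOpenPosMeasure := by unfold pairLaw; infer_instance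
  obtain ⟨z₀, hz₀, hF₀⟩ := exists_gramF_eq hm hq ht
  set g : EuclideanSpace ℝ (Fin p × Fin q) × EuclideanSpace ℝ (Fin N × Fin p) → ℝ := fun z =>
    shrinkGain (entryMat z.1) (entryMat z.2)
      (r (gramF (entryMat z.1) (entryMat z.2)) / gramF (entryMat z.1) (entryMat z.2)) with hg
  have hgm : Measurable g := by
    have hw := (hr.comp (measurable_gramF (p := p) (q := q) (N := N))).div measurable_gramF
    exact hw.mul (measurable_const.sub (measurable_const.mul (hw.mul measurable_gramF)))
  have hFc := (contDiffAt_gramF hz₀).continuousAt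
  have hgc : ContinuousAt g z₀ := by
    have hw : ContinuousAt (fun z : EuclideanSpace ℝ (Fin p × Fin q) ×
        EuclideanSpace ℝ (Fin N × Fin p) => r (gramF (entryMat z.1) (entryMat z.2)) /
          gramF (entryMat z.1) (entryMat z.2)) z₀ := by
      refine ContinuousAt.div ?_ hFc (by rw [hF₀]; exact ht.ne')
      exact ContinuousAt.comp (g := r) (by rw [hF₀]; exact hr_cont t ht) hFc
    exact hw.mul (continuousAt_const.sub (continuousAt_const.mul (hw.mul hFc)))
  have hg0 : 0 < g z₀ := by
    simp only [hg, shrinkGain, Fintype.card_fin, hF₀]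
    rw [div_mul_cancel₀ _ ht.ne']
    exact mul_pos (div_pos hrt ht) (sub_pos.2 hrt')
  refine pos_iff_ne_zero.2 fun h => ?_
  rw [lintegral_eq_zero_iff hgm.ennreal_ofReal] at h
  have hmem : {z | 0 < g z} ∈ nhds z₀ := hgc.eventually (lt_mem_nhds hg0)
  refine (Measure.measure_pos_of_mem_nhds (pairLaw N Sig θ) hmem).ne' ?_
  refine measure_mono_null (fun z hz => ?_) h
  simpa using hz

end Strict

/-- A nondegenerate shrinkage function takes a value strictly between `0` and `q * b`. -/
theorem exists_mem_Ioo_of_nondegenerate {r : ℝ → ℝ} {b : ℝ} {q : ℕ} (hq : 0 < q) (hb : 0 < b)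
    (hr_bound : ∀ t, 0 < t → 0 ≤ r t ∧ r t ≤ b) (hr_cont : ∀ t, 0 < t → ContinuousAt r t)
    (h0 : ∃ t, 0 < t ∧ r t ≠ 0) (h1 : q ≠ 1 ∨ ∃ t, 0 < t ∧ r t ≠ b) :
    ∃ t, 0 < t ∧ 0 < r t ∧ r t < q * b := by
  obtain ⟨u, hu, hru⟩ := h0
  have hru0 : 0 < r u := (hr_bound u hu).1.lt_of_ne' hru
  rcases h1 with h1 | ⟨v, hv, hrv⟩
  · refine ⟨u, hu, hru0, (hr_bound u hu).2.trans_lt ?_⟩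
    have : (1 : ℝ) < q := by exact_mod_cast (by omega : 1 < q)
    exact lt_mul_of_one_lt_left hb this
  · have hq1 : (1 : ℝ) ≤ q := by exact_mod_cast hq
    have hbq : b ≤ q * b := le_mul_of_one_le_left hb.le hq1
    have hrvb : r v < b := (hr_bound v hv).2.lt_of_ne hrv
    rcases (hr_bound v hv).1.eq_or_lt with hv0 | hv0
    · have hmin : min (r u) (b / 2) ∈ Set.Icc (r v) (r u) :=
        ⟨by rw [← hv0]; exact le_min hru0.le (by positivity), min_le_left _ _⟩
      obtain ⟨t, ht, hrt⟩ := isPreconnected_Ioi.intermediate_value (Set.mem_Ioi.2 hv)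
        (Set.mem_Ioi.2 hu) (fun t ht => (hr_cont t ht).continuousWithinAt) hmin
      refine ⟨t, ht, ?_, ?_⟩
      · rw [hrt]; exact lt_min hru0 (by positivity)
      · rw [hrt]
        exact (min_le_right _ _).trans_lt (by linarith)
    · exact ⟨v, hv, hv0, hrvb.trans_le hbq⟩

/-- Let `b` be the upper bound imposed on `r`. The James–Stein estimator has risk at most that of
the maximum likelihood estimator at every `θ`; the risk is strictly smaller at some `θ` except
in the degenerate cases `r ≡ 0` on `(0, ∞)`, and `q = 1` with `r ≡ b` on `(0, ∞)`. -/
theorem mainTheorem1 {Ω : Type*} [MeasurableSpace Ω] (n p q : ℕ)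
    (Sig : Matrix (Fin p) (Fin p) ℝ) (hSig : Sig.PosDef)
    (P : Matrix (Fin p) (Fin q) ℝ → Measure Ω) [∀ θ, IsProbabilityMeasure (P θ)]
    (X : Ω → Matrix (Fin p) (Fin q) ℝ) (S : Ω → Matrix (Fin p) (Fin p) ℝ)
    (hmodel : ∀ θ, GaussianModel n (P θ) X S θ Sig)
    (hrank : ∀ θ, ∀ᵐ ω ∂(P θ), 2 < q * (S ω).rank)
    (r : ℝ → ℝ) (b : ℝ)
    (hb : b = 2 * ((q : ℝ) * (min (n * q) p : ℕ) - 2) /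
      ((n : ℝ) * q + p - 2 * (min (n * q) p : ℕ) + 3))
    (hr_bound : ∀ t, 0 < t → 0 ≤ r t ∧ r t ≤ b)
    (hr_mono : MonotoneOn r (Set.Ioi 0))
    (hr_diff : ∀ t, 0 < t → DifferentiableAt ℝ r t)
    (hr_deriv : ∃ C : ℝ, ∀ t, 0 < t → |deriv r t| ≤ C) :
    (∀ θ, risk (P θ) X S Sig (jamesStein r) θ ≤ risk (P θ) X S Sig mle θ) ∧
      ((∃ t, 0 < t ∧ r t ≠ 0) → (q ≠ 1 ∨ ∃ t, 0 < t ∧ r t ≠ b) →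
        ∃ θ, risk (P θ) X S Sig (jamesStein r) θ < risk (P θ) X S Sig mle θ) := by
  have hqm : 2 < q * min (n * q) p := by
    obtain ⟨Y, -, hY⟩ := (hmodel 0).law_S
    obtain ⟨ω, hω⟩ := (hrank 0).exists
    rw [hY, Matrix.rank_transpose_mul_self] at hω
    refine hω.trans_le (Nat.mul_le_mul_left q (le_min ?_ ?_))
    · simpa using (Y ω).rank_le_height
    · simpa using (Y ω).rank_le_width
  have hq : 0 < q := Nat.pos_of_ne_zero fun h => by simp [h] at hqm
  have hm : 0 < min (n * q) p := Nat.pos_of_ne_zero fun h => by simp [h] at hqm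
  have hqm' : (2 : ℝ) < q * (min (n * q) p : ℕ) := by exact_mod_cast hqm
  have hq' : (1 : ℝ) ≤ q := by exact_mod_cast hq
  have hc : (3 : ℝ) ≤ ((n * q : ℕ) : ℝ) + p - 2 * (min (n * q) p : ℕ) + 3 := by
    have h1 : ((min (n * q) p : ℕ) : ℝ) ≤ (n * q : ℕ) := by exact_mod_cast min_le_left _ _
    have h2 : ((min (n * q) p : ℕ) : ℝ) ≤ p := by exact_mod_cast min_le_right _ _
    linarith
  have hbc : (((n * q : ℕ) : ℝ) + p - 2 * (min (n * q) p : ℕ) + 3) * b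
      = 2 * (q * (min (n * q) p : ℕ) - 2) := by
    rw [hb, Nat.cast_mul n q, mul_div_cancel₀]
    rw [Nat.cast_mul] at hc
    linarith
  have hb0 : 0 < b := pos_of_mul_pos_right (hbc ▸ by linarith) (zero_le_three.trans hc)
  have hbq : (((n * q : ℕ) : ℝ) + p - 2 * (min (n * q) p : ℕ) + 3) / q * b
      ≤ 2 * (q * (min (n * q) p : ℕ) - 2) := by
    rw [div_mul_eq_mul_div, hbc]
    exact div_le_self (by linarith) hq'
  have hr_cont : ∀ t, 0 < t → ContinuousAt r t := fun t ht => (hr_diff t ht).continuousAt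
  -- only the values of `r` on `(0, ∞)` matter, and `r` need not be measurable outside
  set ρ : ℝ → ℝ := (Set.Ioi 0).indicator r with hρ
  have hρr : ∀ t, 0 < t → ρ t = r t := fun t ht => Set.indicator_of_mem (Set.mem_Ioi.2 ht) r
  have hρm : Measurable ρ := by
    classical
    rw [hρ, ← Set.piecewise_eq_indicator]
    exact ContinuousOn.measurable_piecewise
      (fun t ht => (hr_cont t ht).continuousWithinAt) continuousOn_const measurableSet_Ioi
  have hρb : ∀ t, 0 < t → 0 ≤ ρ t ∧ ρ t ≤ b := fun t ht => by
    rw [hρr t ht]; exact hr_bound t ht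
  have hρmono : MonotoneOn ρ (Set.Ioi 0) := fun s hs t ht hst => by
    rw [hρr s hs, hρr t ht]; exact hr_mono hs ht hst
  have hρc : ∀ t, 0 < t → ContinuousAt ρ t := fun t ht =>
    (hr_cont t ht).congr (Filter.eventuallyEq_of_mem (Ioi_mem_nhds ht) fun u hu => (hρr u hu).symm)
  have hJ : ∀ θ, risk (P θ) X S Sig (jamesStein r) θ
      = ∫⁻ z, ENNReal.ofReal (quadLoss Sig θ (entryMat z.1
          - (ρ (gramF (entryMat z.1) (entryMat z.2)) / gramF (entryMat z.1) (entryMat z.2)) •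
            projField (entryMat z.1) (entryMat z.2))) ∂(pairLaw (n * q) Sig θ) := by
    intro θ
    have h1 : risk (P θ) X S Sig (jamesStein r) θ = risk (P θ) X S Sig (jamesStein ρ) θ := by
      obtain ⟨Y, -, hY⟩ := (hmodel θ).law_S
      unfold risk
      refine lintegral_congr fun ω => ?_
      rw [hY, jamesStein_transpose_mul_self, jamesStein_transpose_mul_self]
      rcases (gramF_nonneg (X ω) (Y ω)).eq_or_lt with h | h
      · rw [← h, div_zero, div_zero]
      · rw [hρr _ h]
    rw [h1, risk_eq_lintegral_pairLaw (hmodel θ) (measurable_jamesStein hρm)]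
    simp only [jamesStein_transpose_mul_self]
  have hM : ∀ θ, risk (P θ) X S Sig mle θ
      = ∫⁻ z, ENNReal.ofReal (quadLoss Sig θ (entryMat z.1)) ∂(pairLaw (n * q) Sig θ) := by
    intro θ
    rw [risk_eq_lintegral_pairLaw (hmodel θ)]
    · rfl
    · intro i j
      simp only [mle, entryMat_apply]; fun_prop
  have hmain : ∀ θ, risk (P θ) X S Sig (jamesStein r) θ
      + ∫⁻ z, ENNReal.ofReal (shrinkGain (entryMat z.1) (entryMat z.2)
          (ρ (gramF (entryMat z.1) (entryMat z.2)) / gramF (entryMat z.1) (entryMat z.2)))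
        ∂(pairLaw (n * q) Sig θ) ≤ risk (P θ) X S Sig mle θ := by
    intro θ
    rw [hJ, hM, ← lintegral_add_left]
    · exact lintegral_quadLoss_add_shrinkGain_le hSig hq θ hρb hρmono hρc (by linarith) hbq
    · refine (measurable_quadLoss θ fun i j => ?_).ennreal_ofReal
      refine Measurable.sub ?_
        (((hρm.comp measurable_gramF).div measurable_gramF).mul (measurable_projField i j))
      simp only [entryMat_apply]; fun_prop
  refine ⟨fun θ => le_self_add.trans (hmain θ), fun h0 h1 => ⟨0, ?_⟩⟩
  obtain ⟨t, ht, hrt, hrt'⟩ := exists_mem_Ioo_of_nondegenerate hq hb0 hr_bound hr_cont h0 h1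
  have hfin : risk (P 0) X S Sig mle 0 ≠ ⊤ := by
    rw [hM]
    exact (integrable_quadLoss hSig 0).lintegral_lt_top.ne
  refine lt_of_lt_of_le ?_ (hmain 0)
  refine ENNReal.lt_add_right ((le_self_add.trans (hmain 0)).trans_lt hfin.lt_top).ne
    (lintegral_shrinkGain_pos hSig hm hq 0 hρm hρc ht ?_ ?_).ne'
  · rw [hρr t ht]; exact hrt
  · rw [hρr t ht, ← hbc, div_mul_eq_mul_div, div_lt_iff₀ (by linarith), mul_assoc, mul_comm b]
    exact mul_lt_mul_of_pos_left hrt' (by linarith)
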